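/- Let $G$ be a compact Lie group, $K\subset G$ a closed subgroup with normaliser $N_GK$, and $k\geq 1$ an integer. Suppose that either - $W=\mathrm{U}(1)$ and $c=2k$, or - $W=\mathrm{SU}(2)$ and $c=4k-1$, and that $W$ is isomorphic, as a topological group, to a closed subgroup of $N_GK/K$. Then there is a compact smooth manifold $M$ (without boundary) with a smooth action of $G$ such that - the orbit space $G\backslash M$ is connected, and $K$ is a principal isotropy group of the action; - the kernel of the action is the largest normal subgroup of $G$ contained in $K$ (so the action is effective precisely when $K$ contains no non-trivial normal subgroup of $G$); - the action has cohomogeneity $c$, that is, the principal orbits have codimension $c$ in $M$; - exactly one orbit is non-principal. Here an orbit $Gx$ is called principal if it has the maximum orbit type: for every $y\in M$ the isotropy group $G_x$ is contained in a conjugate of $G_y$; a principal isotropy group is the isotropy group of a point on a principal orbit. -/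

import Mathlib

open scoped Manifold ContDiff

universe u

/-- The group `N_G K / K`, with its quotient topology. -/
abbrev WeylGroup {G : Type*} [Group G] (K : Subgroup G) : Type _ :=
  Subgroup.normalizer (K : Set G) ⧸ K.subgroupOf (Subgroup.normalizer (K : Set G))

/-- The topological group `W` is isomorphic to a closed subgroup of the topological group `Q`
(both groups being compact Hausdorff in all uses, a continuous injective homomorphism is
automatically a closed embedding). -/
def EmbedsIn (W Q : Type*) [Group W] [TopologicalSpace W] [Group Q] [TopologicalSpace Q] : Prop :=
  ∃ φ : W →* Q, Continuous φ ∧ Function.Injective φ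

/-- The orbit `O` is principal: it has the maximum orbit type, that is, every isotropy group of a
point of `O` is contained, up to conjugacy, in the isotropy group of every point of `M`.
(The isotropy group of `g • y` is the conjugate by `g` of the isotropy group of `y`.) -/
def IsPrincipalOrbit {G M : Type*} [Group G] [MulAction G M]
    (O : MulAction.orbitRel.Quotient G M) : Prop :=
  ∀ x ∈ O.orbit, ∀ y : M, ∃ g : G, MulAction.stabilizer G x ≤ MulAction.stabilizer G (g • y)

/-- `K` is a principal isotropy group: the isotropy group of a point on a principal orbit. -/
def IsPrincipalIsotropy {G : Type*} (M : Type*) [Group G] [MulAction G M] (K : Subgroup G) : Prop :=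
  ∃ O : MulAction.orbitRel.Quotient G M, IsPrincipalOrbit O ∧
    ∃ x ∈ O.orbit, MulAction.stabilizer G x = K

/-- The dimension of the orbit of `x` under a smooth action of a `d`-dimensional Lie group `G` on
an `n`-manifold: the rank at `1` of the orbit map `g ↦ g • x`, i.e. the dimension of the tangent
space of the orbit at `x`. -/
noncomputable def orbitDim (d n : ℕ) (G : Type*) {M : Type*} [Group G]
    [TopologicalSpace G] [ChartedSpace (EuclideanSpace ℝ (Fin d)) G]
    [TopologicalSpace M] [ChartedSpace (EuclideanSpace ℝ (Fin n)) M] [MulAction G M] (x : M) : ℕ :=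
  Module.finrank ℝ (LinearMap.range
    (mfderiv (𝓡 d) (𝓡 n) (fun g : G => g • x) 1).toLinearMap)

/-- The action of the `d`-dimensional Lie group `G` on the `n`-manifold `M` has cohomogeneity `c`:
there are principal orbits, and they have codimension `c` in `M`. -/
def HasCohomogeneity (d n : ℕ) (G M : Type*) [Group G]
    [TopologicalSpace G] [ChartedSpace (EuclideanSpace ℝ (Fin d)) G]
    [TopologicalSpace M] [ChartedSpace (EuclideanSpace ℝ (Fin n)) M] [MulAction G M]
    (c : ℕ) : Prop :=
  (∃ O : MulAction.orbitRel.Quotient G M, IsPrincipalOrbit O) ∧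
    ∀ O : MulAction.orbitRel.Quotient G M, IsPrincipalOrbit O →
      ∀ x ∈ O.orbit, orbitDim d n G x + c = n

/-! Let `L` be the preimage in `N_G K` of the copy of `W` in `N_G K / K`, so that `L` is closed and
maps onto `W` with kernel `K`. If `W` acts orthogonally on `V`, then `G` acts on the compact
manifold `M = G ×_L S(V)`. The isotropy group of `[g, s]` is the conjugate by `g` of the preimage of
`W_s` in `L`, and `G\M = W\S(V)`. It therefore suffices to find a representation of `W` that is free
on the sphere except along a single orbit, which is not free.

Let `W` be the unit sphere of `D = ℂ` or `D = ℍ`, and take `V = Dᵏ ⊕ T`, where `T` is `ℂ` with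
weight two or the imaginary quaternions under conjugation. Multiplication on `Dᵏ` makes the action
free where the `Dᵏ`-component is nonzero. The remaining points form `S(T)`, on which `W` is
transitive while `-1` acts trivially. The codimension of a free orbit is `dim V - 1 - dim W`, that
is `2k` or `4k - 1`. This is `isSphereModel_prodUnitSphere` with its two instances; the passage to
`M` is `exists_manifold_of_isSphereModel`, and `EmbedsIn.exists_hom` supplies `L`.

The smooth structure on `M` needs local sections of `G → G/L`. They come from
`exists_subgroupSlice`, a form of the closed subgroup theorem: limit directions of sequences in `L`
tending to `1` are velocities of one-parameter subgroups, and a complement of these directions is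
transverse to the cosets of `L`. In slice coordinates the rank of an orbit map is `p + dim (𝔯 s)`,
where `p` is the codimension of `L` and `𝔯` is the image of the tangent space of `L` in the
endomorphisms of `V`. That `𝔯` is as large as the Lie algebra of `W` is not proved by
differentiating `L → W`: since `W` is infinite, `𝔯` is nonzero, and a nonzero conjugation-invariant
space of imaginary elements of `D` contains all of them. -/

open Filter Topology Set

/-! ### Multiplication of a Lie group in a chart at the identity -/

section LocalGroup

variable {E : Type*} [NormedAddCommGroup E] [NormedSpace ℝ E]
  {G : Type*} [Group G] [TopologicalSpace G] [ChartedSpace E G]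

/-- A smooth chart of a Lie group around the identity which sends the identity to `0`. -/
structure IsCenteredChart (φ : OpenPartialHomeomorph G E) : Prop where
  one_mem : (1 : G) ∈ φ.source
  map_one : φ 1 = 0
  contMDiffOn : ContMDiffOn 𝓘(ℝ, E) 𝓘(ℝ, E) ∞ φ φ.source
  contMDiffOn_symm : ContMDiffOn 𝓘(ℝ, E) 𝓘(ℝ, E) ∞ φ.symm φ.target

theorem exists_isCenteredChart [IsManifold 𝓘(ℝ, E) ∞ G] :
    ∃ φ : OpenPartialHomeomorph G E, IsCenteredChart φ := by
  let c := chartAt E (1 : G)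
  have hc : ContMDiffOn 𝓘(ℝ, E) 𝓘(ℝ, E) ∞ c c.source := contMDiffOn_chart
  have hc' : ContMDiffOn 𝓘(ℝ, E) 𝓘(ℝ, E) ∞ c.symm c.target := contMDiffOn_chart_symm
  refine ⟨c.transHomeomorph (Homeomorph.addRight (-c 1)), ?_, ?_, ?_, ?_⟩
  · simp [c]
  · simp
  · have h : ContMDiff 𝓘(ℝ, E) 𝓘(ℝ, E) ∞ (fun x : E => x + -c 1) :=
      (contDiff_id.add contDiff_const).contMDiff
    exact h.comp_contMDiffOn hc
  · have h : ContMDiff 𝓘(ℝ, E) 𝓘(ℝ, E) ∞ (fun x : E => x + - -c 1) :=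
      (contDiff_id.add contDiff_const).contMDiff
    exact hc'.comp h.contMDiffOn (fun x hx => by simpa using hx)

namespace IsCenteredChart

variable {φ : OpenPartialHomeomorph G E} (hφ : IsCenteredChart φ)
include hφ

theorem zero_mem : (0 : E) ∈ φ.target := hφ.map_one ▸ φ.map_source hφ.one_mem

theorem symm_zero : φ.symm 0 = 1 := by
  rw [← hφ.map_one, φ.left_inv hφ.one_mem]

theorem tendsto_symm : Tendsto φ.symm (𝓝 0) (𝓝 1) := by
  have := φ.symm.continuousAt (x := 0) hφ.zero_mem
  rwa [ContinuousAt, hφ.symm_zero] at this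

theorem tendsto : Tendsto φ (𝓝 1) (𝓝 0) := by
  have := φ.continuousAt hφ.one_mem
  rwa [ContinuousAt, hφ.map_one] at this

/-- A map into the group which is smooth in the manifold sense is smooth in the chart. -/
theorem contDiffAt_comp {X : Type*} [NormedAddCommGroup X] [NormedSpace ℝ X] {f : X → G} {x : X}
    (hf : ContMDiffAt 𝓘(ℝ, X) 𝓘(ℝ, E) ∞ f x) (hx : f x ∈ φ.source) :
    ContDiffAt ℝ ∞ (fun y => φ (f y)) x :=
  contMDiffAt_iff_contDiffAt.1
    ((hφ.contMDiffOn.contMDiffAt (φ.open_source.mem_nhds hx)).comp x hf)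

theorem contMDiffAt_symm_comp {X : Type*} [NormedAddCommGroup X] [NormedSpace ℝ X] {f : X → E}
    {x : X} (hf : ContDiffAt ℝ ∞ f x) (hx : f x ∈ φ.target) :
    ContMDiffAt 𝓘(ℝ, X) 𝓘(ℝ, E) ∞ (fun y => φ.symm (f y)) x :=
  (hφ.contMDiffOn_symm.contMDiffAt (φ.open_target.mem_nhds hx)).comp x hf.contMDiffAt

variable [LieGroup 𝓘(ℝ, E) ∞ G]

theorem contDiffAt_mul {p : E × E} (h₁ : p.1 ∈ φ.target) (h₂ : p.2 ∈ φ.target)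
    (h : φ.symm p.1 * φ.symm p.2 ∈ φ.source) :
    ContDiffAt ℝ ∞ (fun p : E × E => φ (φ.symm p.1 * φ.symm p.2)) p :=
  hφ.contDiffAt_comp ((hφ.contMDiffAt_symm_comp contDiffAt_fst h₁).mul
    (hφ.contMDiffAt_symm_comp contDiffAt_snd h₂)) h

/-- The partial derivatives are read off from `u * 1 = u` and `1 * u = u`. Strictness matters: it
compares two nearby points instead of a point with the origin. -/
theorem hasStrictFDerivAt_mul :
    HasStrictFDerivAt (fun p : E × E => φ (φ.symm p.1 * φ.symm p.2))
      (ContinuousLinearMap.fst ℝ E E + ContinuousLinearMap.snd ℝ E E) 0 := by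
  have hs : ContDiffAt ℝ ∞ (fun p : E × E => φ (φ.symm p.1 * φ.symm p.2)) 0 :=
    hφ.contDiffAt_mul hφ.zero_mem hφ.zero_mem (by simp [hφ.symm_zero, hφ.one_mem])
  have hd := hs.hasStrictFDerivAt (by simp)
  refine hd.congr_fderiv ?_
  have ht : ∀ᶠ u in 𝓝 (0 : E), u ∈ φ.target := φ.open_target.mem_nhds hφ.zero_mem
  have e₁ : (fderiv ℝ (fun p : E × E => φ (φ.symm p.1 * φ.symm p.2)) 0).comp
      (ContinuousLinearMap.inl ℝ E E) = ContinuousLinearMap.id ℝ E := by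
    have h := HasFDerivAt.comp (0 : E) (f := ContinuousLinearMap.inl ℝ E E)
      (by rw [map_zero]; exact hd.hasFDerivAt) (ContinuousLinearMap.inl ℝ E E).hasFDerivAt
    refine h.unique ((hasFDerivAt_id (0 : E)).congr_of_eventuallyEq ?_)
    filter_upwards [ht] with u hu
    simp [hφ.symm_zero, φ.right_inv hu]
  have e₂ : (fderiv ℝ (fun p : E × E => φ (φ.symm p.1 * φ.symm p.2)) 0).comp
      (ContinuousLinearMap.inr ℝ E E) = ContinuousLinearMap.id ℝ E := by
    have h := HasFDerivAt.comp (0 : E) (f := ContinuousLinearMap.inr ℝ E E)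
      (by rw [map_zero]; exact hd.hasFDerivAt) (ContinuousLinearMap.inr ℝ E E).hasFDerivAt
    refine h.unique ((hasFDerivAt_id (0 : E)).congr_of_eventuallyEq ?_)
    filter_upwards [ht] with u hu
    simp [hφ.symm_zero, φ.right_inv hu]
  ext p
  · simpa using DFunLike.congr_fun e₁ p
  · simpa using DFunLike.congr_fun e₂ p

theorem hasStrictFDerivAt_inv_mul :
    HasStrictFDerivAt (fun p : E × E => φ ((φ.symm p.1)⁻¹ * φ.symm p.2))
      (ContinuousLinearMap.snd ℝ E E - ContinuousLinearMap.fst ℝ E E) 0 := by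
  have hs : ContDiffAt ℝ ∞ (fun p : E × E => φ ((φ.symm p.1)⁻¹ * φ.symm p.2)) 0 :=
    hφ.contDiffAt_comp ((hφ.contMDiffAt_symm_comp contDiffAt_fst hφ.zero_mem).inv.mul
      (hφ.contMDiffAt_symm_comp contDiffAt_snd hφ.zero_mem))
      (by simp [hφ.symm_zero, hφ.one_mem])
  have hd := hs.hasStrictFDerivAt (by simp)
  refine hd.congr_fderiv ?_
  have ht : ∀ᶠ u in 𝓝 (0 : E), u ∈ φ.target := φ.open_target.mem_nhds hφ.zero_mem
  -- The map is constant on the diagonal, so the two partial derivatives are opposite.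
  have e₁ : (fderiv ℝ (fun p : E × E => φ ((φ.symm p.1)⁻¹ * φ.symm p.2)) 0).comp
      ((ContinuousLinearMap.id ℝ E).prod (ContinuousLinearMap.id ℝ E)) = 0 := by
    have h := HasFDerivAt.comp (0 : E)
      (f := (ContinuousLinearMap.id ℝ E).prod (ContinuousLinearMap.id ℝ E))
      (by rw [map_zero]; exact hd.hasFDerivAt)
      ((ContinuousLinearMap.id ℝ E).prod (ContinuousLinearMap.id ℝ E)).hasFDerivAt
    refine h.unique ((hasFDerivAt_const (0 : E) (0 : E)).congr_of_eventuallyEq ?_)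
    filter_upwards [ht] with u hu
    simp [hφ.map_one]
  have e₂ : (fderiv ℝ (fun p : E × E => φ ((φ.symm p.1)⁻¹ * φ.symm p.2)) 0).comp
      (ContinuousLinearMap.inr ℝ E E) = ContinuousLinearMap.id ℝ E := by
    have h := HasFDerivAt.comp (0 : E) (f := ContinuousLinearMap.inr ℝ E E)
      (by rw [map_zero]; exact hd.hasFDerivAt) (ContinuousLinearMap.inr ℝ E E).hasFDerivAt
    refine h.unique ((hasFDerivAt_id (0 : E)).congr_of_eventuallyEq ?_)
    filter_upwards [ht] with u hu
    simp [hφ.symm_zero, φ.right_inv hu]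
  ext p
  · have h₁ := DFunLike.congr_fun e₁ p
    have h₂ := DFunLike.congr_fun e₂ p
    simp only [ContinuousLinearMap.comp_apply, ContinuousLinearMap.prod_apply,
      ContinuousLinearMap.id_apply, ContinuousLinearMap.inr_apply,
      zero_apply] at h₁ h₂
    have h₃ : ((p, p) : E × E) = (p, 0) + (0, p) := by simp
    rw [h₃, map_add, h₂] at h₁
    simpa using eq_neg_of_add_eq_zero_left h₁
  · simpa using DFunLike.congr_fun e₂ p

/-- Powers of group elements near the identity are approximately multiples in the chart. -/
theorem exists_norm_pow_sub_le [ProperSpace E] {ε : ℝ} (hε : 0 < ε) :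
    ∃ δ > 0, ∃ r > 0, Metric.closedBall (0 : E) r ⊆ φ.target ∧
      ∀ x ∈ φ.source, ∀ j : ℕ, j * ‖φ x‖ ≤ δ →
      x ^ j ∈ φ.source ∧ ‖φ (x ^ j)‖ ≤ r ∧ ‖φ (x ^ j) - j • φ x‖ ≤ ε * (j * ‖φ x‖) := by
  have : IsTopologicalGroup G := topologicalGroup_of_lieGroup 𝓘(ℝ, E) ∞
  have h₁ := (hφ.hasStrictFDerivAt_mul.isLittleO.def hε)
  have h₂ : ∀ᶠ p : E × E in 𝓝 0, φ.symm p.1 * φ.symm p.2 ∈ φ.source := by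
    have : Tendsto (fun p : E × E => φ.symm p.1 * φ.symm p.2) (𝓝 0) (𝓝 (1 * 1)) :=
      (hφ.tendsto_symm.comp (continuous_fst.tendsto' _ _ rfl)).mul
        (hφ.tendsto_symm.comp (continuous_snd.tendsto' _ _ rfl))
    rw [mul_one] at this
    exact this (φ.open_source.mem_nhds hφ.one_mem)
  have h₃ : ∀ᶠ p : E × E in 𝓝 0, p.1 ∈ φ.target :=
    (continuous_fst.tendsto' (0 : E × E) 0 rfl) (φ.open_target.mem_nhds hφ.zero_mem)
  obtain ⟨r₁, hr₁, H₁⟩ := Metric.eventually_nhds_iff.1 h₁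
  obtain ⟨r₂, hr₂, H₂⟩ := Metric.eventually_nhds_iff.1 (h₂.and h₃)
  obtain ⟨r, hr, hr₁, hr₂⟩ : ∃ r > 0, r < r₁ ∧ r < r₂ :=
    ⟨min r₁ r₂ / 2, by positivity, by
      have := min_le_left r₁ r₂; linarith [lt_min hr₁ hr₂], by
      have := min_le_right r₁ r₂; linarith [lt_min hr₁ hr₂]⟩
  -- Strict differentiability between `(u, w)` and `(u, 0)` gives an error proportional to `‖w‖`
  -- alone. Hence each further multiplication by `x` costs at most `ε ‖φ x‖`, and the costs add up
  -- linearly.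
  have K : ∀ u w : E, ‖u‖ ≤ r → ‖w‖ ≤ r → φ.symm u * φ.symm w ∈ φ.source ∧
      ‖φ (φ.symm u * φ.symm w) - u - w‖ ≤ ε * ‖w‖ := by
    intro u w hu hw
    have a₁ : φ.symm u * φ.symm w ∈ φ.source :=
      (H₂ (y := (u, w)) (by rw [dist_zero_right]; exact (max_le hu hw).trans_lt hr₂)).1
    have a₂ : u ∈ φ.target :=
      (H₂ (y := (u, w)) (by rw [dist_zero_right]; exact (max_le hu hw).trans_lt hr₂)).2
    refine ⟨a₁, ?_⟩
    have := H₁ (y := ((u, w), (u, 0))) (by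
      have e : ((0 : E × E), (0 : E × E)) = 0 := rfl
      rw [e, dist_zero_right]
      refine (max_le (max_le hu hw) (max_le hu ?_)).trans_lt hr₁
      simp [hr.le])
    simpa [hφ.symm_zero, φ.right_inv a₂, Prod.norm_def] using this
  -- A power with `j ‖φ x‖ ≤ δ` has norm at most `(1 + ε) δ = r` in the chart, so the induction
  -- never leaves the ball.
  refine ⟨r / (1 + ε), by positivity, r, hr, ?_, ?_⟩
  · intro u hu
    refine (H₂ (y := (u, 0)) ?_).2
    rw [dist_zero_right]
    refine (max_le (by simpa using hu) ?_).trans_lt hr₂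
    simp [hr.le]
  · intro x hx j
    induction j with
    | zero => intro _; simp [hφ.one_mem, hφ.map_one, hr.le]
    | succ j ih =>
      intro hj
      push_cast at hj
      have hx0 := norm_nonneg (φ x)
      obtain ⟨b₁, b₂, b₃⟩ := ih (le_trans (by nlinarith) hj)
      have hδ : r / (1 + ε) ≤ r := div_le_self hr.le (by linarith)
      have hxr : ‖φ x‖ ≤ r := by
        have : (0 : ℝ) ≤ j * ‖φ x‖ := by positivity
        nlinarith
      obtain ⟨c₁, c₂⟩ := K _ _ b₂ hxr
      rw [φ.left_inv b₁, φ.left_inv hx, ← pow_succ] at c₁ c₂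
      have e : φ (x ^ (j + 1)) - (j + 1) • φ x =
          (φ (x ^ (j + 1)) - φ (x ^ j) - φ x) + (φ (x ^ j) - j • φ x) := by
        rw [add_smul, one_smul]; abel
      have d : ‖φ (x ^ (j + 1)) - (j + 1) • φ x‖ ≤ ε * ((j + 1 : ℕ) * ‖φ x‖) := by
        rw [e]
        refine (norm_add_le _ _).trans ((add_le_add c₂ b₃).trans ?_)
        push_cast
        linarith
      refine ⟨c₁, ?_, d⟩
      have f : ‖φ (x ^ (j + 1))‖ ≤ ‖φ (x ^ (j + 1)) - (j + 1) • φ x‖ + ‖(j + 1) • φ x‖ := by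
        simpa using norm_add_le (φ (x ^ (j + 1)) - (j + 1) • φ x) ((j + 1) • φ x)
      have g : ‖(j + 1) • φ x‖ = (j + 1) * ‖φ x‖ := by
        rw [← Nat.cast_smul_eq_nsmul ℝ, norm_smul, Real.norm_of_nonneg (by positivity)]; push_cast; rfl
      have i : ((j : ℝ) + 1) * ‖φ x‖ * (1 + ε) ≤ r := (le_div_iff₀ (by positivity)).1 hj
      push_cast at d
      rw [g] at f
      linarith

end IsCenteredChart

end LocalGroup

/-! ### One-parameter subgroups from tangent directions of a closed subgroup -/

/-- A continuous one-parameter subgroup. -/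
structure IsOneParam {H : Type*} [Group H] [TopologicalSpace H] (γ : ℝ → H) : Prop where
  continuous : Continuous γ
  map_add : ∀ s t, γ (s + t) = γ s * γ t

namespace IsOneParam

variable {H : Type*} [Group H] [TopologicalSpace H] {γ : ℝ → H}

theorem map_zero (h : IsOneParam γ) : γ 0 = 1 := by
  have := h.map_add 0 0
  simpa using this

theorem comp {H' : Type*} [Group H'] [TopologicalSpace H'] (h : IsOneParam γ) {f : H →* H'}
    (hf : Continuous f) : IsOneParam (fun t => f (γ t)) :=
  ⟨hf.comp h.continuous, fun s t => by simp [h.map_add]⟩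

end IsOneParam

namespace IsCenteredChart

variable {E : Type*} [NormedAddCommGroup E] [NormedSpace ℝ E]
  {G : Type*} [Group G] [TopologicalSpace G] [ChartedSpace E G] [LieGroup 𝓘(ℝ, E) ∞ G]
  {φ : OpenPartialHomeomorph G E} (hφ : IsCenteredChart φ)

-- With `j = ⌊t / r n⌋` one has `j * r n → t`, so `j • φ (x n) → t • v`, and the power estimate
-- passes to the limit.
include hφ in
theorem exists_norm_sub_le_of_tendsto_pow [ProperSpace E] [T2Space G] {F : Filter ℕ} [F.NeBot]
    {x : ℕ → G} {r : ℕ → ℝ} {v : E} (hr : ∀ n, 0 < r n) (hr0 : Tendsto r F (𝓝 0))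
    (hx : Tendsto x F (𝓝 1)) (hv : Tendsto (fun n => (r n)⁻¹ • φ (x n)) F (𝓝 v))
    {ε : ℝ} (hε : 0 < ε) :
    ∃ η > 0, ∀ t, 0 ≤ t → t < η → ∀ g, Tendsto (fun n => x n ^ ⌊t * (r n)⁻¹⌋₊) F (𝓝 g) →
      g ∈ φ.source ∧ ‖φ g - t • v‖ ≤ ε * t := by
  -- The limiting error is a multiple of `t * ‖v‖`; dividing by `‖v‖ + 1` turns it into `ε * t`,
  -- also when `v = 0`.
  obtain ⟨δ, hδ, R, hR, hball, H⟩ :=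
    hφ.exists_norm_pow_sub_le (ε := ε / (‖v‖ + 1)) (by positivity)
  refine ⟨δ / (‖v‖ + 1), by positivity, fun t ht htη g hg => ?_⟩
  have hinv : Tendsto (fun n => (r n)⁻¹) F atTop :=
    tendsto_inv_nhdsGT_zero.comp (tendsto_nhdsWithin_iff.2 ⟨hr0, Eventually.of_forall hr⟩)
  have hj : Tendsto (fun n => (⌊t * (r n)⁻¹⌋₊ : ℝ) * r n) F (𝓝 t) := by
    have := (tendsto_nat_floor_mul_div_atTop ht).comp hinv
    refine this.congr fun n => ?_
    simp [div_eq_mul_inv]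
  have hjx : Tendsto (fun n => (⌊t * (r n)⁻¹⌋₊ : ℝ) • φ (x n)) F (𝓝 (t • v)) := by
    refine (hj.smul hv).congr fun n => ?_
    rw [smul_smul, mul_assoc, mul_inv_cancel₀ (hr n).ne', mul_one]
  have hnorm : Tendsto (fun n => (⌊t * (r n)⁻¹⌋₊ : ℝ) * ‖φ (x n)‖) F (𝓝 (t * ‖v‖)) := by
    have := hjx.norm
    simpa [norm_smul, abs_of_nonneg ht] using this
  have hlt : t * ‖v‖ < δ := by
    have h₁ : t * (‖v‖ + 1) < δ := (lt_div_iff₀ (by positivity)).1 htη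
    nlinarith
  have hev : ∀ᶠ n in F, x n ^ ⌊t * (r n)⁻¹⌋₊ ∈ φ.source ∧ ‖φ (x n ^ ⌊t * (r n)⁻¹⌋₊)‖ ≤ R ∧
      ‖φ (x n ^ ⌊t * (r n)⁻¹⌋₊) - (⌊t * (r n)⁻¹⌋₊ : ℝ) • φ (x n)‖ ≤
        ε / (‖v‖ + 1) * (⌊t * (r n)⁻¹⌋₊ * ‖φ (x n)‖) := by
    filter_upwards [hnorm.eventually_lt_const hlt, hx (φ.open_source.mem_nhds hφ.one_mem)]
      with n h₁ h₂
    have := H (x n) h₂ _ h₁.le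
    rwa [← Nat.cast_smul_eq_nsmul ℝ] at this
  -- The powers stay in a compact part of the chart domain, so their limit cannot escape from it.
  have hcl : IsClosed (φ.symm '' Metric.closedBall 0 R) :=
    ((isCompact_closedBall (0 : E) R).image_of_continuousOn
      (φ.symm.continuousOn.mono hball)).isClosed
  have hgm : g ∈ φ.symm '' Metric.closedBall 0 R := by
    refine hcl.mem_of_tendsto hg (hev.mono fun n hn => ?_)
    exact ⟨_, by simpa using hn.2.1, φ.left_inv hn.1⟩
  have hgs : g ∈ φ.source := by
    obtain ⟨u, hu, rfl⟩ := hgm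
    exact φ.map_target (hball hu)
  refine ⟨hgs, ?_⟩
  have hlim := (((φ.continuousAt hgs).tendsto.comp hg).sub hjx).norm
  have := le_of_tendsto_of_tendsto hlim (hnorm.const_mul (ε / (‖v‖ + 1)))
    (hev.mono fun n hn => hn.2.2)
  refine this.trans ?_
  have : ε / (‖v‖ + 1) * (‖v‖ + 1) = ε := by field_simp
  have h0 : 0 ≤ ε / (‖v‖ + 1) * t := by positivity
  calc ε / (‖v‖ + 1) * (t * ‖v‖) = ε / (‖v‖ + 1) * t * ‖v‖ := by ring
    _ ≤ ε / (‖v‖ + 1) * t * (‖v‖ + 1) := by gcongr; linarith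
    _ = ε * t := by rw [mul_right_comm, this]

/-- Tangent directions at the identity of a closed subgroup of a compact Lie group are
velocities of one-parameter subgroups. -/
theorem exists_isOneParam_of_tendsto [ProperSpace E] [CompactSpace G] [T2Space G]
    (hφ : IsCenteredChart φ)
    {L : Subgroup G} (hL : IsClosed (L : Set G)) {x : ℕ → G} (hxL : ∀ n, x n ∈ L)
    {r : ℕ → ℝ} {v : E} (hr : ∀ n, 0 < r n) (hr0 : Tendsto r atTop (𝓝 0))
    (hx : Tendsto x atTop (𝓝 1)) (hv : Tendsto (fun n => (r n)⁻¹ • φ (x n)) atTop (𝓝 v)) :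
    ∃ γ : ℝ → L, IsOneParam γ ∧ HasDerivAt (fun t => φ (γ t)) v 0 := by
  have : IsTopologicalGroup G := topologicalGroup_of_lieGroup 𝓘(ℝ, E) ∞
  -- Along an ultrafilter on a compact group the powers `x n ^ ⌊t / r n⌋` converge for all real `t`
  -- simultaneously, without a choice of subsequences.
  let F : Filter ℕ := hyperfilter ℕ
  have hF : F ≤ atTop := Nat.hyperfilter_le_atTop
  have hx' : Tendsto x F (𝓝 1) := hx.mono_left hF
  have hex : ∀ t : ℝ, ∃ g : G, Tendsto (fun n => x n ^ ⌊t * (r n)⁻¹⌋) F (𝓝 g) := fun t =>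
    ⟨_, Ultrafilter.le_nhds_lim ((hyperfilter ℕ).map fun n => x n ^ ⌊t * (r n)⁻¹⌋)⟩
  choose g hg using hex
  have hgL : ∀ t, g t ∈ L := fun t =>
    hL.mem_of_tendsto (hg t) (Eventually.of_forall fun n => L.zpow_mem (hxL n) _)
  have hadd : ∀ s t, g (s + t) = g s * g t := by
    intro s t
    -- The floor function fails to be additive by `0` or `1` only, and `x n` itself tends to `1`.
    have h₁ : Tendsto (fun n => x n ^ (⌊(s + t) * (r n)⁻¹⌋ - ⌊s * (r n)⁻¹⌋ - ⌊t * (r n)⁻¹⌋))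
        F (𝓝 1) := by
      rw [tendsto_iff_forall_eventually_mem]
      intro U hU
      filter_upwards [hx' hU] with n hn
      have a₁ := Int.le_floor_add (s * (r n)⁻¹) (t * (r n)⁻¹)
      have a₂ := Int.le_floor_add_floor (s * (r n)⁻¹) (t * (r n)⁻¹)
      rw [← add_mul] at a₁ a₂
      have a₃ : ⌊(s + t) * (r n)⁻¹⌋ - ⌊s * (r n)⁻¹⌋ - ⌊t * (r n)⁻¹⌋ = 0 ∨
        ⌊(s + t) * (r n)⁻¹⌋ - ⌊s * (r n)⁻¹⌋ - ⌊t * (r n)⁻¹⌋ = 1 := by omega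
      rcases a₃ with a | a <;> rw [a]
      · simpa using mem_of_mem_nhds hU
      · simpa using hn
    have h₂ := ((hg s).mul (hg t)).mul h₁
    rw [mul_one] at h₂
    refine tendsto_nhds_unique (hg (s + t)) (h₂.congr fun n => ?_)
    rw [← zpow_add, ← zpow_add]
    congr 1
    ring
  have hneg : ∀ t, g (-t) = (g t)⁻¹ := by
    have h0 : g 0 = 1 := by simpa using hadd 0 0
    intro t
    rw [eq_inv_iff_mul_eq_one, ← hadd, neg_add_cancel, h0]
  have hpos : ∀ t, 0 ≤ t → Tendsto (fun n => x n ^ ⌊t * (r n)⁻¹⌋₊) F (𝓝 (g t)) := by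
    intro t ht
    refine (hg t).congr fun n => ?_
    rw [← Int.natCast_floor_eq_floor (mul_nonneg ht (inv_pos.2 (hr n)).le), zpow_natCast]
  -- The inverse sequence has direction `-v`; it controls the negative times.
  have hv' : Tendsto (fun n => (r n)⁻¹ • φ (x n)⁻¹) atTop (𝓝 (-v)) := by
    have d : HasFDerivAt (fun u : E => φ ((φ.symm u)⁻¹ * φ.symm 0)) (-ContinuousLinearMap.id ℝ E)
        0 := by
      have := HasFDerivAt.comp (0 : E) (f := ContinuousLinearMap.inl ℝ E E)
        (by rw [_root_.map_zero]; exact hφ.hasStrictFDerivAt_inv_mul.hasFDerivAt)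
        (ContinuousLinearMap.inl ℝ E E).hasFDerivAt
      refine this.congr_fderiv ?_
      ext; simp
    have := (hasFDerivWithinAt_univ.2 d).lim (l := atTop) (c := fun n => (r n)⁻¹)
      (d := fun n => φ (x n)) (v := v) (hφ.tendsto.comp hx) (Eventually.of_forall fun _ => mem_univ _)
      hv
    refine Tendsto.congr' ?_ this
    filter_upwards [hx (φ.open_source.mem_nhds hφ.one_mem)] with n hn
    simp [hφ.symm_zero, hφ.map_one, φ.left_inv hn]
  have hest : ∀ ε > 0, ∃ η > 0, ∀ t, |t| < η → g t ∈ φ.source ∧ ‖φ (g t) - t • v‖ ≤ ε * |t| := by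
    intro ε hε
    obtain ⟨η₁, hη₁, H₁⟩ := hφ.exists_norm_sub_le_of_tendsto_pow hr (hr0.mono_left hF) hx'
      (hv.mono_left hF) hε
    obtain ⟨η₂, hη₂, H₂⟩ := hφ.exists_norm_sub_le_of_tendsto_pow (x := fun n => (x n)⁻¹) hr
      (hr0.mono_left hF) (by simpa using hx'.inv) (hv'.mono_left hF) hε
    refine ⟨min η₁ η₂, lt_min hη₁ hη₂, fun t ht => ?_⟩
    rcases le_total 0 t with h | h
    · rw [abs_of_nonneg h] at ht ⊢
      exact H₁ t h (ht.trans_le (min_le_left _ _)) _ (hpos t h)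
    · rw [abs_of_nonpos h] at ht ⊢
      have := H₂ (-t) (by linarith) (ht.trans_le (min_le_right _ _)) (g t) (by
        have := (hpos (-t) (by linarith)).inv
        rw [hneg, inv_inv] at this
        simpa using this)
      simpa using this
  have hder : HasDerivAt (fun t => φ (g t)) v 0 := by
    have h0 : g 0 = 1 := by simpa using hadd 0 0
    rw [hasDerivAt_iff_isLittleO, Asymptotics.isLittleO_iff]
    intro ε hε
    obtain ⟨η, hη, H⟩ := hest ε hε
    filter_upwards [Metric.ball_mem_nhds (0 : ℝ) hη] with t ht
    simpa [h0, hφ.map_one] using (H t (by simpa using ht)).2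
  have hcont0 : Tendsto g (𝓝 0) (𝓝 1) := by
    have h0 : g 0 = 1 := by simpa using hadd 0 0
    have h₁ : Tendsto (fun t => φ (g t)) (𝓝 0) (𝓝 0) := by
      have := hder.continuousAt.tendsto
      simpa [h0, hφ.map_one] using this
    refine Tendsto.congr' ?_ (hφ.tendsto_symm.comp h₁)
    obtain ⟨η, hη, H⟩ := hest 1 one_pos
    filter_upwards [Metric.ball_mem_nhds (0 : ℝ) hη] with t ht
    exact φ.left_inv (H t (by simpa using ht)).1
  have hcont : Continuous g := by
    rw [continuous_iff_continuousAt]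
    intro t₀
    have h₁ : Tendsto (fun t => g t₀ * g (t - t₀)) (𝓝 t₀) (𝓝 (g t₀ * 1)) :=
      (hcont0.comp ((continuous_sub_right t₀).tendsto' _ _ (sub_self _))).const_mul _
    rw [mul_one] at h₁
    refine h₁.congr fun t => ?_
    rw [← hadd]; simp
  exact ⟨fun t => ⟨g t, hgL t⟩, ⟨hcont.subtype_mk _, fun s t => Subtype.ext (hadd s t)⟩, hder⟩

end IsCenteredChart

/-! ### Smoothness of one-parameter subgroups -/

section OneParamSmooth

variable {E : Type*} [NormedAddCommGroup E] [NormedSpace ℝ E]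
  {G : Type*} [Group G] [TopologicalSpace G] [ChartedSpace E G] [LieGroup 𝓘(ℝ, E) ∞ G]
  {φ : OpenPartialHomeomorph G E}

/-- A one-parameter subgroup which is differentiable at `0` is smooth. -/
theorem IsOneParam.contMDiff (hφ : IsCenteredChart φ) {γ : ℝ → G} (hγ : IsOneParam γ) {v : E}
    (hv : HasDerivAt (fun t => φ (γ t)) v 0) : ContMDiff 𝓘(ℝ, ℝ) 𝓘(ℝ, E) ∞ γ := by
  set f : ℝ → E := fun t => φ (γ t) with hf
  set μ : E × E → E := fun p => φ (φ.symm p.1 * φ.symm p.2) with hμ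
  set U : Set ℝ := γ ⁻¹' φ.source with hU
  have hUo : IsOpen U := φ.open_source.preimage hγ.continuous
  have h0U : (0 : ℝ) ∈ U := by simp [hU, hγ.map_zero, hφ.one_mem]
  have hf0 : f 0 = 0 := by simp [hf, hγ.map_zero, hφ.map_one]
  have hμs : ∀ u ∈ φ.target, ContDiffAt ℝ ∞ μ (u, 0) := fun u hu =>
    hφ.contDiffAt_mul hu hφ.zero_mem (by simpa [hφ.symm_zero] using φ.map_target hu)
  -- From `γ (t + s) = γ t * γ s`, the curve solves an autonomous equation `f' = X ∘ f`, where `X`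
  -- is the left-invariant vector field with value `v` at the identity. As `X` is smooth, `f` gains
  -- one derivative at each turn of the induction below.
  have hder : ∀ t ∈ U, HasDerivAt f (fderiv ℝ μ (f t, 0) (0, v)) t := by
    intro t ht
    have hd := (hμs (f t) (φ.map_source ht)).differentiableAt (by simp)
    have h₁ : HasDerivAt (fun s => ((f t, f s) : E × E)) (0, v) 0 :=
      (hasDerivAt_const (0 : ℝ) (f t)).prodMk hv
    have h₂ : HasDerivAt (fun s => μ (f t, f s)) (fderiv ℝ μ (f t, 0) (0, v)) 0 := by
      have hd' : HasFDerivAt μ (fderiv ℝ μ (f t, 0)) (f t, f 0) := by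
        rw [hf0]; exact hd.hasFDerivAt
      exact hd'.comp_hasDerivAt (0 : ℝ) h₁
    have h₃ : HasDerivAt (fun s => f (t + s)) (fderiv ℝ μ (f t, 0) (0, v)) 0 := by
      refine h₂.congr_of_eventuallyEq ?_
      filter_upwards [hUo.mem_nhds h0U] with s hs
      simp only [hμ, hf]
      rw [φ.left_inv ht, φ.left_inv hs, hγ.map_add]
    have h₄ : HasDerivAt (fun s => f (t + s)) (fderiv ℝ μ (f t, 0) (0, v)) (t - t) := by
      rwa [sub_self]
    have := h₄.comp_sub_const t t
    simpa using this
  have hX : ContDiffOn ℝ ∞ (fun u => fderiv ℝ μ (u, 0) (0, v)) φ.target := by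
    intro u hu
    refine ContDiffAt.contDiffWithinAt ?_
    have h₁ : ContDiffAt ℝ ∞ (fun u => fderiv ℝ μ (u, 0)) u :=
      ((hμs u hu).fderiv_right (m := ∞) (by simp)).comp (f := fun u : E => (u, (0 : E))) u
        (contDiffAt_id.prodMk contDiffAt_const)
    exact h₁.clm_apply contDiffAt_const
  have hfn : ∀ n : ℕ, ContDiffOn ℝ n f U := by
    intro n
    induction n with
    | zero =>
      rw [Nat.cast_zero, contDiffOn_zero]
      exact fun t ht => (hder t ht).continuousAt.continuousWithinAt
    | succ n ih =>
      rw [Nat.cast_succ, contDiffOn_succ_iff_deriv_of_isOpen hUo]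
      refine ⟨fun t ht => (hder t ht).differentiableAt.differentiableWithinAt, by simp, ?_⟩
      refine ContDiffOn.congr ?_ (fun t ht => (hder t ht).deriv)
      exact (hX.of_le (by exact_mod_cast le_top)).comp ih (fun t ht => φ.map_source ht)
  have hfs : ContDiffOn ℝ ∞ f U := contDiffOn_infty.2 hfn
  have hat0 : ContMDiffAt 𝓘(ℝ, ℝ) 𝓘(ℝ, E) ∞ γ 0 := by
    refine ContMDiffAt.congr_of_eventuallyEq (hφ.contMDiffAt_symm_comp
      (hfs.contDiffAt (hUo.mem_nhds h0U)) (φ.map_source h0U)) ?_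
    filter_upwards [hUo.mem_nhds h0U] with t ht
    exact (φ.left_inv ht).symm
  intro t₀
  have h₁ : ContMDiffAt 𝓘(ℝ, ℝ) 𝓘(ℝ, E) ∞ (fun t => γ (t - t₀)) t₀ := by
    refine ContMDiffAt.comp t₀ (g := γ) (by simpa using hat0) (ContDiffAt.contMDiffAt ?_)
    exact contDiffAt_id.sub contDiffAt_const
  refine ((contMDiffAt_const (c := γ t₀)).mul h₁).congr_of_eventuallyEq
    (Eventually.of_forall fun t => ?_)
  change γ t = γ t₀ * γ (t - t₀)
  rw [← hγ.map_add, add_sub_cancel]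

/-- A continuous homomorphism from the real line to the units of a Banach algebra is smooth. -/
theorem contDiff_of_map_add_eq_mul {A : Type*} [NormedRing A] [NormedAlgebra ℝ A] [CompleteSpace A]
    {h : ℝ → A} (hc : Continuous h) (h0 : h 0 = 1) (hadd : ∀ s t, h (s + t) = h s * h t) :
    ContDiff ℝ ∞ h := by
  set J : ℝ → A := fun t => ∫ s in (0 : ℝ)..t, h s with hJ
  have hJd : ∀ t, HasDerivAt J (h t) t := fun t => hc.integral_hasStrictDerivAt 0 t |>.hasDerivAt
  -- The mean `J t / t` tends to `h 0 = 1`, and the units are open.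
  obtain ⟨ε, hε0, hε⟩ : ∃ ε : ℝ, ε ≠ 0 ∧ IsUnit (J ε) := by
    have h₁ := (hasDerivAt_iff_tendsto_slope_zero.1 (hJd 0))
    rw [h0] at h₁
    have h₂ : ∀ᶠ t in 𝓝[≠] (0 : ℝ), IsUnit (t⁻¹ • (J (0 + t) - J 0)) :=
      h₁ (Units.isOpen.mem_nhds isUnit_one)
    obtain ⟨t, ht, ht0⟩ := (h₂.and self_mem_nhdsWithin).exists
    refine ⟨t, ht0, ?_⟩
    have : J t = t • (t⁻¹ • (J (0 + t) - J 0)) := by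
      rw [smul_smul, mul_inv_cancel₀ ht0, one_smul]; simp [hJ]
    rw [this]
    have e : t • (t⁻¹ • (J (0 + t) - J 0)) = algebraMap ℝ A t * (t⁻¹ • (J (0 + t) - J 0)) := by
      rw [Algebra.smul_def]
    rw [e]
    exact ((Ne.isUnit ht0).map _).mul ht
  -- Integrating `h (t + s) = h t * h s` over `s` gives `J (t + ε) - J t = h t * J ε`. So `h` is as
  -- smooth as its own primitive.
  have hH : ∀ t, h t = (J (t + ε) - J t) * (↑(hε.unit⁻¹) : A) := by
    intro t
    have : J (t + ε) - J t = h t * J ε := by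
      have a₁ : J (t + ε) - J t = ∫ s in t..(t + ε), h s := by
        rw [sub_eq_iff_eq_add', hJ]
        exact (intervalIntegral.integral_add_adjacent_intervals (hc.intervalIntegrable _ _)
          (hc.intervalIntegrable _ _)).symm
      have a₂ : ∫ s in t..(t + ε), h s = ∫ s in (0 : ℝ)..ε, h (t + s) := by
        rw [intervalIntegral.integral_comp_add_left (fun s => h s) t]; simp
      rw [a₁, a₂]
      simp_rw [hadd]
      exact (ContinuousLinearMap.intervalIntegral_comp_comm
        (ContinuousLinearMap.mul ℝ A (h t)) (hc.intervalIntegrable _ _))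
    rw [this, mul_assoc, IsUnit.mul_val_inv, mul_one]
  refine contDiff_infty.2 fun n => ?_
  induction n with
  | zero => exact contDiff_zero.2 hc
  | succ n ih =>
    have hJn : ContDiff ℝ (n + 1) J := by
      rw [contDiff_succ_iff_deriv]
      refine ⟨fun t => (hJd t).differentiableAt, by simp, ?_⟩
      rwa [funext fun t => (hJd t).deriv]
    have : h = fun t => (J (t + ε) - J t) * (↑(hε.unit⁻¹) : A) := funext hH
    rw [this, Nat.cast_succ]
    exact ((hJn.comp (contDiff_id.add contDiff_const)).sub hJn).mul contDiff_const

end OneParamSmooth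

/-! ### Products of one-parameter subgroups -/

section ProdParam

/-- The ordered product of finitely many curves in a monoid. -/
def prodParam {H : Type*} [Monoid H] {l : ℕ} (γ : Fin l → ℝ → H) (a : Fin l → ℝ) : H :=
  (List.ofFn fun i => γ i (a i)).prod

theorem prodParam_succ {H : Type*} [Monoid H] {l : ℕ} (γ : Fin (l + 1) → ℝ → H)
    (a : Fin (l + 1) → ℝ) :
    prodParam γ a = γ 0 (a 0) * prodParam (fun i => γ i.succ) (fun i => a i.succ) := by
  simp [prodParam, List.ofFn_succ]

theorem map_prodParam {H H' : Type*} [Monoid H] [Monoid H'] (f : H →* H') {l : ℕ}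
    (γ : Fin l → ℝ → H) (a : Fin l → ℝ) :
    f (prodParam γ a) = prodParam (fun i t => f (γ i t)) a := by
  simp [prodParam, map_list_prod, List.map_ofFn, Function.comp_def]

theorem prodParam_zero {H : Type*} [Group H] [TopologicalSpace H] {l : ℕ} {γ : Fin l → ℝ → H}
    (hγ : ∀ i, IsOneParam (γ i)) : prodParam γ 0 = 1 := by
  simp [prodParam, (hγ _).map_zero]

theorem prodParam_eq_one {H : Type*} [Monoid H] {l : ℕ} {γ : Fin l → ℝ → H}
    (hγ : ∀ i t, γ i t = 1) (a : Fin l → ℝ) : prodParam γ a = 1 := by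
  simp [prodParam, hγ]

theorem contDiff_prodParam {A : Type*} [NormedRing A] [NormedAlgebra ℝ A] {l : ℕ}
    {γ : Fin l → ℝ → A} (hγ : ∀ i, ContDiff ℝ ∞ (γ i)) : ContDiff ℝ ∞ (prodParam γ) := by
  induction l with
  | zero =>
    have : prodParam γ = fun _ => 1 := funext fun a => by simp [prodParam]
    rw [this]; exact contDiff_const
  | succ l ih =>
    rw [funext (prodParam_succ γ)]
    refine ((hγ 0).comp (contDiff_apply ℝ ℝ 0)).mul ((ih fun i => hγ i.succ).comp ?_)
    exact contDiff_pi.2 fun i => contDiff_apply ℝ ℝ i.succ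

variable {E : Type*} [NormedAddCommGroup E] [NormedSpace ℝ E]
  {G : Type*} [Group G] [TopologicalSpace G] [ChartedSpace E G] [LieGroup 𝓘(ℝ, E) ∞ G]
  {φ : OpenPartialHomeomorph G E}

theorem contMDiff_prodParam {l : ℕ} {γ : Fin l → ℝ → G}
    (hγ : ∀ i, ContMDiff 𝓘(ℝ, ℝ) 𝓘(ℝ, E) ∞ (γ i)) :
    ContMDiff 𝓘(ℝ, Fin l → ℝ) 𝓘(ℝ, E) ∞ (prodParam γ) := by
  induction l with
  | zero =>
    have : prodParam γ = fun _ => 1 := funext fun a => by simp [prodParam]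
    rw [this]; exact contMDiff_const
  | succ l ih =>
    rw [funext (prodParam_succ γ)]
    refine ((hγ 0).comp (contDiff_apply ℝ ℝ 0).contMDiff).mul
      ((ih fun i => hγ i.succ).comp (ContDiff.contMDiff ?_))
    exact contDiff_pi.2 fun i => contDiff_apply ℝ ℝ i.succ

theorem IsCenteredChart.hasFDerivAt_mul (hφ : IsCenteredChart φ) {X : Type*}
    [NormedAddCommGroup X] [NormedSpace ℝ X] {f g : X → G} {f' g' : X →L[ℝ] E} {x : X}
    (hf1 : f x = 1) (hg1 : g x = 1) (hfc : ContinuousAt f x) (hgc : ContinuousAt g x)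
    (hf : HasFDerivAt (fun y => φ (f y)) f' x) (hg : HasFDerivAt (fun y => φ (g y)) g' x) :
    HasFDerivAt (fun y => φ (f y * g y)) (f' + g') x := by
  have h₁ : HasFDerivAt (fun p : E × E => φ (φ.symm p.1 * φ.symm p.2))
      (ContinuousLinearMap.fst ℝ E E + ContinuousLinearMap.snd ℝ E E) (φ (f x), φ (g x)) := by
    rw [hf1, hg1, hφ.map_one]; exact hφ.hasStrictFDerivAt_mul.hasFDerivAt
  have h₂ := HasFDerivAt.comp x h₁ (hf.prodMk hg)
  refine (h₂.congr_fderiv (by ext; simp)).congr_of_eventuallyEq ?_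
  have hs : φ.source ∈ 𝓝 (1 : G) := φ.open_source.mem_nhds hφ.one_mem
  filter_upwards [hfc.preimage_mem_nhds (hf1 ▸ hs), hgc.preimage_mem_nhds (hg1 ▸ hs)] with y h h'
  simp only [Function.comp]
  rw [φ.left_inv h, φ.left_inv h']

theorem hasFDerivAt_prodParam (hφ : IsCenteredChart φ) {l : ℕ} {γ : Fin l → ℝ → G}
    (hγ : ∀ i, IsOneParam (γ i)) {v : Fin l → E}
    (hv : ∀ i, HasDerivAt (fun t => φ (γ i t)) (v i) 0) :
    HasFDerivAt (fun a => φ (prodParam γ a))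
      (∑ i, (ContinuousLinearMap.proj (R := ℝ) (φ := fun _ : Fin l => ℝ) i).smulRight (v i)) 0 := by
  have : IsTopologicalGroup G := topologicalGroup_of_lieGroup 𝓘(ℝ, E) ∞
  induction l with
  | zero =>
    have : (fun a => φ (prodParam γ a)) = fun _ => φ 1 := funext fun a => by simp [prodParam]
    rw [this]; simpa using hasFDerivAt_const (φ 1) (0 : Fin 0 → ℝ)
  | succ l ih =>
    rw [funext fun a => congrArg φ (prodParam_succ γ a)]
    have hp : ContMDiff 𝓘(ℝ, Fin l → ℝ) 𝓘(ℝ, E) ∞ (prodParam fun i => γ i.succ) :=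
      contMDiff_prodParam fun i => (hγ i.succ).contMDiff hφ (hv i.succ)
    have h₁ : HasFDerivAt (fun a : Fin (l + 1) → ℝ => φ (γ 0 (a 0)))
        ((ContinuousLinearMap.proj (R := ℝ) (φ := fun _ : Fin (l + 1) => ℝ) 0).smulRight (v 0))
        0 := by
      have := HasFDerivAt.comp (0 : Fin (l + 1) → ℝ) (hv 0).hasFDerivAt
        (ContinuousLinearMap.proj (R := ℝ) (φ := fun _ : Fin (l + 1) => ℝ) 0).hasFDerivAt
      refine this.congr_fderiv ?_
      ext; simp
    let tl : (Fin (l + 1) → ℝ) →L[ℝ] (Fin l → ℝ) :=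
      ContinuousLinearMap.pi fun i => ContinuousLinearMap.proj i.succ
    have h₂ := HasFDerivAt.comp (0 : Fin (l + 1) → ℝ) (f := tl)
      (by rw [map_zero]; exact ih (fun i => hγ i.succ) (fun i => hv i.succ)) tl.hasFDerivAt
    refine (hφ.hasFDerivAt_mul ?_ ?_ ?_ ?_ h₁ h₂).congr_fderiv ?_
    · simp [(hγ 0).map_zero]
    · exact prodParam_zero fun i => hγ i.succ
    · exact ((hγ 0).continuous.comp (continuous_apply 0)).continuousAt
    · exact (hp.continuous.comp tl.continuous).continuousAt
    · ext a
      simp [Fin.sum_univ_succ, tl]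

end ProdParam

/-! ### Slices transverse to a closed subgroup -/

section Slice

variable {E : Type*} [NormedAddCommGroup E] [NormedSpace ℝ E]
  {G : Type*} [Group G] [TopologicalSpace G] [ChartedSpace E G]

/-- A local cross-section of the projection `G → G ⧸ L`: a smooth local parametrization
`Θ (b, a) = σ b * (γ₁ a₁ ⋯ γₗ aₗ)` of the Lie group `G` near the identity, with one-parameter
subgroups `γᵢ` of `L`, such that `σ` meets each coset of `L` at most once. -/
structure SubgroupSlice (L : Subgroup G) (p l : ℕ) where
  σ : EuclideanSpace ℝ (Fin p) → G
  γ : Fin l → ℝ → L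
  Θ : OpenPartialHomeomorph (EuclideanSpace ℝ (Fin p) × (Fin l → ℝ)) G
  B : Set (EuclideanSpace ℝ (Fin p))
  isOneParam : ∀ i, IsOneParam (γ i)
  contMDiff_γ : ContMDiff 𝓘(ℝ, Fin l → ℝ) 𝓘(ℝ, E) ∞ fun a => ((prodParam γ a : L) : G)
  Θ_apply : ∀ x ∈ Θ.source, Θ x = σ x.1 * (prodParam γ x.2 : L)
  contMDiffOn_Θ : ContMDiffOn 𝓘(ℝ, EuclideanSpace ℝ (Fin p) × (Fin l → ℝ)) 𝓘(ℝ, E) ∞ Θ Θ.source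
  contMDiffOn_Θ_symm :
    ContMDiffOn 𝓘(ℝ, E) 𝓘(ℝ, EuclideanSpace ℝ (Fin p) × (Fin l → ℝ)) ∞ Θ.symm Θ.target
  isOpen_B : IsOpen B
  zero_mem_B : 0 ∈ B
  mem_source : ∀ b ∈ B, (b, 0) ∈ Θ.source
  σ_zero : σ 0 = 1
  eq_of_mem : ∀ b ∈ B, ∀ b' ∈ B, (σ b)⁻¹ * σ b' ∈ L → b = b'

variable [LieGroup 𝓘(ℝ, E) ∞ G] {φ : OpenPartialHomeomorph G E}

/-- The velocities, in a chart, of the one-parameter subgroups of a closed subgroup. -/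
def IsCenteredChart.tangentSubmodule [ProperSpace E] [CompactSpace G] [T2Space G]
    (hφ : IsCenteredChart φ) {L : Subgroup G} (hL : IsClosed (L : Set G)) : Submodule ℝ E where
  carrier := {v | ∃ γ : ℝ → L, IsOneParam γ ∧ HasDerivAt (fun t => φ (γ t)) v 0}
  zero_mem' := ⟨fun _ => 1, ⟨continuous_const, by simp⟩, by
    simpa using hasDerivAt_const (0 : ℝ) (φ 1)⟩
  smul_mem' := by
    rintro c v ⟨γ, hγ, hv⟩
    refine ⟨fun t => γ (c * t), ⟨hγ.continuous.comp (continuous_const.mul continuous_id),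
      fun s t => by rw [mul_add, hγ.map_add]⟩, ?_⟩
    have h : HasDerivAt (fun t : ℝ => c * t) c 0 := by
      simpa using (hasDerivAt_id (0 : ℝ)).const_mul c
    exact HasDerivAt.scomp (0 : ℝ) (h := fun t : ℝ => c * t) (by simpa using hv) h
  add_mem' := by
    rintro v w ⟨γ, hγ, hv⟩ ⟨γ', hγ', hw⟩
    have hc := continuous_subtype_val.comp hγ.continuous
    have hc' := continuous_subtype_val.comp hγ'.continuous
    have : IsTopologicalGroup G := topologicalGroup_of_lieGroup 𝓘(ℝ, E) ∞
    have h₁ : HasDerivAt (fun t => φ (γ t * γ' t : G)) (v + w) 0 := by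
      have := (hφ.hasFDerivAt_mul (f := fun t => (γ t : G)) (g := fun t => (γ' t : G)) (x := (0 : ℝ))
        (by simp [hγ.map_zero]) (by simp [hγ'.map_zero]) hc.continuousAt
        hc'.continuousAt hv.hasFDerivAt hw.hasFDerivAt).hasDerivAt
      simpa using this
    have hr : Tendsto (fun n : ℕ => 1 / ((n : ℝ) + 1)) atTop (𝓝[≠] 0) :=
      tendsto_nhdsWithin_iff.2 ⟨tendsto_one_div_add_atTop_nhds_zero_nat,
        Eventually.of_forall fun n => by
          have : (0 : ℝ) < 1 / ((n : ℝ) + 1) := by positivity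
          exact this.ne'⟩
    -- The product curve `γ * γ'` need not be a one-parameter subgroup, but its values at `1 / (n +
    -- 1)` form a sequence in `L` with limiting direction `v + w`.
    refine hφ.exists_isOneParam_of_tendsto hL (r := fun n : ℕ => 1 / ((n : ℝ) + 1))
      (x := fun n : ℕ => γ (1 / ((n : ℝ) + 1)) * γ' (1 / ((n : ℝ) + 1)))
      (fun n => L.mul_mem (γ _).2 (γ' _).2) (fun n => by positivity)
      tendsto_one_div_add_atTop_nhds_zero_nat ?_ ?_
    · have : Tendsto (fun t => (γ t * γ' t : G)) (𝓝 0) (𝓝 1) :=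
        (hc.mul hc').tendsto' 0 1 (by simp [hγ.map_zero, hγ'.map_zero])
      exact this.comp tendsto_one_div_add_atTop_nhds_zero_nat
    · have := (hasDerivAt_iff_tendsto_slope_zero.1 h₁).comp hr
      simpa [Function.comp_def, hγ.map_zero, hγ'.map_zero, hφ.map_one] using this

/-- A subspace complementary to the tangent space of `L` is, locally, transverse to the cosets. -/
theorem IsCenteredChart.eventually_eq_of_inv_mul_mem [ProperSpace E] [CompactSpace G] [T2Space G]
    (hφ : IsCenteredChart φ) {L : Subgroup G} (hL : IsClosed (L : Set G)) {P : Type*}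
    [NormedAddCommGroup P] [NormedSpace ℝ P] [ProperSpace P] (ι : P →L[ℝ] E)
    (hι : ∀ u, ι u ∈ hφ.tangentSubmodule hL → u = 0) :
    ∀ᶠ q : P × P in 𝓝 0, (φ.symm (ι q.1))⁻¹ * φ.symm (ι q.2) ∈ L → q.1 = q.2 := by
  have : IsTopologicalGroup G := topologicalGroup_of_lieGroup 𝓘(ℝ, E) ∞
  by_contra hcon
  obtain ⟨q, hq0, hq⟩ := exists_seq_forall_of_frequently (not_eventually.1 hcon)
  simp only [Classical.not_imp] at hq
  have hr : ∀ n, 0 < ‖(q n).2 - (q n).1‖ := fun n =>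
    norm_pos_iff.2 (sub_ne_zero.2 (Ne.symm (hq n).2))
  -- If transversality fails arbitrarily near `0`, the normalised differences accumulate at a unit
  -- vector `u`. The quotients lie in `L` and have direction `ι u`, which is thus tangent to `L`;
  -- this forces `u = 0`.
  obtain ⟨u, hu, θ, hθ, hlim⟩ := (isCompact_sphere (0 : P) 1).tendsto_subseq
    (x := fun n => ‖(q n).2 - (q n).1‖⁻¹ • ((q n).2 - (q n).1)) (fun n => by
      rw [mem_sphere_zero_iff_norm, norm_smul, norm_inv, norm_norm, inv_mul_cancel₀ (hr n).ne'])
  set q' := q ∘ θ with hq'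
  have hq0' : Tendsto q' atTop (𝓝 0) := hq0.comp hθ.tendsto_atTop
  have hq1 : Tendsto (fun n => (q' n).1) atTop (𝓝 0) := (continuous_fst.tendsto' _ _ rfl).comp hq0'
  have hq2 : Tendsto (fun n => (q' n).2) atTop (𝓝 0) := (continuous_snd.tendsto' _ _ rfl).comp hq0'
  have hι1 : Tendsto (fun n => ι (q' n).1) atTop (𝓝 0) := (ι.continuous.tendsto' _ _ (by simp)).comp hq1
  have hι2 : Tendsto (fun n => ι (q' n).2) atTop (𝓝 0) := (ι.continuous.tendsto' _ _ (by simp)).comp hq2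
  have hu0 : u = 0 := by
    refine hι u (hφ.exists_isOneParam_of_tendsto hL
      (x := fun n => (φ.symm (ι (q' n).1))⁻¹ * φ.symm (ι (q' n).2))
      (r := fun n => ‖(q' n).2 - (q' n).1‖) (fun n => (hq (θ n)).1) (fun n => hr (θ n)) ?_ ?_ ?_)
    · simpa using (hq2.sub hq1).norm
    · simpa using ((hφ.tendsto_symm.comp hι1).inv).mul (hφ.tendsto_symm.comp hι2)
    · have h₁ : Tendsto (fun n => ‖(q' n).2 - (q' n).1‖⁻¹ • ι ((q' n).2 - (q' n).1)) atTop
          (𝓝 (ι u)) := by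
        have := (ι.continuous.tendsto u).comp hlim
        simpa [Function.comp_def, hq'] using this
      have h₂ : Tendsto (fun n => ‖(q' n).2 - (q' n).1‖⁻¹ •
          (φ ((φ.symm (ι (q' n).1))⁻¹ * φ.symm (ι (q' n).2)) - ι ((q' n).2 - (q' n).1)))
          atTop (𝓝 0) := by
        have hs := hφ.hasStrictFDerivAt_inv_mul.isLittleO
        -- The comparison point is on the diagonal, where the quotient is `1`; the error is then
        -- small relative to the difference of the two parameters.
        have ht : Tendsto (fun n => (((ι (q' n).1, ι (q' n).2), (ι (q' n).1, ι (q' n).1)) :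
            (E × E) × E × E)) atTop (𝓝 (0, 0)) :=
          (hι1.prodMk_nhds hι2).prodMk_nhds (hι1.prodMk_nhds hι1)
        have h₃ := hs.comp_tendsto ht
        have h₄ : (fun n => φ ((φ.symm (ι (q' n).1))⁻¹ * φ.symm (ι (q' n).2)) -
            ι ((q' n).2 - (q' n).1)) =o[atTop] fun n => ‖(q' n).2 - (q' n).1‖ := by
          refine (h₃.congr_left fun n => ?_).trans_isBigO ?_
          · simp [hφ.map_one]
          · refine Asymptotics.IsBigO.of_bound ‖ι‖ (Eventually.of_forall fun n => ?_)
            simpa [Prod.norm_def, ← map_sub] using ι.le_opNorm ((q' n).2 - (q' n).1)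
        have h₅ := h₄.tendsto_inv_smul_nhds_zero
        exact h₅
      have := h₂.add h₁
      simpa [← smul_add] using this
  rw [hu0] at hu
  simp at hu

/-- Choose a complement `Q` of the tangent space of `L` and one-parameter subgroups whose velocities
form a basis of that tangent space. The product of `φ.symm` on `Q` with the product of the
one-parameter subgroups has bijective differential at `0`, so the inverse function theorem applies;
transversality of `Q` separates the cosets. -/
theorem exists_subgroupSlice [FiniteDimensional ℝ E] [CompactSpace G] [T2Space G]
    {L : Subgroup G} (hL : IsClosed (L : Set G)) :
    ∃ p l : ℕ, p + l = Module.finrank ℝ E ∧ Nonempty (SubgroupSlice (E := E) L p l) := by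
  have : IsTopologicalGroup G := topologicalGroup_of_lieGroup 𝓘(ℝ, E) ∞
  have : ProperSpace E := FiniteDimensional.proper ℝ E
  obtain ⟨φ, hφ⟩ := exists_isCenteredChart (G := G) (E := E)
  set 𝔩 := hφ.tangentSubmodule hL with h𝔩
  obtain ⟨Q, hQ⟩ := Submodule.exists_isCompl 𝔩
  set p := Module.finrank ℝ Q
  set l := Module.finrank ℝ 𝔩
  have hpl : p + l = Module.finrank ℝ E := by
    rw [add_comm]; exact Submodule.finrank_add_eq_of_isCompl hQ
  let eQ : EuclideanSpace ℝ (Fin p) ≃L[ℝ] Q := ContinuousLinearEquiv.ofFinrankEq (by simp [p])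
  let ι : EuclideanSpace ℝ (Fin p) →L[ℝ] E := Q.subtypeL ∘L (eQ : EuclideanSpace ℝ (Fin p) →L[ℝ] Q)
  have hιQ : ∀ u, ι u ∈ Q := fun u => (eQ u).2
  have hι0 : ∀ u, ι u = 0 → u = 0 := fun u hu => by
    have : eQ u = 0 := Subtype.ext hu
    simpa using this
  have hι : ∀ u, ι u ∈ 𝔩 → u = 0 := fun u hu =>
    hι0 u ((Submodule.disjoint_def.1 hQ.disjoint) _ hu (hιQ u))
  let bas := Module.finBasis ℝ 𝔩
  choose γ hγ hγv using fun i => (bas i).2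
  have hγG : ∀ i, IsOneParam fun t => (γ i t : G) := fun i =>
    (hγ i).comp (f := L.subtype) continuous_subtype_val
  have hcoe : ∀ a, ((prodParam γ a : L) : G) = prodParam (fun i t => (γ i t : G)) a := fun a =>
    map_prodParam L.subtype γ a
  have hΦ : ContMDiff 𝓘(ℝ, Fin l → ℝ) 𝓘(ℝ, E) ∞ fun a => ((prodParam γ a : L) : G) := by
    rw [funext hcoe]
    exact contMDiff_prodParam fun i => (hγG i).contMDiff hφ (hγv i)
  have hΦ0 : ((prodParam γ 0 : L) : G) = 1 := by rw [prodParam_zero hγ]; rfl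
  let X := EuclideanSpace ℝ (Fin p) × (Fin l → ℝ)
  let f : X → G := fun x => φ.symm (ι x.1) * (prodParam γ x.2 : L)
  let F : X → E := fun x => φ (f x)
  have hf0 : f 0 = 1 := by simp [f, hφ.symm_zero, hΦ0]
  have hfs : ∀ x : X, ι x.1 ∈ φ.target → ContMDiffAt 𝓘(ℝ, X) 𝓘(ℝ, E) ∞ f x := fun x hx =>
    (hφ.contMDiffAt_symm_comp (ι.contDiff.contDiffAt.comp x contDiffAt_fst) hx).mul
      (hΦ.contMDiffAt.comp x contDiffAt_snd.contMDiffAt)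
  have ht0 : ι (0 : X).1 ∈ φ.target := by simpa using hφ.zero_mem
  have hev₁ : ∀ᶠ x : X in 𝓝 0, ι x.1 ∈ φ.target :=
    (ι.continuous.comp continuous_fst).continuousAt.preimage_mem_nhds (φ.open_target.mem_nhds ht0)
  have hev₂ : ∀ᶠ x : X in 𝓝 0, f x ∈ φ.source :=
    (hfs 0 ht0).continuousAt.preimage_mem_nhds
      (φ.open_source.mem_nhds (by rw [hf0]; exact hφ.one_mem))
  have hFs : ∀ x : X, ι x.1 ∈ φ.target → f x ∈ φ.source → ContDiffAt ℝ ∞ F x := fun x h h' =>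
    hφ.contDiffAt_comp (hfs x h) h'
  have hF0 : ContDiffAt ℝ ∞ F 0 := hFs 0 ht0 (by rw [hf0]; exact hφ.one_mem)
  let D₂ : (Fin l → ℝ) →L[ℝ] E :=
    ∑ i, (ContinuousLinearMap.proj (R := ℝ) (φ := fun _ : Fin l => ℝ) i).smulRight (bas i : E)
  let D : X →L[ℝ] E := ι ∘L ContinuousLinearMap.fst ℝ _ _ + D₂ ∘L ContinuousLinearMap.snd ℝ _ _
  have hFD : HasFDerivAt F D 0 := by
    refine hφ.hasFDerivAt_mul (f := fun x : X => φ.symm (ι x.1))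
      (g := fun x : X => ((prodParam γ x.2 : L) : G)) (by simp [hφ.symm_zero]) hΦ0 ?_ ?_ ?_ ?_
    · exact (hφ.contMDiffAt_symm_comp (ι.contDiff.contDiffAt.comp (0 : X) contDiffAt_fst)
        ht0).continuousAt
    · exact (hΦ.continuous.comp continuous_snd).continuousAt
    · refine (ι ∘L ContinuousLinearMap.fst ℝ (EuclideanSpace ℝ (Fin p))
        (Fin l → ℝ)).hasFDerivAt.congr_of_eventuallyEq ?_
      filter_upwards [hev₁] with x hx
      simp [φ.right_inv hx]
    · have h := hasFDerivAt_prodParam hφ hγG hγv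
      simp_rw [← hcoe] at h
      exact HasFDerivAt.comp (0 : X) (f := Prod.snd) h hasFDerivAt_snd
  have hDinj : Function.Injective D := by
    rw [injective_iff_map_eq_zero]
    rintro ⟨b, a⟩ h
    have hD₂ : D₂ a = ((∑ i, a i • bas i : 𝔩) : E) := by simp [D₂]
    have h' : ι b + D₂ a = 0 := h
    have hb : b = 0 := by
      refine hι b ?_
      rw [eq_neg_of_add_eq_zero_left h', hD₂]
      exact 𝔩.neg_mem (Subtype.property _)
    rw [hb, map_zero, zero_add, hD₂, ZeroMemClass.coe_eq_zero] at h'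
    have ha : a = 0 := funext fun i => Fintype.linearIndependent_iff.1 bas.linearIndependent a h' i
    rw [hb, ha]; rfl
  let De : X ≃L[ℝ] E := (LinearEquiv.ofInjectiveOfFinrankEq D.toLinearMap hDinj
    (by simp [X, hpl])).toContinuousLinearEquiv
  have hDe : (De : X →L[ℝ] E) = D := by ext <;> rfl
  have hFDe : HasFDerivAt F (De : X →L[ℝ] E) 0 := by rw [hDe]; exact hFD
  -- The inverse has to be smooth on its whole domain, not only at the image of `0`, so the
  -- derivative must be invertible throughout the neighbourhood.
  have hev₃ : ∀ᶠ x : X in 𝓝 0, fderiv ℝ F x ∈ range ((↑) : (X ≃L[ℝ] E) → X →L[ℝ] E) := by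
    have hc : ContinuousAt (fderiv ℝ F) 0 :=
      (hF0.fderiv_right (m := ∞) (by simp)).continuousAt
    refine hc.preimage_mem_nhds ?_
    rw [hFDe.fderiv]
    exact ContinuousLinearEquiv.nhds De
  obtain ⟨O, hO, hOo, h0O⟩ := eventually_nhds_iff.1 (hev₁.and (hev₂.and hev₃))
  let T := (hF0.toOpenPartialHomeomorph F hFDe (by simp)).restrOpen O hOo
  have hT : ∀ x, T x = F x := fun x => rfl
  have hTO : ∀ x ∈ T.source, x ∈ O := fun x hx => by
    rw [OpenPartialHomeomorph.restrOpen_source] at hx; exact hx.2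
  have h0T : (0 : X) ∈ T.source := by
    rw [OpenPartialHomeomorph.restrOpen_source]
    exact ⟨hF0.mem_toOpenPartialHomeomorph_source hFDe (by simp), h0O⟩
  let Θ := T.trans φ.symm
  have hΘs : ∀ x ∈ Θ.source, x ∈ T.source := fun x hx => by
    simp only [Θ, OpenPartialHomeomorph.trans_source] at hx; exact hx.1
  have hΘf : ∀ x ∈ Θ.source, Θ x = f x := fun x hx =>
    φ.left_inv (hO x (hTO x (hΘs x hx))).2.1
  have h0Θ : (0 : X) ∈ Θ.source := by
    simp only [Θ, OpenPartialHomeomorph.trans_source]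
    exact ⟨h0T, φ.map_source (hO 0 h0O).2.1⟩
  have hBev : ∀ᶠ b : EuclideanSpace ℝ (Fin p) in 𝓝 0, ((b, 0) : X) ∈ Θ.source :=
    (Continuous.prodMk continuous_id continuous_const).continuousAt.preimage_mem_nhds
      (Θ.open_source.mem_nhds h0Θ)
  have hinj := hφ.eventually_eq_of_inv_mul_mem hL ι hι
  have h00 : (0 : EuclideanSpace ℝ (Fin p) × EuclideanSpace ℝ (Fin p)) = (0, 0) := rfl
  rw [h00, nhds_prod_eq] at hinj
  have hinj' := (eventually_prod_self_iff'.1 hinj)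
  obtain ⟨B', hB', hB'inj⟩ := hinj'
  obtain ⟨B, hB, hBo, h0B⟩ := mem_nhds_iff.1 (Filter.inter_mem hB' hBev)
  refine ⟨p, l, hpl, ⟨{
    σ := fun b => φ.symm (ι b)
    γ := γ
    Θ := Θ
    B := B
    isOneParam := hγ
    contMDiff_γ := hΦ
    Θ_apply := hΘf
    contMDiffOn_Θ := fun x hx => ((hfs x (hO x (hTO x (hΘs x hx))).1).contMDiffWithinAt).congr
      hΘf (hΘf x hx)
    contMDiffOn_Θ_symm := ?_
    isOpen_B := hBo
    zero_mem_B := h0B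
    mem_source := fun b hb => (hB hb).2
    σ_zero := by simp [hφ.symm_zero]
    eq_of_mem := fun b hb b' hb' h => hB'inj _ (hB hb).1 _ (hB hb').1 h }⟩⟩
  intro g hg
  have hgs : g ∈ φ.source := by
    have : g ∈ φ.symm.target ∩ φ.symm.symm ⁻¹' T.target := by
      simpa only [Θ, OpenPartialHomeomorph.trans_target] using hg
    exact this.1
  have hgT : φ g ∈ T.target := by
    have : g ∈ φ.symm.target ∩ φ.symm.symm ⁻¹' T.target := by
      simpa only [Θ, OpenPartialHomeomorph.trans_target] using hg
    exact this.2
  have hy : T.symm (φ g) ∈ T.source := T.map_target hgT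
  obtain ⟨k₁, k₂, e, he⟩ := hO _ (hTO _ hy)
  have hsymm : ContDiffAt ℝ ∞ T.symm (φ g) := by
    refine T.contDiffAt_symm (f₀' := e) hgT ?_ (hFs _ k₁ k₂)
    rw [he]
    exact ((hFs _ k₁ k₂).differentiableAt (by simp)).hasFDerivAt
  exact (hsymm.contMDiffAt.comp g
    (hφ.contMDiffOn.contMDiffAt (φ.open_source.mem_nhds hgs))).contMDiffWithinAt

end Slice

/-! ### Manifold structures on quotients with liftable charts -/

section SubmersionAtlas

variable {F : Type*} [NormedAddCommGroup F] [NormedSpace ℝ F] {HN : Type*} [TopologicalSpace HN]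
  {J : ModelWithCorners ℝ F HN} {N : Type*} [TopologicalSpace N] [ChartedSpace HN N]

/-- Charts of a topological space `M`, together with a map `π : N → M` from a smooth manifold which
is a submersion in these charts: it is smooth and the inverse of each chart lifts to `N`. -/
structure SubmersionAtlas (J : ModelWithCorners ℝ F HN) (E : Type*) [NormedAddCommGroup E]
    [NormedSpace ℝ E] {M : Type*} [TopologicalSpace M] (π : N → M) where
  chart : M → OpenPartialHomeomorph M E
  lift : M → E → N
  mem_source : ∀ x, x ∈ (chart x).source
  contMDiffOn_lift : ∀ x, ContMDiffOn 𝓘(ℝ, E) J ∞ (lift x) (chart x).target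
  proj_lift : ∀ x, ∀ u ∈ (chart x).target, π (lift x u) = (chart x).symm u
  contMDiffOn_chart_proj : ∀ x, ContMDiffOn J 𝓘(ℝ, E) ∞ (fun y => chart x (π y))
    (π ⁻¹' (chart x).source)

namespace SubmersionAtlas

variable {E : Type*} [NormedAddCommGroup E] [NormedSpace ℝ E] {M : Type*} [TopologicalSpace M]
  {π : N → M} (𝒜 : SubmersionAtlas J E π)

/-- The charted space structure given by the charts of a submersion atlas. -/
abbrev chartedSpace : ChartedSpace E M where
  atlas := range 𝒜.chart
  chartAt := 𝒜.chart
  mem_chart_source := 𝒜.mem_source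
  chart_mem_atlas := mem_range_self

/-- A change of charts factors as a smooth lift to `N` followed by a chart composed with `π`, and
both are smooth by assumption. -/
theorem isManifold : @IsManifold ℝ _ E _ _ E _ 𝓘(ℝ, E) ∞ M _ 𝒜.chartedSpace := by
  let _ := 𝒜.chartedSpace
  refine isManifold_of_contDiffOn 𝓘(ℝ, E) ∞ M ?_
  rintro _ _ ⟨x, rfl⟩ ⟨y, rfl⟩
  have h : ContMDiffOn 𝓘(ℝ, E) 𝓘(ℝ, E) ∞ (fun u => 𝒜.chart y (π (𝒜.lift x u)))
      ((𝒜.chart x).symm.trans (𝒜.chart y)).source := by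
    refine (𝒜.contMDiffOn_chart_proj y).comp ((𝒜.contMDiffOn_lift x).mono fun u hu => ?_)
      fun u hu => ?_
    · rw [OpenPartialHomeomorph.trans_source] at hu; exact hu.1
    · rw [OpenPartialHomeomorph.trans_source] at hu
      rw [mem_preimage, mem_preimage, 𝒜.proj_lift x u hu.1]
      exact hu.2
  have h' : ContDiffOn ℝ ∞ (𝒜.chart y ∘ (𝒜.chart x).symm)
      ((𝒜.chart x).symm.trans (𝒜.chart y)).source := by
    refine (contMDiffOn_iff_contDiffOn.1 h).congr fun u hu => ?_
    rw [OpenPartialHomeomorph.trans_source] at hu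
    simp [𝒜.proj_lift x u hu.1]
  simpa using h'

theorem contMDiff_proj [IsManifold J ∞ N] (hπ : Continuous π) :
    letI := 𝒜.chartedSpace
    ContMDiff J 𝓘(ℝ, E) ∞ π := by
  let _ := 𝒜.chartedSpace
  have := 𝒜.isManifold
  rw [contMDiff_iff_target]
  refine ⟨hπ, fun x => ?_⟩
  rw [extChartAt_source]
  exact 𝒜.contMDiffOn_chart_proj x

/-- Local sections reduce the smoothness of maps out of `M` to that of their composites with `π`. -/
theorem exists_section (x : M) :
    letI := 𝒜.chartedSpace
    ∃ s : M → N, ContMDiffAt 𝓘(ℝ, E) J ∞ s x ∧ ∀ᶠ y in 𝓝 x, π (s y) = y := by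
  let _ := 𝒜.chartedSpace
  have := 𝒜.isManifold
  have hx := 𝒜.mem_source x
  refine ⟨fun y => 𝒜.lift x (𝒜.chart x y), ?_, ?_⟩
  · have h₁ : ContMDiffAt 𝓘(ℝ, E) 𝓘(ℝ, E) ∞ (𝒜.chart x) x :=
      (contMDiffOn_chart (x := x)).contMDiffAt ((𝒜.chart x).open_source.mem_nhds hx)
    exact ((𝒜.contMDiffOn_lift x).contMDiffAt ((𝒜.chart x).open_target.mem_nhds
      ((𝒜.chart x).map_source hx))).comp x h₁
  · filter_upwards [(𝒜.chart x).open_source.mem_nhds hx] with y hy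
    rw [𝒜.proj_lift x _ ((𝒜.chart x).map_source hy), (𝒜.chart x).left_inv hy]

end SubmersionAtlas

end SubmersionAtlas

/-! ### Invariance of the rank under submersions and immersions -/

section Rank

variable {E₁ : Type*} [NormedAddCommGroup E₁] [NormedSpace ℝ E₁] {H₁ : Type*} [TopologicalSpace H₁]
  {I₁ : ModelWithCorners ℝ E₁ H₁} {X : Type*} [TopologicalSpace X] [ChartedSpace H₁ X]
  {E₂ : Type*} [NormedAddCommGroup E₂] [NormedSpace ℝ E₂] {H₂ : Type*} [TopologicalSpace H₂]
  {I₂ : ModelWithCorners ℝ E₂ H₂} {Y : Type*} [TopologicalSpace Y] [ChartedSpace H₂ Y]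
  {E₃ : Type*} [NormedAddCommGroup E₃] [NormedSpace ℝ E₃] {H₃ : Type*} [TopologicalSpace H₃]
  {I₃ : ModelWithCorners ℝ E₃ H₃} {Z : Type*} [TopologicalSpace Z] [ChartedSpace H₃ Z]
  {E₄ : Type*} [NormedAddCommGroup E₄] [NormedSpace ℝ E₄] {H₄ : Type*} [TopologicalSpace H₄]
  {I₄ : ModelWithCorners ℝ E₄ H₄} {T : Type*} [TopologicalSpace T] [ChartedSpace H₄ T]

theorem mfderiv_comp_eq_id_of_eventually {f : X → Y} {g : Y → X} {x : X}
    (hf : MDifferentiableAt I₁ I₂ f x) (hg : MDifferentiableAt I₂ I₁ g (f x))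
    (h : ∀ᶠ y in 𝓝 x, g (f y) = y) (v : E₁) :
    (mfderiv I₂ I₁ g (f x) : E₂ → E₁) ((mfderiv I₁ I₂ f x : E₁ → E₂) v) = v := by
  have h₁ := mfderiv_comp x hg hf
  have h₂ : mfderiv I₁ I₁ (g ∘ f) x = mfderiv I₁ I₁ id x :=
    Filter.EventuallyEq.mfderiv_eq h
  rw [h₁, mfderiv_id] at h₂
  exact DFunLike.congr_fun h₂ v

/-- This allows the dimension of an orbit to be computed in slice coordinates on the group and in a
linear ambient space of the sphere. -/
theorem finrank_range_mfderiv_eq {c : X → Y} {f : Y → Z} {ψ : Z → T} {x : X} {y : Y} {z : Z}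
    (hy : c x = y) (hz : f y = z)
    (hc : MDifferentiableAt I₁ I₂ c x) (hf : MDifferentiableAt I₂ I₃ f y)
    (hψ : MDifferentiableAt I₃ I₄ ψ z)
    (hcs : Function.Surjective (mfderiv I₁ I₂ c x : E₁ → E₂))
    (hψi : Function.Injective (mfderiv I₃ I₄ ψ z : E₃ → E₄)) :
    Module.finrank ℝ (LinearMap.range (mfderiv I₂ I₃ f y : E₂ →L[ℝ] E₃).toLinearMap) =
      Module.finrank ℝ
        (LinearMap.range (mfderiv I₁ I₄ (fun w => ψ (f (c w))) x : E₁ →L[ℝ] E₄).toLinearMap) := by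
  subst hy hz
  have h₁ : (mfderiv I₁ I₄ (fun w => ψ (f (c w))) x : E₁ →L[ℝ] E₄) =
      (mfderiv I₃ I₄ ψ (f (c x)) : E₃ →L[ℝ] E₄) ∘L ((mfderiv I₂ I₃ f (c x) : E₂ →L[ℝ] E₃) ∘L
        (mfderiv I₁ I₂ c x : E₁ →L[ℝ] E₂)) := by
    have a := mfderiv_comp x hf hc
    have b := mfderiv_comp x (g := ψ) (f := f ∘ c) hψ (hf.comp x hc)
    rw [a] at b
    exact b
  rw [h₁]
  change _ = Module.finrank ℝ (LinearMap.range
    ((mfderiv I₃ I₄ ψ (f (c x)) : E₃ →L[ℝ] E₄).toLinearMap ∘ₗ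
      ((mfderiv I₂ I₃ f (c x) : E₂ →L[ℝ] E₃).toLinearMap ∘ₗ
        (mfderiv I₁ I₂ c x : E₁ →L[ℝ] E₂).toLinearMap)))
  rw [LinearMap.range_comp, LinearMap.range_comp_of_range_eq_top _ (LinearMap.range_eq_top.2 hcs)]
  exact (LinearEquiv.finrank_eq (Submodule.equivMapOfInjective _ hψi _))

end Rank

/-! ### Orthogonal representations -/

section OrthogonalRep

/-- A continuous orthogonal representation of a topological group. -/
structure OrthogonalRep (H V : Type*) [Group H] [TopologicalSpace H] [NormedAddCommGroup V]
    [InnerProductSpace ℝ V] where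
  toHom : H →* (V →L[ℝ] V)
  continuous : Continuous toHom
  norm_map : ∀ h x, ‖toHom h x‖ = ‖x‖

namespace OrthogonalRep

variable {H V : Type*} [Group H] [TopologicalSpace H] [NormedAddCommGroup V]
  [InnerProductSpace ℝ V] (R : OrthogonalRep H V)

/-- The action on the unit sphere. -/
def act (h : H) (s : Metric.sphere (0 : V) 1) : Metric.sphere (0 : V) 1 :=
  ⟨R.toHom h s, by simp [R.norm_map]⟩

@[simp] theorem coe_act (h : H) (s : Metric.sphere (0 : V) 1) : (R.act h s : V) = R.toHom h s := rfl

@[simp] theorem act_one (s : Metric.sphere (0 : V) 1) : R.act 1 s = s := by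
  ext; simp

theorem act_mul (h h' : H) (s : Metric.sphere (0 : V) 1) :
    R.act (h * h') s = R.act h (R.act h' s) := by
  ext; simp

@[simp] theorem act_inv_act (h : H) (s : Metric.sphere (0 : V) 1) :
    R.act h⁻¹ (R.act h s) = s := by
  rw [← act_mul, inv_mul_cancel, act_one]

@[simp] theorem act_act_inv (h : H) (s : Metric.sphere (0 : V) 1) :
    R.act h (R.act h⁻¹ s) = s := by
  rw [← act_mul, mul_inv_cancel, act_one]

theorem continuous_act : Continuous fun q : H × Metric.sphere (0 : V) 1 => R.act q.1 q.2 := by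
  refine Continuous.subtype_mk ?_ _
  exact (R.continuous.comp continuous_fst).clm_apply (continuous_subtype_val.comp continuous_snd)

/-- The restriction of a representation along a continuous homomorphism. -/
def comp {H' : Type*} [Group H'] [TopologicalSpace H'] (f : H' →* H) (hf : Continuous f) :
    OrthogonalRep H' V where
  toHom := R.toHom.comp f
  continuous := R.continuous.comp hf
  norm_map h x := R.norm_map (f h) x

end OrthogonalRep

end OrthogonalRep

/-! ### The associated sphere bundle as a topological space -/

section AssocSphere

variable {G : Type*} [Group G] {L : Subgroup G} [TopologicalSpace G]
  {V : Type*} [NormedAddCommGroup V] [InnerProductSpace ℝ V]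

/-- The equivalence relation `(g * l, s) ∼ (g, l • s)` on `G × S(V)`. -/
def assocSetoid (R : OrthogonalRep L V) : Setoid (G × Metric.sphere (0 : V) 1) where
  r q q' := ∃ l : L, q.1 = q'.1 * l ∧ q'.2 = R.act l q.2
  iseqv :=
    { refl := fun q => ⟨1, by simp⟩
      symm := by
        rintro q q' ⟨l, h, h'⟩
        exact ⟨l⁻¹, by simp [h], by simp [h']⟩
      trans := by
        rintro q q' q'' ⟨l, h, h'⟩ ⟨k, j, j'⟩
        exact ⟨k * l, by simp [h, j, mul_assoc], by rw [j', h', R.act_mul]⟩ }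

/-- The associated sphere bundle `G ×_L S(V)`. -/
def AssocSphere (R : OrthogonalRep L V) : Type _ := Quotient (assocSetoid R)

namespace AssocSphere

variable (R : OrthogonalRep L V)

instance : TopologicalSpace (AssocSphere R) := inferInstanceAs (TopologicalSpace (Quotient _))

/-- The projection `G × S(V) → G ×_L S(V)`. -/
def mk (q : G × Metric.sphere (0 : V) 1) : AssocSphere R := Quotient.mk (assocSetoid R) q

variable {R}

theorem mk_eq_mk {q q' : G × Metric.sphere (0 : V) 1} :
    mk R q = mk R q' ↔ ∃ l : L, q.1 = q'.1 * l ∧ q'.2 = R.act l q.2 :=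
  Quotient.eq (r := assocSetoid R)

theorem mk_surjective : Function.Surjective (mk R) := Quotient.mk_surjective

theorem isQuotientMap_mk : IsQuotientMap (mk R) := isQuotientMap_quotient_mk'

theorem continuous_mk : Continuous (mk R) := isQuotientMap_mk.continuous

theorem mk_mul_left (g : G) (l : L) (s : Metric.sphere (0 : V) 1) :
    mk R (g * l, s) = mk R (g, R.act l s) := mk_eq_mk.2 ⟨l, rfl, rfl⟩

instance : MulAction G (AssocSphere R) where
  smul g := Quotient.map (fun q => (g * q.1, q.2)) (by
    rintro q q' ⟨l, h, h'⟩
    exact ⟨l, by simp [h, mul_assoc], h'⟩)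
  one_smul x := by
    obtain ⟨q, rfl⟩ := mk_surjective x
    exact congrArg (mk R) (Prod.ext (one_mul _) rfl)
  mul_smul g h x := by
    obtain ⟨q, rfl⟩ := mk_surjective x
    exact congrArg (mk R) (Prod.ext (mul_assoc _ _ _) rfl)

theorem smul_mk (g : G) (q : G × Metric.sphere (0 : V) 1) :
    g • mk R q = mk R (g * q.1, q.2) := rfl

variable [IsTopologicalGroup G]

/-- The saturation of a set is the union of its translates under `L`. -/
theorem isOpenMap_mk : IsOpenMap (mk R) := by
  intro U hU
  rw [← isQuotientMap_mk.isOpen_preimage]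
  have : mk R ⁻¹' (mk R '' U) =
      ⋃ l : L, (fun q : G × Metric.sphere (0 : V) 1 => (q.1 * (l : G), R.act l⁻¹ q.2)) ⁻¹' U := by
    ext q
    simp only [mem_preimage, mem_image, mem_iUnion]
    constructor
    · rintro ⟨q', hq', h⟩
      obtain ⟨l, h₁, h₂⟩ := mk_eq_mk.1 h
      refine ⟨l, ?_⟩
      rw [← h₁, h₂, R.act_inv_act]
      exact hq'
    · rintro ⟨l, hl⟩
      exact ⟨_, hl, by rw [mk_mul_left, R.act_act_inv]⟩
  rw [this]
  refine isOpen_iUnion fun l => hU.preimage ?_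
  refine (continuous_fst.mul continuous_const).prodMk ?_
  exact R.continuous_act.comp (continuous_const.prodMk continuous_snd)

instance [CompactSpace G] [FiniteDimensional ℝ V] : CompactSpace (AssocSphere R) := by
  have : ProperSpace V := FiniteDimensional.proper ℝ V
  exact inferInstanceAs (CompactSpace (Quotient _))

/-- The equivalence relation is the continuous image of the compact space `L × G × S(V)`, hence
closed, and the quotient map is open. -/
theorem t2Space [CompactSpace G] [T2Space G] [FiniteDimensional ℝ V] (hL : IsClosed (L : Set G)) :
    T2Space (AssocSphere R) := by
  have : ProperSpace V := FiniteDimensional.proper ℝ V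
  have : CompactSpace L := isCompact_iff_compactSpace.1 hL.isCompact
  rw [t2Space_iff_of_isOpenQuotientMap ⟨mk_surjective, continuous_mk, isOpenMap_mk⟩]
  have : {q : (G × Metric.sphere (0 : V) 1) × (G × Metric.sphere (0 : V) 1) |
      mk R q.1 = mk R q.2} = range fun x : L × G × Metric.sphere (0 : V) 1 =>
        ((x.2.1 * (x.1 : G), x.2.2), (x.2.1, R.act x.1 x.2.2)) := by
    ext ⟨q, q'⟩
    simp only [mem_ofPred_eq, mem_range, mk_eq_mk]
    constructor
    · rintro ⟨l, h, h'⟩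
      exact ⟨(l, q'.1, q.2), by rw [← h, ← h']⟩
    · rintro ⟨⟨l, g, s⟩, h⟩
      cases h
      exact ⟨l, rfl, rfl⟩
  rw [this]
  refine (isCompact_range ?_).isClosed
  refine Continuous.prodMk (Continuous.prodMk ?_ ?_) (Continuous.prodMk ?_ ?_)
  · exact (continuous_fst.comp continuous_snd).mul (continuous_subtype_val.comp continuous_fst)
  · exact continuous_snd.comp continuous_snd
  · exact continuous_fst.comp continuous_snd
  · exact R.continuous_act.comp (continuous_fst.prodMk (continuous_snd.comp continuous_snd))

end AssocSphere

end AssocSphere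

theorem nonempty_sphere (V : Type*) [NormedAddCommGroup V] [InnerProductSpace ℝ V] (m : ℕ)
    [hm : Fact (Module.finrank ℝ V = m + 1)] : Nonempty (Metric.sphere (0 : V) 1) :=
  haveI : Nontrivial V := Module.nontrivial_of_finrank_pos (R := ℝ) (by rw [hm.out]; omega)
  (NormedSpace.sphere_nonempty.2 zero_le_one).to_subtype

/-! ### Smooth charts of the associated sphere bundle -/

section Charts

variable {E : Type*} [NormedAddCommGroup E] [NormedSpace ℝ E]
  {G : Type*} [Group G] [TopologicalSpace G] [ChartedSpace E G]
  {L : Subgroup G} {V : Type*} [NormedAddCommGroup V] [InnerProductSpace ℝ V]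
  {p l m : ℕ}

namespace SubgroupSlice

variable (𝒮 : SubgroupSlice (E := E) L p l)

theorem Θ_zero_right {b : EuclideanSpace ℝ (Fin p)} (hb : b ∈ 𝒮.B) : 𝒮.Θ (b, 0) = 𝒮.σ b := by
  rw [𝒮.Θ_apply _ (𝒮.mem_source b hb)]
  simp [prodParam_zero 𝒮.isOneParam]

theorem Θ_symm_σ {b : EuclideanSpace ℝ (Fin p)} (hb : b ∈ 𝒮.B) : 𝒮.Θ.symm (𝒮.σ b) = (b, 0) := by
  rw [← 𝒮.Θ_zero_right hb, 𝒮.Θ.left_inv (𝒮.mem_source b hb)]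

theorem σ_mem_target {b : EuclideanSpace ℝ (Fin p)} (hb : b ∈ 𝒮.B) : 𝒮.σ b ∈ 𝒮.Θ.target := by
  rw [← 𝒮.Θ_zero_right hb]
  exact 𝒮.Θ.map_source (𝒮.mem_source b hb)

theorem contMDiffOn_σ :
    ContMDiffOn 𝓘(ℝ, EuclideanSpace ℝ (Fin p)) 𝓘(ℝ, E) ∞ 𝒮.σ 𝒮.B := by
  have h : ContMDiff 𝓘(ℝ, EuclideanSpace ℝ (Fin p))
      𝓘(ℝ, EuclideanSpace ℝ (Fin p) × (Fin l → ℝ)) ∞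
      (fun b : EuclideanSpace ℝ (Fin p) => (b, (0 : Fin l → ℝ))) :=
    (contDiff_id.prodMk contDiff_const).contMDiff
  exact (𝒮.contMDiffOn_Θ.comp h.contMDiffOn 𝒮.mem_source).congr
    fun b hb => (𝒮.Θ_zero_right hb).symm

/-- Each factor is a continuous homomorphism from `ℝ` into a Banach algebra and so is smooth;
continuity of the representation suffices. -/
theorem contDiff_rep [FiniteDimensional ℝ V] (R : OrthogonalRep L V) :
    ContDiff ℝ ∞ fun a => R.toHom (prodParam 𝒮.γ a) := by
  have : CompleteSpace V := FiniteDimensional.complete ℝ V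
  rw [funext fun a => map_prodParam R.toHom 𝒮.γ a]
  refine contDiff_prodParam fun i => contDiff_of_map_add_eq_mul
    (R.continuous.comp (𝒮.isOneParam i).continuous) ?_ fun s t => ?_
  · simp [(𝒮.isOneParam i).map_zero]
  · simp [(𝒮.isOneParam i).map_add]

theorem contMDiff_act [Fact (Module.finrank ℝ V = m + 1)] (R : OrthogonalRep L V) (k : L) :
    ContMDiff (𝓘(ℝ, Fin l → ℝ).prod (𝓡 m)) (𝓡 m) ∞
      fun q : (Fin l → ℝ) × Metric.sphere (0 : V) 1 => R.act (prodParam 𝒮.γ q.1 * k) q.2 := by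
  have : FiniteDimensional ℝ V := .of_fact_finrank_eq_succ m
  refine ContMDiff.codRestrict_sphere (f := fun q : (Fin l → ℝ) × Metric.sphere (0 : V) 1 =>
    R.toHom (prodParam 𝒮.γ q.1 * k) q.2) ?_ _
  have h₁ : ContMDiff (𝓘(ℝ, Fin l → ℝ).prod (𝓡 m)) 𝓘(ℝ, V →L[ℝ] V) ∞
      fun q : (Fin l → ℝ) × Metric.sphere (0 : V) 1 => R.toHom (prodParam 𝒮.γ q.1) :=
    (𝒮.contDiff_rep R).contMDiff.comp contMDiff_fst
  have h₂ : ContMDiff (𝓘(ℝ, Fin l → ℝ).prod (𝓡 m)) 𝓘(ℝ, V) ∞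
      fun q : (Fin l → ℝ) × Metric.sphere (0 : V) 1 => R.toHom k q.2 :=
    (R.toHom k).contDiff.contMDiff.comp (contMDiff_coe_sphere.comp contMDiff_snd)
  simpa using h₁.clm_apply h₂

variable (R : OrthogonalRep L V)

/-- The local parametrization `(b, s) ↦ [g₀ σ(b), s]` of `G ×_L S(V)`. -/
def param (g₀ : G) (y : EuclideanSpace ℝ (Fin p) × Metric.sphere (0 : V) 1) : AssocSphere R :=
  AssocSphere.mk R (g₀ * 𝒮.σ y.1, y.2)

/-- A local lift to the parameters of the projection `G × S(V) → G ×_L S(V)`. -/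
def slide (g₀ : G) (k : L) (q : G × Metric.sphere (0 : V) 1) :
    EuclideanSpace ℝ (Fin p) × Metric.sphere (0 : V) 1 :=
  ((𝒮.Θ.symm (g₀⁻¹ * q.1 * (k : G)⁻¹)).1,
    R.act (prodParam 𝒮.γ (𝒮.Θ.symm (g₀⁻¹ * q.1 * (k : G)⁻¹)).2 * k) q.2)

variable {R}

/-- The slice factors `g₀⁻¹ * q.1 * k⁻¹` as `σ b` times an element of `L`; that element and `k` are
moved across to the sphere. -/
theorem param_slide {g₀ : G} {k : L} {q : G × Metric.sphere (0 : V) 1}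
    (hq : g₀⁻¹ * q.1 * (k : G)⁻¹ ∈ 𝒮.Θ.target) :
    𝒮.param R g₀ (𝒮.slide R g₀ k q) = AssocSphere.mk R q := by
  symm
  refine AssocSphere.mk_eq_mk.2
    ⟨prodParam 𝒮.γ (𝒮.Θ.symm (g₀⁻¹ * q.1 * (k : G)⁻¹)).2 * k, ?_, rfl⟩
  have h := 𝒮.Θ_apply _ (𝒮.Θ.map_target hq)
  rw [𝒮.Θ.right_inv hq] at h
  simp only [slide, Subgroup.coe_mul]
  rw [mul_assoc g₀, ← mul_assoc (𝒮.σ _), ← h]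
  group

/-- The element of `L` relating the two representatives serves as `k`. This extra translation is
what makes a smooth lift available near every point of the fibre, not only near the slice. -/
theorem exists_slide_eq {g₀ : G} {q : G × Metric.sphere (0 : V) 1}
    {y : EuclideanSpace ℝ (Fin p) × Metric.sphere (0 : V) 1} (hy : y.1 ∈ 𝒮.B)
    (h : AssocSphere.mk R q = 𝒮.param R g₀ y) :
    ∃ k : L, g₀⁻¹ * q.1 * (k : G)⁻¹ ∈ 𝒮.Θ.target ∧ 𝒮.slide R g₀ k q = y := by
  obtain ⟨k, h₁, h₂⟩ := AssocSphere.mk_eq_mk.1 h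
  simp only at h₁ h₂
  have e : g₀⁻¹ * q.1 * (k : G)⁻¹ = 𝒮.σ y.1 := by rw [h₁]; group
  refine ⟨k, by rw [e]; exact 𝒮.σ_mem_target hy, ?_⟩
  rw [slide, e, 𝒮.Θ_symm_σ hy]
  simp only [prodParam_zero 𝒮.isOneParam, one_mul, ← h₂]

theorem injOn_param (g₀ : G) : InjOn (𝒮.param R g₀) (𝒮.B ×ˢ univ) := by
  rintro ⟨b, s⟩ ⟨hb, -⟩ ⟨b', s'⟩ ⟨hb', -⟩ h
  obtain ⟨k, h₁, h₂⟩ := AssocSphere.mk_eq_mk.1 h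
  simp only at h₁ h₂ hb hb'
  rw [mul_assoc, mul_right_inj] at h₁
  have hbb : b' = b := 𝒮.eq_of_mem b' hb' b hb (by rw [h₁]; simp)
  subst hbb
  have : k = 1 := by
    ext
    simpa using h₁
  rw [h₂, this, R.act_one]

variable [LieGroup 𝓘(ℝ, E) ∞ G]

omit [InnerProductSpace ℝ V] in
theorem isOpen_slide_domain (g₀ : G) (k : L) :
    IsOpen {q : G × Metric.sphere (0 : V) 1 | g₀⁻¹ * q.1 * (k : G)⁻¹ ∈ 𝒮.Θ.target} := by
  have : IsTopologicalGroup G := topologicalGroup_of_lieGroup 𝓘(ℝ, E) ∞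
  exact 𝒮.Θ.open_target.preimage ((continuous_const.mul continuous_fst).mul continuous_const)

theorem contMDiffOn_slide [Fact (Module.finrank ℝ V = m + 1)] (g₀ : G) (k : L) :
    ContMDiffOn (𝓘(ℝ, E).prod (𝓡 m)) (𝓘(ℝ, EuclideanSpace ℝ (Fin p)).prod (𝓡 m)) ∞
      (𝒮.slide R g₀ k) {q | g₀⁻¹ * q.1 * (k : G)⁻¹ ∈ 𝒮.Θ.target} := by
  have h₁ : ContMDiff (𝓘(ℝ, E).prod (𝓡 m)) 𝓘(ℝ, E) ∞
      fun q : G × Metric.sphere (0 : V) 1 => g₀⁻¹ * q.1 * (k : G)⁻¹ :=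
    (contMDiff_const.mul contMDiff_fst).mul contMDiff_const
  have h₂ : ContMDiffOn (𝓘(ℝ, E).prod (𝓡 m))
      𝓘(ℝ, EuclideanSpace ℝ (Fin p) × (Fin l → ℝ)) ∞
      (fun q : G × Metric.sphere (0 : V) 1 => 𝒮.Θ.symm (g₀⁻¹ * q.1 * (k : G)⁻¹))
      {q | g₀⁻¹ * q.1 * (k : G)⁻¹ ∈ 𝒮.Θ.target} :=
    𝒮.contMDiffOn_Θ_symm.comp h₁.contMDiffOn fun q hq => hq
  have h₃ := (contDiff_fst (𝕜 := ℝ) (E := EuclideanSpace ℝ (Fin p)) (F := Fin l → ℝ)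
    (n := ∞)).contMDiff.comp_contMDiffOn h₂
  have h₄ := (contDiff_snd (𝕜 := ℝ) (E := EuclideanSpace ℝ (Fin p)) (F := Fin l → ℝ)
    (n := ∞)).contMDiff.comp_contMDiffOn h₂
  exact h₃.prodMk ((𝒮.contMDiff_act R k).comp_contMDiffOn (h₄.prodMk contMDiffOn_snd))

theorem continuousOn_param (g₀ : G) : ContinuousOn (𝒮.param R g₀) (𝒮.B ×ˢ univ) := by
  have : IsTopologicalGroup G := topologicalGroup_of_lieGroup 𝓘(ℝ, E) ∞
  refine AssocSphere.continuous_mk.comp_continuousOn (ContinuousOn.prodMk ?_ continuousOn_snd)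
  exact continuousOn_const.mul (𝒮.contMDiffOn_σ.continuousOn.comp continuousOn_fst fun y hy => hy.1)

/-- Near a given point the image contains the projection of an open set, namely of the preimage
under `slide` of a neighbourhood in the parameter space, and the projection is open. -/
theorem isOpenMap_param [Fact (Module.finrank ℝ V = m + 1)] (g₀ : G) :
    IsOpenMap ((𝒮.B ×ˢ univ).domRestrict (𝒮.param R g₀)) := by
  have : IsTopologicalGroup G := topologicalGroup_of_lieGroup 𝓘(ℝ, E) ∞
  rw [isOpenMap_iff_nhds_le]
  rintro ⟨y, hy⟩ U hU
  rw [mem_map] at hU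
  obtain ⟨O, hO, hOo, hyO⟩ := mem_nhds_iff.1 hU
  obtain ⟨A, hA, hAO⟩ := isOpen_induced_iff.1 hOo
  obtain ⟨k, hk, hs⟩ := 𝒮.exists_slide_eq (R := R) (g₀ := g₀) (q := (g₀ * 𝒮.σ y.1, y.2)) hy.1 rfl
  have hAy : y ∈ A ∩ 𝒮.B ×ˢ univ := ⟨by
    have : (⟨y, hy⟩ : ↥(𝒮.B ×ˢ univ)) ∈ Subtype.val ⁻¹' A := by rw [hAO]; exact hyO
    exact this, hy⟩
  have hAB : IsOpen (A ∩ 𝒮.B ×ˢ (univ : Set (Metric.sphere (0 : V) 1))) :=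
    hA.inter (𝒮.isOpen_B.prod isOpen_univ)
  have hc := (𝒮.contMDiffOn_slide (R := R) (m := m) g₀ k).continuousOn.isOpen_inter_preimage
    (𝒮.isOpen_slide_domain g₀ k) hAB
  refine mem_of_superset ((AssocSphere.isOpenMap_mk (R := R) _ hc).mem_nhds
    (mem_image_of_mem _ ⟨hk, by rw [mem_preimage, hs]; exact hAy⟩)) ?_
  rintro _ ⟨q, ⟨hq, hq'⟩, rfl⟩
  rw [← 𝒮.param_slide hq]
  have hmem : (⟨𝒮.slide R g₀ k q, hq'.2⟩ : ↥(𝒮.B ×ˢ univ)) ∈ O := by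
    rw [← hAO]; exact hq'.1
  exact hO hmem

/-- The local parametrization as a partial homeomorphism. -/
noncomputable def paramHomeo [Fact (Module.finrank ℝ V = m + 1)] (R : OrthogonalRep L V) (g₀ : G) :
    OpenPartialHomeomorph (EuclideanSpace ℝ (Fin p) × Metric.sphere (0 : V) 1) (AssocSphere R) :=
  haveI := nonempty_sphere V m
  OpenPartialHomeomorph.ofContinuousOpenRestrict
    ((𝒮.injOn_param (R := R) g₀).toPartialEquiv (𝒮.param R g₀) (𝒮.B ×ˢ univ))
    (𝒮.continuousOn_param g₀) (𝒮.isOpenMap_param (m := m) g₀) (𝒮.isOpen_B.prod isOpen_univ)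

variable (R) in
@[simp] theorem coe_paramHomeo [Fact (Module.finrank ℝ V = m + 1)] (g₀ : G) :
    ⇑(𝒮.paramHomeo (m := m) R g₀) = 𝒮.param R g₀ := rfl

variable (R) in
theorem mem_paramHomeo_target [Fact (Module.finrank ℝ V = m + 1)] (g₀ : G)
    (s : Metric.sphere (0 : V) 1) :
    AssocSphere.mk R (g₀, s) ∈ (𝒮.paramHomeo (m := m) R g₀).target ∧
      (𝒮.paramHomeo (m := m) R g₀).symm (AssocSphere.mk R (g₀, s)) = (0, s) := by
  have h0 : ((0, s) : EuclideanSpace ℝ (Fin p) × Metric.sphere (0 : V) 1) ∈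
    (𝒮.paramHomeo (m := m) R g₀).source := ⟨𝒮.zero_mem_B, mem_univ _⟩
  have h1 : 𝒮.paramHomeo (m := m) R g₀ (0, s) = AssocSphere.mk R (g₀, s) := by
    simp [param, 𝒮.σ_zero]
  rw [← h1]
  exact ⟨OpenPartialHomeomorph.map_source _ h0, OpenPartialHomeomorph.left_inv _ h0⟩

-- Locally this composite is `slide` for a suitable `k`, by injectivity of the parametrization.
variable (R) in
theorem contMDiffOn_paramHomeo_symm_mk [Fact (Module.finrank ℝ V = m + 1)] (g₀ : G) :
    ContMDiffOn (𝓘(ℝ, E).prod (𝓡 m)) (𝓘(ℝ, EuclideanSpace ℝ (Fin p)).prod (𝓡 m)) ∞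
      (fun q => (𝒮.paramHomeo (m := m) R g₀).symm (AssocSphere.mk R q))
      (AssocSphere.mk R ⁻¹' (𝒮.paramHomeo (m := m) R g₀).target) := by
  intro q hq
  set Q := 𝒮.paramHomeo (m := m) R g₀ with hQ
  have hy : Q.symm (AssocSphere.mk R q) ∈ Q.source := Q.map_target hq
  obtain ⟨k, hk, hks⟩ := 𝒮.exists_slide_eq (R := R) (g₀ := g₀) (q := q)
    (y := Q.symm (AssocSphere.mk R q)) hy.1 (Q.right_inv hq).symm
  have hs := (𝒮.contMDiffOn_slide (R := R) (m := m) g₀ k).contMDiffAt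
    ((𝒮.isOpen_slide_domain g₀ k).mem_nhds hk)
  refine (hs.congr_of_eventuallyEq ?_).contMDiffWithinAt
  have h₁ : 𝒮.slide R g₀ k ⁻¹' Q.source ∈ 𝓝 q :=
    hs.continuousAt.preimage_mem_nhds (Q.open_source.mem_nhds (by rw [hks]; exact hy))
  filter_upwards [h₁, (𝒮.isOpen_slide_domain g₀ k).mem_nhds hk] with q' h h'
  rw [← 𝒮.param_slide h']
  exact Q.left_inv h

/-- The submersion atlas of the associated sphere bundle. -/
noncomputable def atlas [Fact (Module.finrank ℝ V = m + 1)] (R : OrthogonalRep L V) :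
    SubmersionAtlas (𝓘(ℝ, E).prod (𝓡 m)) (EuclideanSpace ℝ (Fin (p + m)))
      (AssocSphere.mk R) :=
  let e : (EuclideanSpace ℝ (Fin p) × EuclideanSpace ℝ (Fin m)) ≃L[ℝ]
    EuclideanSpace ℝ (Fin (p + m)) := ContinuousLinearEquiv.ofFinrankEq (by simp)
  let Q := fun x : AssocSphere R => 𝒮.paramHomeo (m := m) R (Quotient.out x).1
  let χ := fun x : AssocSphere R => chartAt (EuclideanSpace ℝ (Fin m)) (Quotient.out x).2
  let χ' := fun x : AssocSphere R =>
    (OpenPartialHomeomorph.refl (EuclideanSpace ℝ (Fin p))).prod (χ x)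
  have hχ : ∀ x, ContMDiffOn (𝓘(ℝ, EuclideanSpace ℝ (Fin p)).prod (𝓡 m))
      𝓘(ℝ, EuclideanSpace ℝ (Fin p) × EuclideanSpace ℝ (Fin m)) ∞ (χ' x) (χ' x).source := by
    intro x
    have h₁ : ContMDiffOn (𝓡 m) (𝓡 m) ∞ (χ x) (χ x).source := contMDiffOn_chart
    rw [modelWithCornersSelf_prod, ← chartedSpaceSelf_prod]
    refine contMDiffOn_fst.prodMk (h₁.comp contMDiffOn_snd fun y hy => ?_)
    exact hy.2
  have hχs : ∀ x, ContMDiffOn 𝓘(ℝ, EuclideanSpace ℝ (Fin p) × EuclideanSpace ℝ (Fin m))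
      (𝓘(ℝ, EuclideanSpace ℝ (Fin p)).prod (𝓡 m)) ∞ (χ' x).symm (χ' x).target := by
    intro x
    have h₁ : ContMDiffOn (𝓡 m) (𝓡 m) ∞ (χ x).symm (χ x).target := contMDiffOn_chart_symm
    refine contDiff_fst.contMDiff.contMDiffOn.prodMk
      (h₁.comp contDiff_snd.contMDiff.contMDiffOn fun y hy => ?_)
    exact hy.2
  { chart := fun x => ((Q x).symm.trans (χ' x)).trans e.toHomeomorph.toOpenPartialHomeomorph
    lift := fun x u => ((Quotient.out x).1 * 𝒮.σ ((χ' x).symm (e.symm u)).1,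
      ((χ' x).symm (e.symm u)).2)
    mem_source := fun x => by
      have hx : AssocSphere.mk R (Quotient.out x) = x := Quotient.out_eq x
      have h := 𝒮.mem_paramHomeo_target (m := m) R (Quotient.out x).1 (Quotient.out x).2
      rw [Prod.mk.eta, hx] at h
      simp [Q, χ', χ, h.1, h.2]
    contMDiffOn_lift := fun x => by
      have h₁ : ContMDiffOn 𝓘(ℝ, EuclideanSpace ℝ (Fin (p + m)))
          (𝓘(ℝ, EuclideanSpace ℝ (Fin p)).prod (𝓡 m)) ∞ (fun u => (χ' x).symm (e.symm u))
          (((Q x).symm.trans (χ' x)).trans e.toHomeomorph.toOpenPartialHomeomorph).target := by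
        refine (hχs x).comp e.symm.contDiff.contMDiff.contMDiffOn fun u hu => ?_
        simp only [OpenPartialHomeomorph.trans_target] at hu
        exact hu.2.1
      refine ContMDiffOn.prodMk (contMDiffOn_const.mul (𝒮.contMDiffOn_σ.comp
        (contMDiff_fst.comp_contMDiffOn h₁) fun u hu => ?_)) (contMDiff_snd.comp_contMDiffOn h₁)
      simp only [OpenPartialHomeomorph.trans_target] at hu
      exact hu.2.2.1
    proj_lift := fun x u hu => rfl
    contMDiffOn_chart_proj := fun x => by
      have h₁ : ContMDiffOn (𝓘(ℝ, E).prod (𝓡 m))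
          𝓘(ℝ, EuclideanSpace ℝ (Fin p) × EuclideanSpace ℝ (Fin m)) ∞
          (fun q => χ' x ((Q x).symm (AssocSphere.mk R q)))
          (AssocSphere.mk R ⁻¹'
            (((Q x).symm.trans (χ' x)).trans e.toHomeomorph.toOpenPartialHomeomorph).source) := by
        refine (hχ x).comp ((𝒮.contMDiffOn_paramHomeo_symm_mk (m := m) R _).mono
          fun q hq => ?_) fun q hq => ?_
        · simp only [mem_preimage, OpenPartialHomeomorph.trans_source] at hq
          exact hq.1.1
        · simp only [mem_preimage, OpenPartialHomeomorph.trans_source] at hq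
          exact hq.1.2
      exact e.contDiff.contMDiff.comp_contMDiffOn h₁ }

end SubgroupSlice

end Charts

/-! ### Smoothness of the action and dimension of the orbits -/

theorem finrank_range_prodMap_id {P A B : Type*} [AddCommGroup P] [Module ℝ P] [AddCommGroup A]
    [Module ℝ A] [AddCommGroup B] [Module ℝ B] [FiniteDimensional ℝ P] [FiniteDimensional ℝ A]
    (f : A →ₗ[ℝ] B) :
    Module.finrank ℝ (LinearMap.range ((LinearMap.id : P →ₗ[ℝ] P).prodMap f)) =
      Module.finrank ℝ P + Module.finrank ℝ (LinearMap.range f) := by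
  have h : (LinearMap.id : P →ₗ[ℝ] P).prodMap f =
      ((LinearMap.id : P →ₗ[ℝ] P).prodMap (LinearMap.range f).subtype) ∘ₗ
        ((LinearMap.id : P →ₗ[ℝ] P).prodMap f.rangeRestrict) := by
    ext <;> simp
  rw [h, LinearMap.range_comp_of_range_eq_top, LinearMap.finrank_range_of_inj, Module.finrank_prod]
  · exact Function.Injective.prodMap Function.injective_id Subtype.val_injective
  · exact LinearMap.range_eq_top.2
      (Function.Surjective.prodMap Function.surjective_id f.surjective_rangeRestrict)

namespace SubgroupSlice

variable {E : Type*} [NormedAddCommGroup E] [NormedSpace ℝ E]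
  {G : Type*} [Group G] [TopologicalSpace G] [ChartedSpace E G] [LieGroup 𝓘(ℝ, E) ∞ G]
  {L : Subgroup G} {V : Type*} [NormedAddCommGroup V] [InnerProductSpace ℝ V]
  {p l m : ℕ} (𝒮 : SubgroupSlice (E := E) L p l) [Fact (Module.finrank ℝ V = m + 1)]
  (R : OrthogonalRep L V)

theorem contMDiff_mk :
    letI := (𝒮.atlas (m := m) R).chartedSpace
    ContMDiff (𝓘(ℝ, E).prod (𝓡 m)) (𝓡 (p + m)) ∞ (AssocSphere.mk R) :=
  (𝒮.atlas (m := m) R).contMDiff_proj AssocSphere.continuous_mk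

theorem contMDiffSMul :
    letI := (𝒮.atlas (m := m) R).chartedSpace
    ContMDiffSMul 𝓘(ℝ, E) (𝓡 (p + m)) ∞ G (AssocSphere R) := by
  let _ := (𝒮.atlas (m := m) R).chartedSpace
  refine ⟨fun y => ?_⟩
  obtain ⟨s, hs, hs'⟩ := (𝒮.atlas (m := m) R).exists_section y.2
  have hs₂ : ContMDiffAt (𝓘(ℝ, E).prod (𝓡 (p + m))) (𝓘(ℝ, E).prod (𝓡 m)) ∞
      (fun x : G × AssocSphere R => s x.2) y := hs.comp y contMDiffAt_snd
  have h₁ : ContMDiffAt (𝓘(ℝ, E).prod (𝓡 (p + m))) (𝓘(ℝ, E).prod (𝓡 m)) ∞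
      (fun x : G × AssocSphere R => (x.1 * (s x.2).1, (s x.2).2)) y :=
    (contMDiffAt_fst.mul (contMDiffAt_fst.comp y hs₂)).prodMk (contMDiffAt_snd.comp y hs₂)
  refine ((𝒮.contMDiff_mk (m := m) R).contMDiffAt.comp y h₁).congr_of_eventuallyEq ?_
  filter_upwards [continuous_snd.continuousAt.preimage_mem_nhds hs'] with x hx
  have hx' : AssocSphere.mk R (s x.2) = x.2 := hx
  calc x.1 • x.2 = x.1 • AssocSphere.mk R (s x.2) := by rw [hx']
    _ = _ := rfl

theorem contMDiffAt_param (g₀ : G) {y : EuclideanSpace ℝ (Fin p) × Metric.sphere (0 : V) 1}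
    (hy : y.1 ∈ 𝒮.B) :
    letI := (𝒮.atlas (m := m) R).chartedSpace
    ContMDiffAt (𝓘(ℝ, EuclideanSpace ℝ (Fin p)).prod (𝓡 m)) (𝓡 (p + m)) ∞ (𝒮.param R g₀) y := by
  let _ := (𝒮.atlas (m := m) R).chartedSpace
  have h : ContMDiffAt (𝓘(ℝ, EuclideanSpace ℝ (Fin p)).prod (𝓡 m)) 𝓘(ℝ, E) ∞
      (fun y : EuclideanSpace ℝ (Fin p) × Metric.sphere (0 : V) 1 => g₀ * 𝒮.σ y.1) y :=
    contMDiffAt_const.mul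
      ((𝒮.contMDiffOn_σ.contMDiffAt (𝒮.isOpen_B.mem_nhds hy)).comp y contMDiffAt_fst)
  exact (𝒮.contMDiff_mk (m := m) R).contMDiffAt.comp y (h.prodMk contMDiffAt_snd)

theorem contMDiffAt_paramHomeo_symm (g₀ : G) {x : AssocSphere R}
    (hx : x ∈ (𝒮.paramHomeo (m := m) R g₀).target) :
    letI := (𝒮.atlas (m := m) R).chartedSpace
    ContMDiffAt (𝓡 (p + m)) (𝓘(ℝ, EuclideanSpace ℝ (Fin p)).prod (𝓡 m)) ∞
      (𝒮.paramHomeo (m := m) R g₀).symm x := by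
  let _ := (𝒮.atlas (m := m) R).chartedSpace
  set Q := 𝒮.paramHomeo (m := m) R g₀
  obtain ⟨s, hs, hs'⟩ := (𝒮.atlas (m := m) R).exists_section x
  have hsx : AssocSphere.mk R (s x) = x := hs'.self_of_nhds
  have h₁ := (𝒮.contMDiffOn_paramHomeo_symm_mk (m := m) R g₀).contMDiffAt
    ((Q.open_target.preimage AssocSphere.continuous_mk).mem_nhds (x := s x)
      (by rw [mem_preimage, hsx]; exact hx))
  refine (h₁.comp x hs).congr_of_eventuallyEq ?_
  filter_upwards [hs'] with y hy
  simp only [Function.comp, hy]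
  rfl

/-- The dimension of the orbit of `[g₀, s]` in `G ×_L S(V)`. -/
theorem finrank_range_mfderiv_smul [FiniteDimensional ℝ E] (g₀ : G)
    (s : Metric.sphere (0 : V) 1) :
    letI := (𝒮.atlas (m := m) R).chartedSpace
    Module.finrank ℝ (LinearMap.range (mfderiv 𝓘(ℝ, E) (𝓡 (p + m))
      (fun g : G => g • AssocSphere.mk R (g₀, s)) 1).toLinearMap) =
    p + Module.finrank ℝ (LinearMap.range ((ContinuousLinearMap.apply ℝ V (s : V)).toLinearMap ∘ₗ
      (fderiv ℝ (fun a => R.toHom (prodParam 𝒮.γ a)) 0).toLinearMap)) := by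
  let _ := (𝒮.atlas (m := m) R).chartedSpace
  have := (𝒮.atlas (m := m) R).isManifold
  have := 𝒮.contMDiffSMul (m := m) R
  have : FiniteDimensional ℝ V := .of_fact_finrank_eq_succ m
  have hT : IsTopologicalGroup G := topologicalGroup_of_lieGroup 𝓘(ℝ, E) ∞
  let X := EuclideanSpace ℝ (Fin p) × (Fin l → ℝ)
  let Q := 𝒮.paramHomeo (m := m) R g₀
  -- Conjugation by `g₀` gives `c x * g₀ = g₀ * 𝒮.Θ x`, so that left translation of `[g₀, s]` moves
  -- along the slice based at `g₀`.
  let c : X → G := fun x => g₀ * 𝒮.Θ x * g₀⁻¹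
  let c' : G → X := fun g => 𝒮.Θ.symm (g₀⁻¹ * g * g₀)
  let f : G → AssocSphere R := fun g => g • AssocSphere.mk R (g₀, s)
  let j : EuclideanSpace ℝ (Fin p) × Metric.sphere (0 : V) 1 → EuclideanSpace ℝ (Fin p) × V :=
    Prod.map id Subtype.val
  let ψ : AssocSphere R → EuclideanSpace ℝ (Fin p) × V := fun x => j (Q.symm x)
  have h0 : (0 : X) ∈ 𝒮.Θ.source := 𝒮.mem_source 0 𝒮.zero_mem_B
  have hΘ0 : 𝒮.Θ 0 = 1 := (𝒮.Θ_zero_right 𝒮.zero_mem_B).trans 𝒮.σ_zero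
  have h1 : (1 : G) ∈ 𝒮.Θ.target := hΘ0 ▸ 𝒮.Θ.map_source h0
  have hΘ1 : 𝒮.Θ.symm 1 = 0 := by rw [← hΘ0, 𝒮.Θ.left_inv h0]
  have hc0 : c 0 = 1 := by simp [c, hΘ0]
  have hc1 : c' 1 = 0 := by simp [c', hΘ1]
  have hf1 : f 1 = AssocSphere.mk R (g₀, s) := one_smul _ _
  obtain ⟨hxt, hxs⟩ := 𝒮.mem_paramHomeo_target (m := m) R g₀ s
  have hcd : MDifferentiableAt 𝓘(ℝ, X) 𝓘(ℝ, E) c 0 :=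
    ((contMDiffAt_const.mul (𝒮.contMDiffOn_Θ.contMDiffAt
      (𝒮.Θ.open_source.mem_nhds h0))).mul contMDiffAt_const).mdifferentiableAt (by simp)
  have hcd' : MDifferentiableAt 𝓘(ℝ, E) 𝓘(ℝ, X) c' 1 := by
    have a : ContMDiffAt 𝓘(ℝ, E) 𝓘(ℝ, X) ∞ 𝒮.Θ.symm (g₀⁻¹ * 1 * g₀) := by
      refine 𝒮.contMDiffOn_Θ_symm.contMDiffAt (𝒮.Θ.open_target.mem_nhds ?_)
      simpa using h1
    refine (ContMDiffAt.comp (1 : G) (f := fun g : G => g₀⁻¹ * g * g₀) a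
      ((contMDiffAt_const.mul contMDiffAt_id).mul contMDiffAt_const)).mdifferentiableAt (by simp)
  have hcs : Function.Surjective (mfderiv 𝓘(ℝ, X) 𝓘(ℝ, E) c 0 : X → E) := by
    intro v
    refine ⟨(mfderiv 𝓘(ℝ, E) 𝓘(ℝ, X) c' 1 : E → X) v, ?_⟩
    have := mfderiv_comp_eq_id_of_eventually (f := c') (g := c) hcd' (by rw [hc1]; exact hcd) ?_ v
    · rwa [hc1] at this
    · have ho : IsOpen ((fun g : G => g₀⁻¹ * g * g₀) ⁻¹' 𝒮.Θ.target) :=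
        𝒮.Θ.open_target.preimage ((continuous_const.mul continuous_id).mul continuous_const)
      filter_upwards [ho.mem_nhds (x := 1) (by simpa using h1)] with g hg
      simp only [c, c']
      rw [𝒮.Θ.right_inv hg]
      group
  have hfd : MDifferentiableAt 𝓘(ℝ, E) (𝓡 (p + m)) f 1 :=
    ContMDiffAt.mdifferentiableAt (n := ∞) (ContMDiffAt.smul (f := fun g : G => g)
      (g := fun _ => AssocSphere.mk R (g₀, s)) contMDiffAt_id contMDiffAt_const) (by simp)
  have hQd : MDifferentiableAt (𝓡 (p + m)) (𝓘(ℝ, EuclideanSpace ℝ (Fin p)).prod (𝓡 m))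
      Q.symm (AssocSphere.mk R (g₀, s)) :=
    (𝒮.contMDiffAt_paramHomeo_symm (m := m) R g₀ hxt).mdifferentiableAt (by simp)
  have hvd : MDifferentiableAt (𝓡 m) 𝓘(ℝ, V) (Subtype.val : Metric.sphere (0 : V) 1 → V) s :=
    (contMDiff_coe_sphere (m := ∞)).mdifferentiable (by simp) s
  have hjd : MDifferentiableAt (𝓘(ℝ, EuclideanSpace ℝ (Fin p)).prod (𝓡 m))
      (𝓘(ℝ, EuclideanSpace ℝ (Fin p)).prod 𝓘(ℝ, V)) j (0, s) :=
    MDifferentiableAt.prodMap mdifferentiableAt_id hvd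
  have hjd' : MDifferentiableAt (𝓘(ℝ, EuclideanSpace ℝ (Fin p)).prod (𝓡 m))
      (𝓘(ℝ, EuclideanSpace ℝ (Fin p)).prod 𝓘(ℝ, V)) j (Q.symm (AssocSphere.mk R (g₀, s))) := by
    rw [hxs]; exact hjd
  have hψd : MDifferentiableAt (𝓡 (p + m)) (𝓘(ℝ, EuclideanSpace ℝ (Fin p)).prod 𝓘(ℝ, V))
      ψ (AssocSphere.mk R (g₀, s)) :=
    MDifferentiableAt.comp _ (g := j) (f := Q.symm) hjd' hQd
  have hji : Function.Injective (mfderiv (𝓘(ℝ, EuclideanSpace ℝ (Fin p)).prod (𝓡 m))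
      (𝓘(ℝ, EuclideanSpace ℝ (Fin p)).prod 𝓘(ℝ, V)) j (0, s) :
      EuclideanSpace ℝ (Fin p) × EuclideanSpace ℝ (Fin m) → EuclideanSpace ℝ (Fin p) × V) := by
    have a : mfderiv (𝓘(ℝ, EuclideanSpace ℝ (Fin p)).prod (𝓡 m))
      (𝓘(ℝ, EuclideanSpace ℝ (Fin p)).prod 𝓘(ℝ, V)) j (0, s) = _ :=
      mfderiv_prodMap (p := ((0 : EuclideanSpace ℝ (Fin p)), s)) mdifferentiableAt_id hvd
    rw [a]
    have b : Function.Injective (mfderiv (𝓡 m) 𝓘(ℝ, V)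
        (Subtype.val : Metric.sphere (0 : V) 1 → V) s) := by
      convert! injective_mvfderiv_subtypeVal_sphere s
    have b' : Function.Injective (mfderiv 𝓘(ℝ, EuclideanSpace ℝ (Fin p))
        𝓘(ℝ, EuclideanSpace ℝ (Fin p)) id (0 : EuclideanSpace ℝ (Fin p))) := by
      rw [mfderiv_id]; exact Function.injective_id
    exact Function.Injective.prodMap b' b
  have hψi : Function.Injective (mfderiv (𝓡 (p + m))
      (𝓘(ℝ, EuclideanSpace ℝ (Fin p)).prod 𝓘(ℝ, V)) ψ (AssocSphere.mk R (g₀, s)) :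
      EuclideanSpace ℝ (Fin (p + m)) → EuclideanSpace ℝ (Fin p) × V) := by
    have a : mfderiv (𝓡 (p + m)) (𝓘(ℝ, EuclideanSpace ℝ (Fin p)).prod 𝓘(ℝ, V)) ψ
        (AssocSphere.mk R (g₀, s)) = _ :=
      mfderiv_comp (AssocSphere.mk R (g₀, s)) (g := j) (f := Q.symm)
        hjd' hQd
    rw [a, hxs]
    suffices hQi : Function.Injective (mfderiv (𝓡 (p + m))
        (𝓘(ℝ, EuclideanSpace ℝ (Fin p)).prod (𝓡 m)) Q.symm (AssocSphere.mk R (g₀, s)) :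
        EuclideanSpace ℝ (Fin (p + m)) →
          EuclideanSpace ℝ (Fin p) × EuclideanSpace ℝ (Fin m)) by
      intro v w hvw
      exact hQi (hji hvw)
    refine Function.LeftInverse.injective
      (g := (mfderiv (𝓘(ℝ, EuclideanSpace ℝ (Fin p)).prod (𝓡 m)) (𝓡 (p + m)) (𝒮.param R g₀)
        (Q.symm (AssocSphere.mk R (g₀, s))) : EuclideanSpace ℝ (Fin p) × EuclideanSpace ℝ (Fin m) →
        EuclideanSpace ℝ (Fin (p + m)))) fun v => ?_
    refine mfderiv_comp_eq_id_of_eventually (f := Q.symm) (g := 𝒮.param R g₀) hQd ?_ ?_ v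
    · refine (𝒮.contMDiffAt_param (m := m) R g₀ ?_).mdifferentiableAt (by simp)
      rw [hxs]; exact 𝒮.zero_mem_B
    · filter_upwards [Q.open_target.mem_nhds hxt] with y hy
      exact Q.right_inv hy
  have key := finrank_range_mfderiv_eq hc0 hf1 hcd hfd hψd hcs hψi
  refine key.trans ?_
  let D := fderiv ℝ (fun a => R.toHom (prodParam 𝒮.γ a)) 0
  have hD : HasFDerivAt (fun a => R.toHom (prodParam 𝒮.γ a)) D 0 :=
    ((𝒮.contDiff_rep R).differentiable (by simp) 0).hasFDerivAt
  -- In these coordinates the orbit map splits: the slice parameter is kept, and the parameter of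
  -- `L` acts on `s` through the representation. The two ranks therefore add up.
  have hH : (fun w => ψ (f (c w))) =ᶠ[𝓝 (0 : X)]
      fun x => (x.1, R.toHom (prodParam 𝒮.γ x.2) s) := by
    have hB : ∀ᶠ x : X in 𝓝 0, x.1 ∈ 𝒮.B :=
      continuous_fst.continuousAt.preimage_mem_nhds (𝒮.isOpen_B.mem_nhds 𝒮.zero_mem_B)
    filter_upwards [hB, 𝒮.Θ.open_source.mem_nhds h0] with x hx hx'
    have e : f (c x) = Q (x.1, R.act (prodParam 𝒮.γ x.2) s) := by
      simp only [f, c, Q, AssocSphere.smul_mk, coe_paramHomeo, param]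
      rw [inv_mul_cancel_right, 𝒮.Θ_apply x hx', ← mul_assoc, AssocSphere.mk_mul_left]
    simp only [ψ]
    rw [e, Q.left_inv (show _ ∈ Q.source from ⟨hx, mem_univ _⟩)]
    rfl
  have hHd : HasMFDerivAt 𝓘(ℝ, X) (𝓘(ℝ, EuclideanSpace ℝ (Fin p)).prod 𝓘(ℝ, V))
      (fun x : X => (x.1, R.toHom (prodParam 𝒮.γ x.2) s)) 0
      ((ContinuousLinearMap.fst ℝ (EuclideanSpace ℝ (Fin p)) (Fin l → ℝ)).prod
        (ContinuousLinearMap.apply ℝ V (s : V) ∘L D ∘L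
          ContinuousLinearMap.snd ℝ (EuclideanSpace ℝ (Fin p)) (Fin l → ℝ))) := by
    have a₁ : HasFDerivAt (fun x : X => x.1)
        (ContinuousLinearMap.fst ℝ (EuclideanSpace ℝ (Fin p)) (Fin l → ℝ)) 0 := hasFDerivAt_fst
    have a₂ : HasFDerivAt (fun x : X => R.toHom (prodParam 𝒮.γ x.2) (s : V))
        (ContinuousLinearMap.apply ℝ V (s : V) ∘L D ∘L
          ContinuousLinearMap.snd ℝ (EuclideanSpace ℝ (Fin p)) (Fin l → ℝ)) 0 :=
      (ContinuousLinearMap.apply ℝ V (s : V)).hasFDerivAt.comp (0 : X)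
        (HasFDerivAt.comp (0 : X) (f := Prod.snd) hD hasFDerivAt_snd)
    exact a₁.hasMFDerivAt.prodMk a₂.hasMFDerivAt
  rw [hH.mfderiv_eq, hHd.mfderiv]
  have := finrank_range_prodMap_id (P := EuclideanSpace ℝ (Fin p))
    ((ContinuousLinearMap.apply ℝ V (s : V)).toLinearMap ∘ₗ D.toLinearMap)
  rw [finrank_euclideanSpace_fin] at this
  exact this

end SubgroupSlice

theorem prodParam_single {H : Type*} [Group H] [TopologicalSpace H] {l : ℕ} {γ : Fin l → ℝ → H}
    (hγ : ∀ i, IsOneParam (γ i)) (i : Fin l) (t : ℝ) : prodParam γ (Pi.single i t) = γ i t := by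
  induction l with
  | zero => exact i.elim0
  | succ l ih =>
    rw [prodParam_succ]
    refine Fin.cases ?_ (fun j => ?_) i
    · have h : (fun j : Fin l => (Pi.single 0 t : Fin (l + 1) → ℝ) j.succ) = 0 := by
        ext j; simp
      rw [h, prodParam_zero fun j => hγ j.succ]
      simp
    · have h : (fun k : Fin l => (Pi.single j.succ t : Fin (l + 1) → ℝ) k.succ) =
          Pi.single j t := by
        ext k; simp [Pi.single_apply]
      rw [h, ih fun j => hγ j.succ]
      simp [(hγ 0).map_zero]

/-! ### The image of the tangent space of the subgroup under a representation -/

namespace SubgroupSlice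

variable {E : Type*} [NormedAddCommGroup E] [NormedSpace ℝ E]
  {G : Type*} [Group G] [TopologicalSpace G] [ChartedSpace E G]
  {L : Subgroup G} {V : Type*} [NormedAddCommGroup V] [InnerProductSpace ℝ V]
  [FiniteDimensional ℝ V]
  {p l : ℕ} (𝒮 : SubgroupSlice (E := E) L p l) (R : OrthogonalRep L V)

theorem Θ_symm_one : 𝒮.Θ.symm 1 = 0 := by
  rw [← 𝒮.σ_zero, 𝒮.Θ_symm_σ 𝒮.zero_mem_B]; rfl

theorem one_mem_target : (1 : G) ∈ 𝒮.Θ.target := by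
  rw [← 𝒮.σ_zero]; exact 𝒮.σ_mem_target 𝒮.zero_mem_B

/-- The subgroup is, near the identity, parametrized by products of one-parameter subgroups. -/
theorem eventually_eq_prodParam :
    ∀ᶠ g in 𝓝 (1 : G), ∀ h : g ∈ L, (⟨g, h⟩ : L) = prodParam 𝒮.γ (𝒮.Θ.symm g).2 := by
  have h₁ : ∀ᶠ g in 𝓝 (1 : G), (𝒮.Θ.symm g).1 ∈ 𝒮.B := by
    refine (continuous_fst.continuousAt.comp (𝒮.Θ.symm.continuousAt 𝒮.one_mem_target))
      |>.preimage_mem_nhds (𝒮.isOpen_B.mem_nhds ?_)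
    simp [𝒮.Θ_symm_one, 𝒮.zero_mem_B]
  filter_upwards [h₁, 𝒮.Θ.open_target.mem_nhds 𝒮.one_mem_target] with g hg hg' hgL
  have h₂ := 𝒮.Θ_apply _ (𝒮.Θ.map_target hg')
  rw [𝒮.Θ.right_inv hg'] at h₂
  have h₃ : (0 : EuclideanSpace ℝ (Fin p)) = (𝒮.Θ.symm g).1 := by
    refine 𝒮.eq_of_mem 0 𝒮.zero_mem_B _ hg ?_
    rw [𝒮.σ_zero, inv_one, one_mul, eq_mul_inv_of_mul_eq h₂.symm]
    exact L.mul_mem hgL (L.inv_mem (Subtype.property _))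
  rw [← h₃, 𝒮.σ_zero, one_mul] at h₂
  exact Subtype.ext h₂

/-- The image of the tangent space of the subgroup under the differential of a representation. -/
noncomputable def tangentImage : Submodule ℝ (V →L[ℝ] V) :=
  LinearMap.range (fderiv ℝ (fun a => R.toHom (prodParam 𝒮.γ a)) 0).toLinearMap

theorem hasFDerivAt_rep : HasFDerivAt (fun a => R.toHom (prodParam 𝒮.γ a))
    (fderiv ℝ (fun a => R.toHom (prodParam 𝒮.γ a)) 0) 0 :=
  ((𝒮.contDiff_rep R).differentiable (by simp) 0).hasFDerivAt

theorem hasDerivAt_rep_line (a : Fin l → ℝ) : HasDerivAt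
    (fun t : ℝ => R.toHom (prodParam 𝒮.γ (t • a)))
    (fderiv ℝ (fun a => R.toHom (prodParam 𝒮.γ a)) 0 a) 0 := by
  have h₁ : HasDerivAt (fun t : ℝ => t • a) a 0 := by
    simpa using (hasDerivAt_id (0 : ℝ)).smul_const a
  have h₂ : HasFDerivAt (fun a => R.toHom (prodParam 𝒮.γ a))
      (fderiv ℝ (fun a => R.toHom (prodParam 𝒮.γ a)) 0) ((0 : ℝ) • a) := by
    rw [zero_smul]; exact 𝒮.hasFDerivAt_rep R
  exact h₂.comp_hasDerivAt (0 : ℝ) h₁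

theorem exists_curve_of_mem_tangentImage {A : V →L[ℝ] V} (hA : A ∈ 𝒮.tangentImage R) :
    ∃ w : ℝ → L, w 0 = 1 ∧ HasDerivAt (fun t => R.toHom (w t)) A 0 := by
  obtain ⟨a, rfl⟩ := hA
  exact ⟨fun t => prodParam 𝒮.γ (t • a), by simp [prodParam_zero 𝒮.isOneParam],
    𝒮.hasDerivAt_rep_line R a⟩

variable [LieGroup 𝓘(ℝ, E) ∞ G]

/-- A conjugated curve stays in `L`, so near `1` it is `prodParam` of a smooth curve of parameters;
its velocity under the representation can be computed in both ways. -/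
theorem conj_mem_tangentImage {A : V →L[ℝ] V} (hA : A ∈ 𝒮.tangentImage R) (k : L) :
    R.toHom k * A * R.toHom k⁻¹ ∈ 𝒮.tangentImage R := by
  obtain ⟨a, rfl⟩ := hA
  have : CompleteSpace V := FiniteDimensional.complete ℝ V
  let u : ℝ → G := fun t => k * (prodParam 𝒮.γ (t • a) : L) * (k : G)⁻¹
  have hu0 : u 0 = 1 := by simp [u, prodParam_zero 𝒮.isOneParam]
  have hus : ContMDiffAt 𝓘(ℝ, ℝ) 𝓘(ℝ, E) ∞ u 0 := by
    have h₁ : ContMDiff 𝓘(ℝ, ℝ) 𝓘(ℝ, Fin l → ℝ) ∞ (fun t : ℝ => t • a) :=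
      (contDiff_id.smul contDiff_const).contMDiff
    exact (contMDiffAt_const.mul (𝒮.contMDiff_γ.comp h₁).contMDiffAt).mul contMDiffAt_const
  have hα : ContDiffAt ℝ ∞ (fun t => (𝒮.Θ.symm (u t)).2) 0 := by
    have h₁ : ContMDiffAt 𝓘(ℝ, ℝ) 𝓘(ℝ, EuclideanSpace ℝ (Fin p) × (Fin l → ℝ)) ∞
        (fun t => 𝒮.Θ.symm (u t)) 0 := by
      refine ContMDiffAt.comp (0 : ℝ) (𝒮.contMDiffOn_Θ_symm.contMDiffAt ?_) hus
      rw [hu0]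
      exact 𝒮.Θ.open_target.mem_nhds 𝒮.one_mem_target
    exact contDiffAt_snd.comp (0 : ℝ) (contMDiffAt_iff_contDiffAt.1 h₁)
  have hα0 : (𝒮.Θ.symm (u 0)).2 = 0 := by rw [hu0, 𝒮.Θ_symm_one]; rfl
  obtain ⟨α', hα'⟩ : ∃ α', HasDerivAt (fun t => (𝒮.Θ.symm (u t)).2) α' 0 :=
    ⟨_, (hα.differentiableAt (by simp)).hasDerivAt⟩
  have h₁ : HasDerivAt (fun t => R.toHom (prodParam 𝒮.γ (𝒮.Θ.symm (u t)).2))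
      (fderiv ℝ (fun a => R.toHom (prodParam 𝒮.γ a)) 0 α') 0 := by
    have h₂ : HasFDerivAt (fun a => R.toHom (prodParam 𝒮.γ a))
        (fderiv ℝ (fun a => R.toHom (prodParam 𝒮.γ a)) 0) (𝒮.Θ.symm (u 0)).2 := by
      rw [hα0]; exact 𝒮.hasFDerivAt_rep R
    exact h₂.comp_hasDerivAt (0 : ℝ) hα'
  have h₂ : HasDerivAt (fun t : ℝ => R.toHom k * R.toHom (prodParam 𝒮.γ (t • a)) * R.toHom k⁻¹)
      (R.toHom k * fderiv ℝ (fun a => R.toHom (prodParam 𝒮.γ a)) 0 a * R.toHom k⁻¹) 0 :=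
    ((𝒮.hasDerivAt_rep_line R a).const_mul _).mul_const _
  have h₃ : (fun t => R.toHom (prodParam 𝒮.γ (𝒮.Θ.symm (u t)).2)) =ᶠ[𝓝 0]
      fun t : ℝ => R.toHom k * R.toHom (prodParam 𝒮.γ (t • a)) * R.toHom k⁻¹ := by
    have h₄ : Tendsto u (𝓝 0) (𝓝 1) := by
      have := hus.continuousAt.tendsto; rwa [hu0] at this
    filter_upwards [h₄ 𝒮.eventually_eq_prodParam] with t ht
    have h₅ : u t ∈ L := (k * prodParam 𝒮.γ (t • a) * k⁻¹).2
    rw [← ht h₅, ← map_mul, ← map_mul]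
    rfl
  have h₄ := (h₁.congr_of_eventuallyEq h₃.symm).unique h₂
  exact ⟨α', h₄⟩

/-- If the image vanished, each one-parameter subgroup would act with zero derivative, hence
trivially. Then `L` acts trivially near `1`, so `π.ker` is open in the compact group `L` and `W` is
finite. -/
theorem tangentImage_ne_bot [CompactSpace G] {W : Type*} [Group W] [Infinite W]
    (hL : IsClosed (L : Set G)) (π : L →* W) (hπ : Function.Surjective π)
    (hR : ∀ k, R.toHom k = 1 → π k = 1) : 𝒮.tangentImage R ≠ ⊥ := by
  intro hbot
  have : IsTopologicalGroup G := topologicalGroup_of_lieGroup 𝓘(ℝ, E) ∞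
  have : CompactSpace L := isCompact_iff_compactSpace.1 hL.isCompact
  have : CompleteSpace V := FiniteDimensional.complete ℝ V
  have h₁ : ∀ i t, R.toHom (𝒮.γ i t) = 1 := by
    intro i
    let h : ℝ → V →L[ℝ] V := fun t => R.toHom (𝒮.γ i t)
    have hadd : ∀ s t, h (s + t) = h s * h t := fun s t => by
      simp [h, (𝒮.isOneParam i).map_add]
    have h00 : h 0 = 1 := by simp [h, (𝒮.isOneParam i).map_zero]
    have h0 : HasDerivAt h 0 0 := by
      have h₂ := 𝒮.hasDerivAt_rep_line R (Pi.single i 1)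
      have h₃ : fderiv ℝ (fun a => R.toHom (prodParam 𝒮.γ a)) 0 (Pi.single i 1) = 0 := by
        have : fderiv ℝ (fun a => R.toHom (prodParam 𝒮.γ a)) 0 (Pi.single i 1) ∈
          𝒮.tangentImage R := ⟨_, rfl⟩
        rwa [hbot, Submodule.mem_bot] at this
      rw [h₃] at h₂
      refine h₂.congr_of_eventuallyEq (Eventually.of_forall fun t => ?_)
      simp only [h]
      rw [← Pi.single_smul, prodParam_single 𝒮.isOneParam]
      simp
    have hd : ∀ t, HasDerivAt h 0 t := by
      intro t
      have h₂ : HasDerivAt (fun s => h t * h s) (h t * 0) (t - t) := by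
        rw [sub_self]; exact h0.const_mul _
      have h₃ := h₂.comp_sub_const t t
      rw [mul_zero] at h₃
      refine h₃.congr_of_eventuallyEq (Eventually.of_forall fun s => ?_)
      change h s = h t * h (s - t)
      rw [← hadd, add_sub_cancel]
    intro t
    exact (is_const_of_deriv_eq_zero (fun t => (hd t).differentiableAt) (fun t => (hd t).deriv)
      t 0).trans h00
  have h₂ : ∀ a, R.toHom (prodParam 𝒮.γ a) = 1 := fun a => by
    rw [map_prodParam]; exact prodParam_eq_one h₁ a
  have h₃ : (π.ker : Set L) ∈ 𝓝 (1 : L) := by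
    have h₄ : ∀ᶠ k : L in 𝓝 1, ∀ h : (k : G) ∈ L,
        (⟨k, h⟩ : L) = prodParam 𝒮.γ (𝒮.Θ.symm k).2 :=
      (continuous_subtype_val.tendsto' (1 : L) (1 : G) rfl).eventually 𝒮.eventually_eq_prodParam
    filter_upwards [h₄] with k hk
    refine hR k ?_
    have := hk k.2
    rw [Subtype.coe_eta] at this
    rw [this, h₂]
  have h₅ : Finite (L ⧸ π.ker) :=
    Subgroup.quotient_finite_of_isOpen _ (Subgroup.isOpen_of_mem_nhds _ h₃)
  have : Finite W := Finite.of_equiv _ (QuotientGroup.quotientKerEquivOfSurjective π hπ).toEquiv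
  exact not_finite W

end SubgroupSlice

/-- A closed subgroup of a compact group which is contained in a conjugate of itself is equal to
that conjugate. -/
theorem Subgroup.conj_mem_of_forall_inv_conj_mem {G : Type*} [Group G] [TopologicalSpace G]
    [IsTopologicalGroup G] [CompactSpace G] {K : Subgroup G} (hK : IsClosed (K : Set G)) {u : G}
    (hu : ∀ x ∈ K, u⁻¹ * x * u ∈ K) {x : G} (hx : x ∈ K) : u * x * u⁻¹ ∈ K := by
  have hpow : ∀ (n : ℕ), ∀ x ∈ K, (u ^ n)⁻¹ * x * u ^ n ∈ K := by
    intro n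
    induction n with
    | zero => intro x hx; simpa using hx
    | succ n ih =>
      intro x hx
      have := hu _ (ih x hx)
      rw [pow_succ]
      simpa [mul_assoc] using this
  have hcl : IsClosed ((fun y : G => y⁻¹ * x * y) ⁻¹' K) :=
    hK.preimage ((continuous_inv.mul continuous_const).mul continuous_id)
  -- In a compact group an inverse is a limit point of the positive powers, and the condition at
  -- hand is closed and stable under positive powers.
  have h₁ : u⁻¹ ∈ _root_.closure (range (u ^ · : ℕ → G)) :=
    ((mapClusterPt_atTop_pow_tfae u⁻¹ u).out 0 2).1
      (by simpa using mapClusterPt_self_zpow_atTop_pow u (-1))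
  have h₂ : u⁻¹ ∈ (fun y : G => y⁻¹ * x * y) ⁻¹' K :=
    closure_minimal (by rintro _ ⟨n, rfl⟩; exact hpow n x hx) hcl h₁
  simpa using h₂

/-- An orthogonal representation of `W` on a space of dimension `m + 1` such that `W` acts freely
on the unit sphere outside a single orbit `Z`, which is not free, with orbit space of
dimension `c`. The last field expresses the dimension of the free orbits without reference to the
Lie algebra of `W`. -/
structure IsSphereModel {W V : Type*} [Group W] [TopologicalSpace W] [NormedAddCommGroup V]
    [InnerProductSpace ℝ V] (R : OrthogonalRep W V) (Z : Set (Metric.sphere (0 : V) 1))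
    (m c : ℕ) : Prop where
  one_le : 1 ≤ m
  free : ∀ s ∉ Z, ∀ w, R.act w s = s → w = 1
  exists_notMem : ∃ s, s ∉ Z
  exists_ne_one : ∀ s ∈ Z, ∃ w ≠ 1, R.act w s = s
  nonempty : Z.Nonempty
  transitive : ∀ s ∈ Z, ∀ s' ∈ Z, ∃ w, R.act w s = s'
  finrank_add : ∀ 𝔯 : Submodule ℝ (V →L[ℝ] V), 𝔯 ≠ ⊥ →
    (∀ w, ∀ A ∈ 𝔯, R.toHom w * A * R.toHom w⁻¹ ∈ 𝔯) →
    (∀ A ∈ 𝔯, ∃ w : ℝ → W, w 0 = 1 ∧ HasDerivAt (fun t => R.toHom (w t)) A 0) →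
    ∀ s ∉ Z, Module.finrank ℝ
      (𝔯.map (ContinuousLinearMap.apply ℝ V (s : V)).toLinearMap) + c = m

/-! ### Isotropy groups and orbits of the associated sphere bundle -/

namespace AssocSphere

variable {G : Type*} [Group G] [TopologicalSpace G] {K L : Subgroup G}
  {W : Type*} [Group W] [TopologicalSpace W]
  {V : Type*} [NormedAddCommGroup V] [InnerProductSpace ℝ V]
  {R : OrthogonalRep W V} {Z : Set (Metric.sphere (0 : V) 1)} {m c : ℕ}
  {π : L →* W} {hπ : Continuous π}

theorem mem_stabilizer_mk {g : G} {s : Metric.sphere (0 : V) 1} {h : G} :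
    h ∈ MulAction.stabilizer G (mk (R.comp π hπ) (g, s)) ↔
      ∃ k : L, h = g * k * g⁻¹ ∧ R.act (π k) s = s := by
  rw [MulAction.mem_stabilizer_iff, smul_mk, mk_eq_mk]
  refine exists_congr fun k => and_congr ?_ ⟨fun h => h.symm, fun h => h.symm⟩
  exact ⟨fun h => by rw [← h]; group, fun h => by rw [h]; group⟩

variable (hKL : K ≤ L) (hker : ∀ k : L, π k = 1 ↔ (k : G) ∈ K)

include hKL hker in
theorem mem_stabilizer_of_conj_mem {g h : G} (s : Metric.sphere (0 : V) 1)
    (hh : g⁻¹ * h * g ∈ K) : h ∈ MulAction.stabilizer G (mk (R.comp π hπ) (g, s)) := by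
  refine mem_stabilizer_mk.2 ⟨⟨_, hKL hh⟩, by group, ?_⟩
  rw [(hker _).2 hh, R.act_one]

include hKL hker in
theorem mem_stabilizer_iff_of_notMem (hR : IsSphereModel R Z m c) {g h : G}
    {s : Metric.sphere (0 : V) 1} (hs : s ∉ Z) :
    h ∈ MulAction.stabilizer G (mk (R.comp π hπ) (g, s)) ↔ g⁻¹ * h * g ∈ K := by
  refine ⟨fun h => ?_, mem_stabilizer_of_conj_mem hKL hker s⟩
  obtain ⟨k, rfl, hk⟩ := mem_stabilizer_mk.1 h
  have : g⁻¹ * (g * (k : G) * g⁻¹) * g = k := by group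
  rw [this]
  exact (hker k).1 (hR.free s hs _ hk)

-- Every isotropy group contains a conjugate of `K`, and outside `Z` it equals one.
include hKL hker in
theorem isPrincipalOrbit_of_notMem (hR : IsSphereModel R Z m c) {g : G}
    {s : Metric.sphere (0 : V) 1} (hs : s ∉ Z) :
    IsPrincipalOrbit (Quotient.mk'' (mk (R.comp π hπ) (g, s))
        : MulAction.orbitRel.Quotient G (AssocSphere (R.comp π hπ))) := by
  intro x hx y
  rw [MulAction.orbitRel.Quotient.orbit_mk] at hx
  obtain ⟨u, rfl⟩ := hx
  obtain ⟨⟨g', s'⟩, rfl⟩ := mk_surjective y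
  refine ⟨u * g * g'⁻¹, fun h hh => ?_⟩
  simp only [smul_mk] at hh ⊢
  rw [mem_stabilizer_iff_of_notMem hKL hker hR hs] at hh
  refine mem_stabilizer_of_conj_mem hKL hker s' ?_
  simpa using hh

-- Were the orbit principal, its isotropy group would lie in a conjugate of `K`. As it also contains
-- a conjugate of `K`, compactness forces equality, which contradicts the nontrivial element of `W`
-- fixing `s`.
include hKL hker in
theorem not_isPrincipalOrbit_of_mem [IsTopologicalGroup G] [CompactSpace G]
    (hK : IsClosed (K : Set G)) (hsurj : Function.Surjective π) (hR : IsSphereModel R Z m c) {g : G}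
    {s : Metric.sphere (0 : V) 1} (hs : s ∈ Z) :
    ¬ IsPrincipalOrbit
      (Quotient.mk'' (mk (R.comp π hπ) (g, s))
        : MulAction.orbitRel.Quotient G (AssocSphere (R.comp π hπ))) := by
  intro hP
  obtain ⟨s₀, hs₀⟩ := hR.exists_notMem
  obtain ⟨h, hh⟩ := hP (mk (R.comp π hπ) (g, s))
    (by rw [MulAction.orbitRel.Quotient.orbit_mk]; exact MulAction.mem_orbit_self _)
    (mk (R.comp π hπ) (1, s₀))
  rw [smul_mk] at hh
  have hle : ∀ x, x ∈ MulAction.stabilizer G (mk (R.comp π hπ) (g, s)) →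
      (h * 1)⁻¹ * x * (h * 1) ∈ K := fun x hx =>
    (mem_stabilizer_iff_of_notMem hKL hker hR hs₀).1 (hh hx)
  simp only [mul_one] at hle
  have hu : ∀ x ∈ K, (g⁻¹ * h)⁻¹ * x * (g⁻¹ * h) ∈ K := by
    intro x hx
    have := hle (g * x * g⁻¹) (mem_stabilizer_of_conj_mem hKL hker s
      (by simpa [mul_assoc] using hx))
    simpa [mul_assoc] using this
  obtain ⟨w, hw1, hw⟩ := hR.exists_ne_one s hs
  obtain ⟨k, rfl⟩ := hsurj w
  have h₁ := hle (g * k * g⁻¹) (mem_stabilizer_mk.2 ⟨k, rfl, hw⟩)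
  have h₂ := Subgroup.conj_mem_of_forall_inv_conj_mem hK hu h₁
  refine hw1 ((hker k).2 ?_)
  simpa [mul_assoc] using h₂

-- The points `[b⁻¹, s₀]` with `s₀ ∉ Z` have all conjugates of `K` as isotropy groups, and every
-- other isotropy group contains a conjugate.
include hKL hker in
theorem ker_toPermHom (hR : IsSphereModel R Z m c) :
    (MulAction.toPermHom G (AssocSphere (R.comp π hπ))).ker = K.normalCore := by
  ext h
  rw [MonoidHom.mem_ker]
  constructor
  · intro hh b
    obtain ⟨s₀, hs₀⟩ := hR.exists_notMem
    have h₁ : h ∈ MulAction.stabilizer G (mk (R.comp π hπ) (b⁻¹, s₀)) := by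
      rw [MulAction.mem_stabilizer_iff]
      exact DFunLike.congr_fun hh (mk (R.comp π hπ) (b⁻¹, s₀))
    simpa using (mem_stabilizer_iff_of_notMem hKL hker hR hs₀).1 h₁
  · intro hh
    ext x
    obtain ⟨⟨g, s⟩, rfl⟩ := mk_surjective x
    have h₁ := mem_stabilizer_of_conj_mem (R := R) (hπ := hπ) hKL hker s
      (by simpa using hh g⁻¹ : g⁻¹ * h * g ∈ K)
    exact h₁

theorem orbit_mk_eq (g : G) (s : Metric.sphere (0 : V) 1) :
    (Quotient.mk'' (mk (R.comp π hπ) (g, s))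
        : MulAction.orbitRel.Quotient G (AssocSphere (R.comp π hπ))) =
      Quotient.mk'' (mk (R.comp π hπ) (1, s)) := by
  refine Quotient.sound' ?_
  rw [MulAction.orbitRel_apply]
  exact ⟨g, by simp [smul_mk]⟩

theorem connectedSpace_orbitRel [Fact (Module.finrank ℝ V = m + 1)] (hm : 1 ≤ m) :
    ConnectedSpace (MulAction.orbitRel.Quotient G (AssocSphere (R.comp π hπ))) := by
  have : FiniteDimensional ℝ V := .of_fact_finrank_eq_succ m
  have : ConnectedSpace (Metric.sphere (0 : V) 1) := by
    rw [← isConnected_iff_connectedSpace]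
    refine isConnected_sphere ?_ 0 zero_le_one
    rw [← Module.finrank_eq_rank, Fact.out (p := Module.finrank ℝ V = m + 1)]
    exact_mod_cast Nat.lt_add_of_pos_left hm
  refine Function.Surjective.connectedSpace (f := fun s : Metric.sphere (0 : V) 1 =>
    (Quotient.mk'' (mk (R.comp π hπ) (1, s))
        : MulAction.orbitRel.Quotient G (AssocSphere (R.comp π hπ)))) ?_ ?_
  · intro O
    induction O using Quotient.inductionOn' with
    | h x =>
      obtain ⟨⟨g, s⟩, rfl⟩ := mk_surjective x
      exact ⟨s, (orbit_mk_eq g s).symm⟩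
  · exact continuous_quotient_mk'.comp (continuous_mk.comp (continuous_const.prodMk continuous_id))

end AssocSphere

-- From a sphere model to the manifold

universe v

theorem exists_manifold_of_isSphereModel {d : ℕ} {G : Type v} [Group G] [TopologicalSpace G]
    [CompactSpace G] [T2Space G] [ChartedSpace (EuclideanSpace ℝ (Fin d)) G]
    [LieGroup (𝓡 d) ∞ G] {K L : Subgroup G} (hK : IsClosed (K : Set G))
    (hL : IsClosed (L : Set G)) (hKL : K ≤ L)
    {W : Type*} [Group W] [TopologicalSpace W] [Infinite W] {π : L →* W} (hπ : Continuous π)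
    (hsurj : Function.Surjective π) (hker : ∀ k : L, π k = 1 ↔ (k : G) ∈ K)
    {V : Type} [NormedAddCommGroup V] [InnerProductSpace ℝ V]
    {R : OrthogonalRep W V} {Z : Set (Metric.sphere (0 : V) 1)} {m c : ℕ}
    (hm : Module.finrank ℝ V = m + 1) (hR : IsSphereModel R Z m c) :
    ∃ (n : ℕ) (M : Type v) (_ : TopologicalSpace M)
      (_ : ChartedSpace (EuclideanSpace ℝ (Fin n)) M) (_ : MulAction G M),
      IsManifold (𝓡 n) ∞ M ∧ T2Space M ∧ CompactSpace M ∧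
      ContMDiffSMul (𝓡 d) (𝓡 n) ∞ G M ∧
      (MulAction.toPermHom G M).ker = K.normalCore ∧
      ConnectedSpace (MulAction.orbitRel.Quotient G M) ∧
      IsPrincipalIsotropy M K ∧
      HasCohomogeneity d n G M c ∧
      ∃! O : MulAction.orbitRel.Quotient G M, ¬ IsPrincipalOrbit O := by
  have : IsTopologicalGroup G := topologicalGroup_of_lieGroup (𝓡 d) ∞
  have : Fact (Module.finrank ℝ V = m + 1) := ⟨hm⟩
  have : FiniteDimensional ℝ V := .of_fact_finrank_eq_succ m
  obtain ⟨p, l, -, ⟨𝒮⟩⟩ := exists_subgroupSlice (E := EuclideanSpace ℝ (Fin d)) hL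
  obtain ⟨s₀, hs₀⟩ := hR.exists_notMem
  obtain ⟨s₁, hs₁⟩ := hR.nonempty
  let R' := R.comp π hπ
  let _ := (𝒮.atlas (m := m) R').chartedSpace
  have hpr : ∀ g s, IsPrincipalOrbit
      (Quotient.mk'' (AssocSphere.mk R' (g, s)) :
        MulAction.orbitRel.Quotient G (AssocSphere R')) ↔ s ∉ Z := fun g s =>
    ⟨fun h hs => AssocSphere.not_isPrincipalOrbit_of_mem hKL hker hK hsurj hR hs h,
      fun hs => AssocSphere.isPrincipalOrbit_of_notMem hKL hker hR hs⟩
  have hrank : 𝒮.tangentImage R' ≠ ⊥ := 𝒮.tangentImage_ne_bot R' hL π hsurj fun k hk => by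
    refine hR.free s₀ hs₀ (π k) (Subtype.ext ?_)
    have : R.toHom (π k) = 1 := hk
    simp [this]
  refine ⟨p + m, AssocSphere R', inferInstance, (𝒮.atlas (m := m) R').chartedSpace, inferInstance,
    (𝒮.atlas (m := m) R').isManifold, AssocSphere.t2Space hL, inferInstance,
    𝒮.contMDiffSMul (m := m) R', AssocSphere.ker_toPermHom hKL hker hR,
    AssocSphere.connectedSpace_orbitRel hR.one_le, ?_, ⟨?_, ?_⟩, ?_⟩
  · refine ⟨Quotient.mk'' (AssocSphere.mk R' (1, s₀)), (hpr 1 s₀).2 hs₀, AssocSphere.mk R' (1, s₀),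
      ?_, ?_⟩
    · rw [MulAction.orbitRel.Quotient.orbit_mk]; exact MulAction.mem_orbit_self _
    · ext h
      rw [AssocSphere.mem_stabilizer_iff_of_notMem hKL hker hR hs₀]
      simp
  · exact ⟨Quotient.mk'' (AssocSphere.mk R' (1, s₀)), (hpr 1 s₀).2 hs₀⟩
  · intro O hO x hx
    obtain ⟨⟨g, s⟩, rfl⟩ := AssocSphere.mk_surjective x
    have hOx : O = Quotient.mk'' (AssocSphere.mk R' (g, s)) := by
      rw [MulAction.orbitRel.Quotient.mem_orbit] at hx
      exact hx.symm
    rw [hOx, hpr] at hO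
    have h₁ := 𝒮.finrank_range_mfderiv_smul (m := m) R' g s
    -- Invariance under `W` follows from invariance under `L` because `π` is surjective, and curves
    -- in `L` project to curves in `W`.
    have h₂ := hR.finrank_add (𝒮.tangentImage R') hrank
      (fun w A hA => by
        obtain ⟨k, rfl⟩ := hsurj w
        have := 𝒮.conj_mem_tangentImage R' hA k
        have e : R.toHom (π k)⁻¹ = R'.toHom k⁻¹ := by simp [R', OrthogonalRep.comp]
        rw [e]
        exact this)
      (fun A hA => by
        obtain ⟨w, hw, hw'⟩ := 𝒮.exists_curve_of_mem_tangentImage R' hA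
        exact ⟨fun t => π (w t), by simp [hw], hw'⟩) s hO
    rw [SubgroupSlice.tangentImage, ← LinearMap.range_comp] at h₂
    have h₃ : orbitDim d (p + m) G (AssocSphere.mk R' (g, s)) = _ := h₁
    rw [h₃, add_assoc, h₂]
  · refine ⟨Quotient.mk'' (AssocSphere.mk R' (1, s₁)), fun h => (hpr 1 s₁).1 h hs₁, ?_⟩
    intro O hO
    induction O using Quotient.inductionOn' with
    | h x =>
      obtain ⟨⟨g, s⟩, rfl⟩ := AssocSphere.mk_surjective x
      have hs : s ∈ Z := by
        by_contra hs
        exact hO ((hpr g s).2 hs)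
      obtain ⟨w, hw⟩ := hR.transitive s hs s₁ hs₁
      obtain ⟨k, rfl⟩ := hsurj w
      have e : R'.act k s = s₁ := hw
      have e' : AssocSphere.mk R' (1, s₁) = AssocSphere.mk R' (k, s) := by
        rw [← e, ← AssocSphere.mk_mul_left, one_mul]
      rw [e', AssocSphere.orbit_mk_eq g, AssocSphere.orbit_mk_eq (k : G)]

/-- An orthogonal representation from a pointwise continuous family of linear isometries. -/
noncomputable def OrthogonalRep.ofLinear {W V : Type*} [Group W] [TopologicalSpace W]
    [NormedAddCommGroup V] [InnerProductSpace ℝ V] [FiniteDimensional ℝ V] (f : W → V →ₗ[ℝ] V)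
    (map_one : f 1 = 1) (map_mul : ∀ w w', f (w * w') = f w * f w')
    (norm_map : ∀ w x, ‖f w x‖ = ‖x‖) (continuous : ∀ x, Continuous fun w => f w x) :
    OrthogonalRep W V where
  toHom :=
    { toFun := fun w => (f w).toContinuousLinearMap
      map_one' := by ext x; simp [map_one]
      map_mul' := fun w w' => by ext x; simp [map_mul] }
  continuous := continuous_clm_apply.2 continuous
  norm_map := norm_map

theorem Submodule.finrank_map_of_forall_eq_zero {A B : Type*} [AddCommGroup A] [Module ℝ A]
    [AddCommGroup B] [Module ℝ B] (f : A →ₗ[ℝ] B) (U : Submodule ℝ A)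
    (h : ∀ x ∈ U, f x = 0 → x = 0) : Module.finrank ℝ (U.map f) = Module.finrank ℝ U := by
  rw [← LinearMap.range_domRestrict]
  refine LinearMap.finrank_range_of_inj ((injective_iff_map_eq_zero _).2 fun x hx => ?_)
  exact Subtype.ext (h x x.2 hx)

/-! ### Unit spheres of division algebras acting on `Dᵏ ⊕ T` -/

section UnitSphereModel

variable {D : Type*} [NormedDivisionRing D] [InnerProductSpace ℝ D]
  [FiniteDimensional ℝ D]
  {T : Type*} [NormedAddCommGroup T] [InnerProductSpace ℝ T] [FiniteDimensional ℝ T]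

theorem finrank_prodUnitSphere (k : ℕ) :
    Module.finrank ℝ (WithLp 2 (PiLp 2 (fun _ : Fin k => D) × T)) =
      k * Module.finrank ℝ D + Module.finrank ℝ T := by
  rw [(WithLp.linearEquiv 2 ℝ (PiLp 2 (fun _ : Fin k => D) × T)).finrank_eq, Module.finrank_prod,
    (WithLp.linearEquiv 2 ℝ (Fin k → D)).finrank_eq, Module.finrank_pi_fintype]
  simp

theorem infinite_unitSphere (hD : 1 < Module.finrank ℝ D) :
    Infinite (Metric.sphere (0 : D) 1) := by
  have h₁ : IsPreconnected (Metric.sphere (0 : D) 1) := by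
    refine isPreconnected_sphere ?_ 0 1
    rw [← Module.finrank_eq_rank]
    exact_mod_cast hD
  rw [infinite_coe_iff]
  refine h₁.infinite_of_nontrivial ⟨1, by simp, -1, by simp, fun h => ?_⟩
  have h₂ : (2 : ℝ) • (1 : D) = 0 := by
    rw [two_smul]; nth_rewrite 2 [h]; simp
  simp at h₂

variable [SMulCommClass ℝ D D]

/-- The representation of the unit sphere of a division algebra `D` on `Dᵏ ⊕ T`. -/
noncomputable def OrthogonalRep.prodUnitSphere (k : ℕ)
    (S : OrthogonalRep (Metric.sphere (0 : D) 1) T) :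
    OrthogonalRep (Metric.sphere (0 : D) 1) (WithLp 2 (PiLp 2 (fun _ : Fin k => D) × T)) :=
  OrthogonalRep.ofLinear
    (fun w =>
      { toFun := fun x => WithLp.toLp 2 (WithLp.toLp 2 fun i => w * x.fst i, S.toHom w x.snd)
        map_add' := fun x y => by
          refine WithLp.ofLp_injective 2 (Prod.ext ?_ ?_)
          · ext i; simp [mul_add]
          · simp
        map_smul' := fun r x => by
          refine WithLp.ofLp_injective 2 (Prod.ext ?_ ?_)
          · ext i; simp [mul_smul_comm]
          · simp })
    (by
      refine LinearMap.ext fun x => WithLp.ofLp_injective 2 (Prod.ext ?_ ?_)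
      · ext i; simp
      · simp)
    (fun w w' => by
      refine LinearMap.ext fun x => WithLp.ofLp_injective 2 (Prod.ext ?_ ?_)
      · ext i; simp [mul_assoc]
      · simp)
    (fun w x => by
      have h : ‖(WithLp.toLp 2 fun i => (w : D) * x.fst i : PiLp 2 fun _ : Fin k => D)‖ ^ 2 =
          ‖x.fst‖ ^ 2 := by
        simp [PiLp.norm_sq_eq_of_L2]
      rw [← sq_eq_sq₀ (norm_nonneg _) (norm_nonneg _), WithLp.prod_norm_sq_eq_of_L2,
        WithLp.prod_norm_sq_eq_of_L2]
      change ‖(WithLp.toLp 2 fun i => (w : D) * x.fst i : PiLp 2 fun _ : Fin k => D)‖ ^ 2 +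
        ‖S.toHom w x.snd‖ ^ 2 = _
      rw [h, S.norm_map])
    (fun x => by
      refine (WithLp.prod_continuous_toLp 2 _ _).comp (Continuous.prodMk ?_ ?_)
      · refine (PiLp.continuous_toLp 2 _).comp (continuous_pi fun i => ?_)
        exact continuous_subtype_val.mul continuous_const
      · exact S.continuous.clm_apply continuous_const)

variable {k : ℕ} (S : OrthogonalRep (Metric.sphere (0 : D) 1) T)

theorem OrthogonalRep.prodUnitSphere_fst (w : Metric.sphere (0 : D) 1)
    (x : WithLp 2 (PiLp 2 (fun _ : Fin k => D) × T)) (i : Fin k) :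
    ((S.prodUnitSphere k).toHom w x).fst i = w * x.fst i := rfl

variable [IsScalarTower ℝ D D]

/-- If the unit sphere `W` of `D` acts transitively, but not effectively, on the unit sphere
of `T`, then `Dᵏ ⊕ T` is a sphere model for `W`. -/
theorem isSphereModel_prodUnitSphere {r c m : ℕ} (hk : 1 ≤ k) (hm : 1 ≤ m) (hc : r + c = m)
    (htr : ∀ y y' : T, ‖y‖ = 1 → ‖y'‖ = 1 → ∃ w, S.toHom w y = y')
    (hne : ∃ y : T, ‖y‖ = 1) (htriv : ∃ w ≠ 1, ∀ y, S.toHom w y = y)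
    (hder : ∀ w : ℝ → Metric.sphere (0 : D) 1, w 0 = 1 →
      HasDerivAt (fun t => (w t : D)) 0 0 → ∀ y, HasDerivAt (fun t => S.toHom (w t) y) 0 0)
    (hU : ∀ U : Submodule ℝ D, U ≠ ⊥ → (∀ X ∈ U, inner ℝ (1 : D) X = 0) →
      (∀ w : Metric.sphere (0 : D) 1, ∀ X ∈ U, (w : D) * X * (w : D)⁻¹ ∈ U) →
      Module.finrank ℝ U = r) :
    IsSphereModel (S.prodUnitSphere k) {s | (s : WithLp 2 (PiLp 2 (fun _ : Fin k => D) × T)).fst = 0}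
      m c := by
  let V := WithLp 2 (PiLp 2 (fun _ : Fin k => D) × T)
  let i₀ : Fin k := ⟨0, hk⟩
  -- Since `w` acts on `Dᵏ` by left multiplication, the coordinate `i₀` of `w • e` is `w` itself.
  -- Evaluation at `e` thus recovers velocities in `D` from operators on `V`.
  let e : V := WithLp.toLp 2 (PiLp.single 2 i₀ (1 : D), 0)
  have hei : e.fst i₀ = 1 := by simp [e]
  have hnorm : ‖e‖ = 1 := by
    rw [← sq_eq_sq₀ (norm_nonneg _) zero_le_one, WithLp.prod_norm_sq_eq_of_L2]
    simp [e, PiLp.norm_single]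
  have hsnd : ∀ x : V, x.fst = 0 → ‖x.snd‖ = ‖x‖ := fun x hx => by
    rw [← sq_eq_sq₀ (norm_nonneg _) (norm_nonneg _), WithLp.prod_norm_sq_eq_of_L2, hx]
    simp
  let P : Fin k → V →L[ℝ] D := fun i => LinearMap.toContinuousLinearMap
    { toFun := fun x => x.fst i
      map_add' := fun x y => rfl
      map_smul' := fun a x => rfl }
  let Q : V →L[ℝ] T := LinearMap.toContinuousLinearMap
    { toFun := fun x => x.snd
      map_add' := fun x y => rfl
      map_smul' := fun a x => rfl }
  refine ⟨hm, ?_, ⟨⟨e, by simp [hnorm]⟩, fun h => ?_⟩, ?_, ?_, ?_, ?_⟩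
  · intro s hs w hw
    obtain ⟨i, hi⟩ : ∃ i, (s : V).fst i ≠ 0 := by
      by_contra! hcon
      exact hs (by ext i; exact hcon i)
    have h := congrArg (fun x : Metric.sphere (0 : V) 1 => (x : V).fst i) hw
    change (w : D) * (s : V).fst i = (s : V).fst i at h
    ext
    simpa [hi] using h
  · have h0 : e.fst = 0 := h
    rw [h0] at hei
    simp at hei
  · intro s hs
    obtain ⟨w, hw, hw'⟩ := htriv
    refine ⟨w, hw, Subtype.ext (WithLp.ofLp_injective 2 (Prod.ext ?_ (hw' _)))⟩
    ext i
    have hs' : (s : V).fst = 0 := hs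
    change (w : D) * (s : V).fst i = (s : V).fst i
    rw [hs']; simp
  · obtain ⟨y, hy⟩ := hne
    refine ⟨⟨WithLp.toLp 2 (0, y), ?_⟩, rfl⟩
    rw [mem_sphere_zero_iff_norm, ← hsnd _ rfl]
    exact hy
  · intro s hs s' hs'
    have h₁ : (s : V).fst = 0 := hs
    have h₂ : (s' : V).fst = 0 := hs'
    obtain ⟨w, hw⟩ := htr (s : V).snd (s' : V).snd (by rw [hsnd _ h₁]; simp)
      (by rw [hsnd _ h₂]; simp)
    refine ⟨w, Subtype.ext (WithLp.ofLp_injective 2 (Prod.ext ?_ hw))⟩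
    ext i
    change (w : D) * (s : V).fst i = (s' : V).fst i
    rw [h₁, h₂]; simp
  · intro 𝔯 h𝔯 hconj hcurve s hs
    let ev : (V →L[ℝ] V) →ₗ[ℝ] D :=
      (P i₀).toLinearMap ∘ₗ (ContinuousLinearMap.apply ℝ V e).toLinearMap
    have hev : ∀ A, ev A = (A e).fst i₀ := fun A => rfl
    have hw : ∀ A ∈ 𝔯, ∃ w : ℝ → Metric.sphere (0 : D) 1, w 0 = 1 ∧
        HasDerivAt (fun t => (w t : D)) (ev A) 0 ∧
        ∀ x, HasDerivAt (fun t => S.toHom (w t) x.snd) (A x).snd 0 := by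
      intro A hA
      obtain ⟨w, hw0, hw⟩ := hcurve A hA
      have hx : ∀ x, HasDerivAt (fun t => (S.prodUnitSphere k).toHom (w t) x) (A x) 0 := fun x => by
        simpa using hw.clm_apply (hasDerivAt_const (0 : ℝ) x)
      refine ⟨w, hw0, ?_, fun x => Q.hasFDerivAt.comp_hasDerivAt (0 : ℝ) (hx x)⟩
      have := (P i₀).hasFDerivAt.comp_hasDerivAt (0 : ℝ) (hx e)
      refine this.congr_of_eventuallyEq (Eventually.of_forall fun t => ?_)
      change (w t : D) = w t * e.fst i₀
      rw [hei, mul_one]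
    have hfst : ∀ A ∈ 𝔯, ∀ x i, (A x).fst i = ev A * x.fst i := by
      intro A hA x i
      obtain ⟨w, hw0, hw⟩ := hcurve A hA
      have hx : ∀ x, HasDerivAt (fun t => (S.prodUnitSphere k).toHom (w t) x) (A x) 0 := fun x => by
        simpa using hw.clm_apply (hasDerivAt_const (0 : ℝ) x)
      have h₁ : HasDerivAt (fun t => (w t : D)) (ev A) 0 := by
        have := (P i₀).hasFDerivAt.comp_hasDerivAt (0 : ℝ) (hx e)
        refine this.congr_of_eventuallyEq (Eventually.of_forall fun t => ?_)
        change (w t : D) = w t * e.fst i₀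
        rw [hei, mul_one]
      have h₂ := ((LinearMap.mulRight ℝ (x.fst i)).toContinuousLinearMap).hasFDerivAt.comp_hasDerivAt
        (0 : ℝ) h₁
      exact ((P i).hasFDerivAt.comp_hasDerivAt (0 : ℝ) (hx x)).unique h₂
    -- On `Dᵏ` the operator `A` is left multiplication by `ev A`; on `T` it vanishes by `hder` once
    -- the velocity is zero. So `𝔯` embeds in `D`, and its evaluation at any `s` with nonzero
    -- `Dᵏ`-component is injective too.
    have hzero : ∀ A ∈ 𝔯, ev A = 0 → A = 0 := by
      intro A hA h0
      obtain ⟨w, hw0, hw₁, hw₂⟩ := hw A hA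
      rw [h0] at hw₁
      refine ContinuousLinearMap.ext fun x => WithLp.ofLp_injective 2 (Prod.ext ?_ ?_)
      · ext i
        exact (hfst A hA x i).trans (by rw [h0, zero_mul]; rfl)
      · exact (hw₂ x).unique (hder w hw0 hw₁ x.snd)
    have h₁ : Module.finrank ℝ (𝔯.map (ContinuousLinearMap.apply ℝ V (s : V)).toLinearMap) =
        Module.finrank ℝ 𝔯 := by
      refine Submodule.finrank_map_of_forall_eq_zero _ _ fun A hA h0 => hzero A hA ?_
      obtain ⟨i, hi⟩ : ∃ i, (s : V).fst i ≠ 0 := by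
        by_contra! hcon
        exact hs (by ext i; exact hcon i)
      have h₂ := hfst A hA s i
      have h₃ : A (s : V) = 0 := h0
      rw [h₃] at h₂
      simpa [hi] using h₂
    have h₂ : Module.finrank ℝ (𝔯.map ev) = Module.finrank ℝ 𝔯 :=
      Submodule.finrank_map_of_forall_eq_zero _ _ hzero
    rw [h₁, ← h₂, hU (𝔯.map ev), hc]
    · intro hbot
      refine h𝔯 ((Submodule.eq_bot_iff _).2 fun A hA => hzero A hA ?_)
      have : ev A ∈ 𝔯.map ev := Submodule.mem_map_of_mem hA
      rwa [hbot, Submodule.mem_bot] at this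
    · rintro _ ⟨A, hA, rfl⟩
      obtain ⟨w, hw0, hw₁, -⟩ := hw A hA
      -- A curve of unit vectors through `1` has velocity orthogonal to `1`.
      have h₃ := hw₁.norm_sq
      have h₄ : (fun t => ‖(w t : D)‖ ^ 2) = fun _ => 1 := by ext t; simp
      rw [h₄] at h₃
      have h₅ := h₃.unique (hasDerivAt_const (0 : ℝ) (1 : ℝ))
      rw [hw0] at h₅
      simpa using h₅
    · rintro w _ ⟨A, hA, rfl⟩
      refine ⟨_, hconj w A hA, ?_⟩
      have h₃ : ev ((S.prodUnitSphere k).toHom w * A * (S.prodUnitSphere k).toHom w⁻¹) =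
          w * (A ((S.prodUnitSphere k).toHom w⁻¹ e)).fst i₀ := rfl
      rw [h₃, hfst A hA, OrthogonalRep.prodUnitSphere_fst, hei]
      simp [mul_assoc]

end UnitSphereModel

/-! ### Lifting a subgroup of `N_G K / K` to `G` -/

theorem Subgroup.isClosed_normalizer {G : Type*} [Group G] [TopologicalSpace G]
    [IsTopologicalGroup G] {K : Subgroup G} (hK : IsClosed (K : Set G)) :
    IsClosed (Subgroup.normalizer (K : Set G) : Set G) := by
  have h : (Subgroup.normalizer (K : Set G) : Set G) =
      ⋂ n ∈ K, ((fun g => g * n * g⁻¹) ⁻¹' K ∩ (fun g => g⁻¹ * n * g) ⁻¹' K) := by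
    ext g
    simp only [SetLike.mem_coe, mem_iInter, mem_inter_iff, mem_preimage]
    constructor
    · intro hg n hn
      exact ⟨(Subgroup.mem_normalizer_iff.1 hg n).1 hn, (Subgroup.mem_normalizer_iff''.1 hg n).1 hn⟩
    · intro hg
      refine Subgroup.mem_normalizer_iff.2 fun n => ⟨fun hn => (hg n hn).1, fun hn => ?_⟩
      simpa [mul_assoc] using (hg _ hn).2
  rw [h]
  refine isClosed_biInter fun n _ => (hK.preimage ?_).inter (hK.preimage ?_) <;> fun_prop

/-- A compact group embedded in `N_G K / K` is the quotient by `K` of a closed subgroup of `G`. -/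
theorem EmbedsIn.exists_hom {G W : Type*} [Group G] [TopologicalSpace G] [IsTopologicalGroup G]
    [CompactSpace G] [T2Space G] [Group W] [TopologicalSpace W] [CompactSpace W]
    {K : Subgroup G} (hK : IsClosed (K : Set G)) (h : EmbedsIn W (WeylGroup K)) :
    ∃ (L : Subgroup G) (π : L →* W), IsClosed (L : Set G) ∧ K ≤ L ∧ Continuous π ∧
      Function.Surjective π ∧ ∀ l : L, π l = 1 ↔ (l : G) ∈ K := by
  obtain ⟨φ, hφc, hφ⟩ := h
  set N := Subgroup.normalizer (K : Set G) with hN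
  have : IsClosed (K.subgroupOf N : Set N) := hK.preimage continuous_subtype_val
  have hemb : IsClosedEmbedding φ := hφc.isClosedEmbedding hφ
  let p : N →* WeylGroup K := QuotientGroup.mk' _
  have hp : Continuous p := QuotientGroup.continuous_mk
  let L : Subgroup G := (φ.range.comap p).map N.subtype
  have hLN : L ≤ N := Subgroup.map_subtype_le _
  let q : L →* WeylGroup K := p.comp (Subgroup.inclusion hLN)
  have hq : ∀ l : L, q l ∈ φ.range := by
    rintro ⟨_, l, hl, rfl⟩
    exact hl
  let π : L →* W := (MonoidHom.ofInjective hφ).symm.toMonoidHom.comp (q.codRestrict φ.range hq)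
  have hπ : ∀ l, φ (π l) = q l := fun l =>
    congrArg Subtype.val ((MonoidHom.ofInjective hφ).apply_symm_apply ⟨q l, hq l⟩)
  have hqK : ∀ l : L, q l = 1 ↔ (l : G) ∈ K := fun l =>
    (QuotientGroup.eq_one_iff _).trans Subgroup.mem_subgroupOf
  have hKN : K ≤ N := Subgroup.le_normalizer
  refine ⟨L, π, ?_, fun x hx => ?_, ?_, fun w => ?_, fun l => ?_⟩
  · have h₁ : IsClosed (p ⁻¹' range φ) := hemb.isClosed_range.preimage hp
    exact (Subgroup.isClosed_normalizer hK).isClosedEmbedding_subtypeVal.isClosedMap _ h₁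
  · refine ⟨⟨x, hKN hx⟩, ?_, rfl⟩
    have : p ⟨x, hKN hx⟩ = 1 := (QuotientGroup.eq_one_iff _).2 (Subgroup.mem_subgroupOf.2 hx)
    change p ⟨x, hKN hx⟩ ∈ φ.range
    rw [this]
    exact one_mem _
  -- As `W` is compact, `φ` is a closed embedding, so continuity of `π` can be tested after
  -- composing with `φ`.
  · rw [hemb.continuous_iff]
    have : φ ∘ π = q := funext hπ
    rw [this]
    exact hp.comp (continuous_inclusion hLN)
  · obtain ⟨n, hn⟩ := QuotientGroup.mk'_surjective (K.subgroupOf N) (φ w)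
    refine ⟨⟨n, n, ⟨w, hn.symm⟩, rfl⟩, hφ ?_⟩
    rw [hπ]
    exact hn
  · rw [← hqK, ← hπ, map_eq_one_iff φ hφ]

theorem EmbedsIn.trans {A B C : Type*} [Group A] [TopologicalSpace A] [Group B]
    [TopologicalSpace B] [Group C] [TopologicalSpace C] (h : EmbedsIn A B) (h' : EmbedsIn B C) :
    EmbedsIn A C := by
  obtain ⟨f, hf, hf'⟩ := h
  obtain ⟨g, hg, hg'⟩ := h'
  exact ⟨g.comp f, hg.comp hf, hg'.comp hf'⟩

/-! ### The circle -/

section Complex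

theorem embedsIn_circle : EmbedsIn (Metric.sphere (0 : ℂ) 1) Circle :=
  ⟨{ toFun := fun w => (⟨w, w.2⟩ : Circle)
     map_one' := rfl
     map_mul' := fun _ _ => rfl },
    Continuous.subtype_mk continuous_subtype_val _,
    fun _ _ h => Subtype.ext (congrArg (fun z : Circle => (z : ℂ)) h)⟩

/-- The representation of the circle group on `ℂ` of weight two. -/
noncomputable def OrthogonalRep.complexSq : OrthogonalRep (Metric.sphere (0 : ℂ) 1) ℂ :=
  OrthogonalRep.ofLinear (fun w => LinearMap.mulLeft ℝ ((w : ℂ) ^ 2))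
    (by ext; simp) (fun w w' => by ext; simp [mul_pow])
    (fun w x => by simp) (fun x => (continuous_subtype_val.pow 2).mul continuous_const)

theorem isSphereModel_complexSq {k : ℕ} (hk : 1 ≤ k) :
    IsSphereModel (OrthogonalRep.complexSq.prodUnitSphere k)
      {s | (s : WithLp 2 (PiLp 2 (fun _ : Fin k => ℂ) × ℂ)).fst = 0} (2 * k + 1) (2 * k) := by
  refine isSphereModel_prodUnitSphere (r := 1) _ hk (by omega) (by omega) ?_ ⟨1, by simp⟩ ?_ ?_ ?_
  -- Transitivity amounts to extracting a square root of `y' / y`; weight two is chosen so that `-1`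
  -- acts trivially.
  · intro y y' hy hy'
    obtain ⟨z, hz⟩ := IsAlgClosed.exists_pow_nat_eq (y' / y) two_pos
    have hy0 : y ≠ 0 := norm_ne_zero_iff.1 (by simp [hy])
    have hz1 : ‖z‖ = 1 := by
      have : ‖z‖ ^ 2 = 1 := by rw [← norm_pow, hz, norm_div, hy, hy', div_one]
      exact (pow_eq_one_iff_of_nonneg (norm_nonneg _) two_ne_zero).1 this
    refine ⟨⟨z, by simp [hz1]⟩, ?_⟩
    change z ^ 2 * y = y'
    rw [hz, div_mul_cancel₀ _ hy0]
  · refine ⟨-1, fun h => ?_, fun y => ?_⟩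
    · have h' : (-1 : ℂ) = 1 := congrArg Subtype.val h
      norm_num at h'
    · change (((-1 : Metric.sphere (0 : ℂ) 1) : ℂ)) ^ 2 * y = y
      simp
  · intro w hw0 hw y
    have h : HasDerivAt (fun t => (w t : ℂ) ^ 2 * y) 0 0 := by
      simpa using (hw.pow 2).mul_const y
    exact h
  · intro U hU h1 _
    have : Fact (Module.finrank ℝ ℂ = 1 + 1) := ⟨Complex.finrank_real_complex⟩
    have hle : U ≤ (Submodule.span ℝ {(1 : ℂ)})ᗮ := fun X hX =>
      Submodule.mem_orthogonal_singleton_iff_inner_right.2 (h1 X hX)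
    have h₁ := Submodule.finrank_mono hle
    rw [Submodule.finrank_orthogonal_span_singleton (n := 1) one_ne_zero] at h₁
    have h₂ := Submodule.one_le_finrank_iff.2 hU
    omega

end Complex

/-! ### The unit quaternions -/

section Quaternion

open scoped Quaternion

theorem Quaternion.inv_eq_star_of_norm_eq_one {q : ℍ[ℝ]} (hq : ‖q‖ = 1) : q⁻¹ = star q := by
  refine inv_eq_of_mul_eq_one_right ?_
  rw [Quaternion.self_mul_star, Quaternion.normSq_eq_norm_mul_self, hq]
  simp

theorem Quaternion.norm_sq_eq_add (q : ℍ[ℝ]) :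
    ‖q‖ ^ 2 = q.re ^ 2 + q.imI ^ 2 + q.imJ ^ 2 + q.imK ^ 2 := by
  rw [sq, ← Quaternion.normSq_eq_norm_mul_self, Quaternion.normSq_def']

theorem Quaternion.norm_eq_one_of_sq {q : ℍ[ℝ]}
    (h : q.re ^ 2 + q.imI ^ 2 + q.imJ ^ 2 + q.imK ^ 2 = 1) : ‖q‖ = 1 := by
  rw [← Quaternion.norm_sq_eq_add] at h
  exact (pow_eq_one_iff_of_nonneg (norm_nonneg _) two_ne_zero).1 h

/-- The unit quaternions embed in `SU(2)`. -/
theorem embedsIn_specialUnitaryGroup :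
    EmbedsIn (Metric.sphere (0 : ℍ[ℝ]) 1) (Matrix.specialUnitaryGroup (Fin 2) ℂ) := by
  let f : ℍ[ℝ] → Matrix (Fin 2) (Fin 2) ℂ := fun q =>
    !![⟨q.re, q.imI⟩, ⟨q.imJ, q.imK⟩; ⟨-q.imJ, q.imK⟩, ⟨q.re, -q.imI⟩]
  have hf1 : f 1 = 1 := by
    ext i j
    fin_cases i <;> fin_cases j <;> simp [f, Complex.ext_iff]
  have hfm : ∀ p q, f (p * q) = f p * f q := fun p q => by
    ext i j
    fin_cases i <;> fin_cases j <;>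
      simp [f, Complex.ext_iff, Matrix.mul_apply, Fin.sum_univ_two] <;> constructor <;> ring
  have hfs : ∀ q, star (f q) = f (star q) := fun q => by
    ext i j
    fin_cases i <;> fin_cases j <;> simp [f, Complex.ext_iff, Matrix.star_apply]
  have hmem : ∀ q : Metric.sphere (0 : ℍ[ℝ]) 1, f q ∈ Matrix.specialUnitaryGroup (Fin 2) ℂ := by
    intro q
    have hq : ‖(q : ℍ[ℝ])‖ = 1 := by simp
    refine Matrix.mem_specialUnitaryGroup_iff.2 ⟨Matrix.mem_unitaryGroup_iff.2 ?_, ?_⟩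
    · rw [hfs, ← hfm, ← Quaternion.inv_eq_star_of_norm_eq_one hq, mul_inv_cancel₀, hf1]
      exact norm_ne_zero_iff.1 (by simp [hq])
    · have h := Quaternion.norm_sq_eq_add (q : ℍ[ℝ])
      rw [hq] at h
      simp only [f, Matrix.det_fin_two_of, Complex.ext_iff]
      constructor
      · simp; linarith
      · simp; ring
  refine ⟨{ toFun := fun q => ⟨f q, hmem q⟩
            map_one' := Subtype.ext hf1
            map_mul' := fun p q => Subtype.ext (hfm p q) }, ?_, fun p q h => ?_⟩
  · have hc : ∀ a b : ℍ[ℝ] → ℝ, Continuous a → Continuous b →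
        Continuous fun q => (⟨a q, b q⟩ : ℂ) := fun a b ha hb => by
      refine ((Complex.continuous_ofReal.comp ha).add
        ((Complex.continuous_ofReal.comp hb).mul (continuous_const (y := Complex.I)))).congr fun q => ?_
      exact (Complex.mk_eq_add_mul_I _ _).symm
    have hfc : Continuous f := by
      refine continuous_matrix fun i j => ?_
      fin_cases i <;> fin_cases j
      · exact hc _ _ Quaternion.continuous_re Quaternion.continuous_imI
      · exact hc _ _ Quaternion.continuous_imJ Quaternion.continuous_imK
      · exact hc _ _ Quaternion.continuous_imJ.neg Quaternion.continuous_imK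
      · exact hc _ _ Quaternion.continuous_re Quaternion.continuous_imI.neg
    exact (hfc.comp continuous_subtype_val).subtype_mk _
  · have h' : f p = f q := congrArg Subtype.val h
    have h₁ := congrFun (congrFun h' 0) 0
    have h₂ := congrFun (congrFun h' 0) 1
    simp only [f, Matrix.of_apply, Matrix.cons_val_zero, Matrix.cons_val_one,
      Complex.mk.injEq] at h₁ h₂
    exact Subtype.ext (Quaternion.ext _ _ h₁.1 h₁.2 h₂.1 h₂.2)

/-- The space of purely imaginary quaternions. -/
noncomputable abbrev Quaternion.imSpace : Submodule ℝ ℍ[ℝ] := (Submodule.span ℝ {(1 : ℍ[ℝ])})ᗮ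

theorem Quaternion.mem_imSpace {x : ℍ[ℝ]} : x ∈ Quaternion.imSpace ↔ x.re = 0 := by
  rw [Submodule.mem_orthogonal_singleton_iff_inner_right, Quaternion.inner_def]
  simp

theorem Quaternion.conj_mem_imSpace {w : ℍ[ℝ]} (hw : ‖w‖ = 1) {x : ℍ[ℝ]}
    (hx : x ∈ Quaternion.imSpace) : w * x * w⁻¹ ∈ Quaternion.imSpace := by
  rw [Quaternion.mem_imSpace] at hx ⊢
  rw [Quaternion.inv_eq_star_of_norm_eq_one hw]
  simp [hx]
  ring

/-- The representation of the unit quaternions on the imaginary quaternions by conjugation. -/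
noncomputable def OrthogonalRep.quaternionConj :
    OrthogonalRep (Metric.sphere (0 : ℍ[ℝ]) 1) Quaternion.imSpace :=
  OrthogonalRep.ofLinear
    (fun w => (LinearMap.mulLeft ℝ (w : ℍ[ℝ]) ∘ₗ LinearMap.mulRight ℝ (w : ℍ[ℝ])⁻¹).restrict
      fun x hx => by
        simpa [mul_assoc] using Quaternion.conj_mem_imSpace (w := w) (by simp) hx)
    (by ext x : 2; simp)
    (fun w w' => by ext x : 2; simp [mul_assoc])
    (fun w x => by simp [Submodule.coe_norm])
    (fun x => by
      refine Continuous.subtype_mk (continuous_subtype_val.mul (continuous_const.mul ?_)) _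
      exact continuous_subtype_val.inv₀ fun w => norm_ne_zero_iff.1 (by simp))

theorem OrthogonalRep.coe_quaternionConj (w : Metric.sphere (0 : ℍ[ℝ]) 1)
    (x : Quaternion.imSpace) :
    (OrthogonalRep.quaternionConj.toHom w x : ℍ[ℝ]) = w * x * (w : ℍ[ℝ])⁻¹ :=
  (mul_assoc _ _ _).symm

/-- Since `p² = q² = -1`, the element `v = 1 - q * p` satisfies `v * p = p + q = q * v`. It vanishes
only for `q = -p`, and otherwise can be normalised. -/
theorem Quaternion.exists_conj_eq_of_ne_neg {p q : ℍ[ℝ]} (hp : p.re = 0) (hq : q.re = 0)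
    (hp1 : ‖p‖ = 1) (hq1 : ‖q‖ = 1) (h : q ≠ -p) :
    ∃ w : Metric.sphere (0 : ℍ[ℝ]) 1, (w : ℍ[ℝ]) * p * (w : ℍ[ℝ])⁻¹ = q := by
  have hsq : ∀ x : ℍ[ℝ], x.re = 0 → ‖x‖ = 1 → x * x = -1 := fun x hx hx1 => by
    have h₁ : star x = -x := by ext <;> simp [hx]
    have h₂ := Quaternion.self_mul_star x
    rw [h₁, Quaternion.normSq_eq_norm_mul_self, hx1] at h₂
    rw [← neg_eq_iff_eq_neg, ← mul_neg, h₂]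
    simp
  have hpp := hsq p hp hp1
  have hqq := hsq q hq hq1
  have hv : 1 - q * p ≠ 0 := fun h0 => h <| by
    have h₁ : q * p * p = p := by rw [← sub_eq_zero.1 h0, one_mul]
    rw [mul_assoc, hpp, mul_neg, mul_one] at h₁
    rw [← h₁, neg_neg]
  have hvp : (1 - q * p) * p = q * (1 - q * p) := by
    rw [sub_mul, mul_sub, mul_assoc, hpp, ← mul_assoc, hqq]
    simp [add_comm]
  have hv' : ‖1 - q * p‖ ≠ 0 := norm_ne_zero_iff.2 hv
  refine ⟨⟨‖1 - q * p‖⁻¹ • (1 - q * p), by simp [norm_smul, hv']⟩, ?_⟩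
  rw [mul_inv_eq_iff_eq_mul₀ (smul_ne_zero (inv_ne_zero hv') hv), smul_mul_assoc, hvp,
    mul_smul_comm]

theorem Quaternion.exists_conj_eq {p q : ℍ[ℝ]} (hp : p.re = 0) (hq : q.re = 0)
    (hp1 : ‖p‖ = 1) (hq1 : ‖q‖ = 1) :
    ∃ w : Metric.sphere (0 : ℍ[ℝ]) 1, (w : ℍ[ℝ]) * p * (w : ℍ[ℝ])⁻¹ = q := by
  by_cases h : q = -p
  -- Antipodal points are joined through a third one: `i` or `j`, according to whether the
  -- `i`-component of `p` is zero.
  · obtain ⟨u, hu, hu1, hup, hun⟩ : ∃ u : ℍ[ℝ], u.re = 0 ∧ ‖u‖ = 1 ∧ u ≠ p ∧ u ≠ -p := by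
      by_cases hi : p.imI = 0
      · refine ⟨⟨0, 1, 0, 0⟩, rfl, Quaternion.norm_eq_one_of_sq (by simp), fun h => ?_, fun h => ?_⟩
        · simp [← h] at hi
        · have := congrArg (·.imI) h
          simp [hi] at this
      · refine ⟨⟨0, 0, 1, 0⟩, rfl, Quaternion.norm_eq_one_of_sq (by simp), fun h => ?_, fun h => ?_⟩
        · simp [← h] at hi
        · have := congrArg (·.imI) h
          simp [hi] at this
    obtain ⟨w, hw⟩ := Quaternion.exists_conj_eq_of_ne_neg hp hu hp1 hu1 hun
    obtain ⟨w', hw'⟩ := Quaternion.exists_conj_eq_of_ne_neg hu hq hu1 hq1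
      (fun h' => hup (neg_injective (h'.symm.trans h)))
    exact ⟨w' * w, by rw [← hw', ← hw]; simp [mul_assoc]⟩
  · exact Quaternion.exists_conj_eq_of_ne_neg hp hq hp1 hq1 h

/-- Conjugation by `(1 + i + j + k) / 2` permutes the three axes cyclically, and adding to a vector
its conjugate by `i` leaves twice its `i`-component. So `U` contains `i`, and then `j` and `k`. -/
theorem Quaternion.eq_imSpace_of_conj_mem {U : Submodule ℝ ℍ[ℝ]} (hU : U ≠ ⊥)
    (hle : U ≤ Quaternion.imSpace)
    (hconj : ∀ w : Metric.sphere (0 : ℍ[ℝ]) 1, ∀ X ∈ U, (w : ℍ[ℝ]) * X * (w : ℍ[ℝ])⁻¹ ∈ U) :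
    U = Quaternion.imSpace := by
  have hc : ∀ w : ℍ[ℝ], w.re ^ 2 + w.imI ^ 2 + w.imJ ^ 2 + w.imK ^ 2 = 1 → ∀ X ∈ U,
      w * X * star w ∈ U := fun w hw X hX => by
    have h₁ := Quaternion.norm_eq_one_of_sq hw
    rw [← Quaternion.inv_eq_star_of_norm_eq_one h₁]
    exact hconj ⟨w, by simp [h₁]⟩ X hX
  have hrot : ∀ a b c : ℝ, (⟨0, a, b, c⟩ : ℍ[ℝ]) ∈ U → (⟨0, c, a, b⟩ : ℍ[ℝ]) ∈ U := by
    intro a b c h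
    have hw := hc ⟨1 / 2, 1 / 2, 1 / 2, 1 / 2⟩ (by norm_num) _ h
    have heq : (⟨0, c, a, b⟩ : ℍ[ℝ]) = ⟨1 / 2, 1 / 2, 1 / 2, 1 / 2⟩ * ⟨0, a, b, c⟩ *
        star ⟨1 / 2, 1 / 2, 1 / 2, 1 / 2⟩ := by
      ext <;> simp <;> ring
    rw [heq]
    exact hw
  have hflip : ∀ a b c : ℝ, (⟨0, a, b, c⟩ : ℍ[ℝ]) ∈ U → a ≠ 0 → (⟨0, 1, 0, 0⟩ : ℍ[ℝ]) ∈ U := by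
    intro a b c h ha
    have heq : (⟨0, 1, 0, 0⟩ : ℍ[ℝ]) = (2 * a)⁻¹ • (⟨0, a, b, c⟩ +
        ⟨0, 1, 0, 0⟩ * ⟨0, a, b, c⟩ * star ⟨0, 1, 0, 0⟩) := by
      ext <;> simp
      field_simp
      ring
    rw [heq]
    exact U.smul_mem _ (U.add_mem h (hc ⟨0, 1, 0, 0⟩ (by norm_num) _ h))
  have hi : (⟨0, 1, 0, 0⟩ : ℍ[ℝ]) ∈ U := by
    obtain ⟨X, hX, hX0⟩ := (Submodule.ne_bot_iff U).1 hU
    have hre : X.re = 0 := Quaternion.mem_imSpace.1 (hle hX)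
    have hX' : (⟨0, X.imI, X.imJ, X.imK⟩ : ℍ[ℝ]) ∈ U := by
      have heq : X = ⟨0, X.imI, X.imJ, X.imK⟩ := Quaternion.ext _ _ hre rfl rfl rfl
      rwa [← heq]
    by_cases h₁ : X.imI = 0
    · by_cases h₂ : X.imJ = 0
      · refine hflip _ _ _ (hrot _ _ _ hX') fun h₃ => hX0 ?_
        ext <;> simp [*]
      · exact hflip _ _ _ (hrot _ _ _ (hrot _ _ _ hX')) h₂
    · exact hflip _ _ _ hX' h₁
  have hj := hrot _ _ _ hi
  have hk := hrot _ _ _ hj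
  refine le_antisymm hle fun X hX => ?_
  have hre := Quaternion.mem_imSpace.1 hX
  have heq : X = X.imI • (⟨0, 1, 0, 0⟩ : ℍ[ℝ]) + X.imJ • (⟨0, 0, 1, 0⟩ : ℍ[ℝ]) +
      X.imK • (⟨0, 0, 0, 1⟩ : ℍ[ℝ]) := by
    ext <;> simp [hre]
  rw [heq]
  exact U.add_mem (U.add_mem (U.smul_mem _ hi) (U.smul_mem _ hj)) (U.smul_mem _ hk)

theorem Quaternion.finrank_imSpace : Module.finrank ℝ Quaternion.imSpace = 3 := by
  have : Fact (Module.finrank ℝ ℍ[ℝ] = 3 + 1) := ⟨Quaternion.finrank_eq_four⟩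
  exact Submodule.finrank_orthogonal_span_singleton one_ne_zero

theorem isSphereModel_quaternionConj {k : ℕ} (hk : 1 ≤ k) :
    IsSphereModel (OrthogonalRep.quaternionConj.prodUnitSphere k)
      {s | (s : WithLp 2 (PiLp 2 (fun _ : Fin k => ℍ[ℝ]) × Quaternion.imSpace)).fst = 0}
      (4 * k + 2) (4 * k - 1) := by
  refine isSphereModel_prodUnitSphere (r := 3) _ hk (by omega) (by omega) ?_ ?_ ?_ ?_ ?_
  · intro y y' hy hy'
    obtain ⟨w, hw⟩ := Quaternion.exists_conj_eq (Quaternion.mem_imSpace.1 y.2)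
      (Quaternion.mem_imSpace.1 y'.2) hy hy'
    exact ⟨w, Subtype.ext ((OrthogonalRep.coe_quaternionConj w y).trans hw)⟩
  · exact ⟨⟨⟨0, 1, 0, 0⟩, Quaternion.mem_imSpace.2 rfl⟩, Quaternion.norm_eq_one_of_sq (by simp)⟩
  · refine ⟨-1, fun h => ?_, fun y => ?_⟩
    · have h' : (-1 : ℍ[ℝ]) = 1 := congrArg Subtype.val h
      have := congrArg (·.re) h'
      norm_num at this
    · refine Subtype.ext ((OrthogonalRep.coe_quaternionConj _ y).trans ?_)
      simp
  · intro w hw0 hw y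
    have h₀ : HasDerivAt (fun t => (w t : ℍ[ℝ])⁻¹) 0 0 := by
      have h := (hasFDerivAt_inv' (𝕜 := ℝ)
        (norm_ne_zero_iff.1 (by simp) : (w 0 : ℍ[ℝ]) ≠ 0)).comp_hasDerivAt (0 : ℝ) hw
      rw [map_zero] at h
      exact h
    have h₁ : HasDerivAt (fun t => (w t : ℍ[ℝ]) * y * (w t : ℍ[ℝ])⁻¹) 0 0 := by
      have h := (hw.mul_const (y : ℍ[ℝ])).mul h₀
      rw [zero_mul, zero_mul, mul_zero, add_zero] at h
      exact h
    -- The derivative is computed in `ℍ` and carried back to the subspace by the orthogonal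
    -- projection, which fixes its elements.
    have h₂ := (Quaternion.imSpace.orthogonalProjectionOnto).hasFDerivAt.comp_hasDerivAt (0 : ℝ) h₁
    rw [map_zero] at h₂
    refine h₂.congr_of_eventuallyEq (Eventually.of_forall fun t => ?_)
    simp only [Function.comp_apply]
    rw [← OrthogonalRep.coe_quaternionConj]
    simp
  · intro U hU h1 hconj
    rw [Quaternion.eq_imSpace_of_conj_mem hU (fun X hX =>
      Submodule.mem_orthogonal_singleton_iff_inner_right.2 (h1 X hX)) hconj]
    exact Quaternion.finrank_imSpace

end Quaternion

/-! ### The main theorem -/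

theorem mainTheorem7 {d : ℕ} {G : Type u} [Group G] [TopologicalSpace G] [CompactSpace G] [T2Space G]
    [ChartedSpace (EuclideanSpace ℝ (Fin d)) G] [LieGroup (𝓡 d) ∞ G]
    (K : Subgroup G) (hK : IsClosed (K : Set G)) (k c : ℕ) (hk : 1 ≤ k)
    (hW : (EmbedsIn Circle (WeylGroup K) ∧ c = 2 * k) ∨
      (EmbedsIn (Matrix.specialUnitaryGroup (Fin 2) ℂ) (WeylGroup K) ∧ c = 4 * k - 1)) :
    ∃ (n : ℕ) (M : Type u) (_ : TopologicalSpace M)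
      (_ : ChartedSpace (EuclideanSpace ℝ (Fin n)) M) (_ : MulAction G M),
      IsManifold (𝓡 n) ∞ M ∧ T2Space M ∧ CompactSpace M ∧
      ContMDiffSMul (𝓡 d) (𝓡 n) ∞ G M ∧
      (MulAction.toPermHom G M).ker = K.normalCore ∧
      ConnectedSpace (MulAction.orbitRel.Quotient G M) ∧
      IsPrincipalIsotropy M K ∧
      HasCohomogeneity d n G M c ∧
      ∃! O : MulAction.orbitRel.Quotient G M, ¬ IsPrincipalOrbit O := by
  have := topologicalGroup_of_lieGroup (𝓡 d) ∞ (G := G)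
  rcases hW with ⟨hW, rfl⟩ | ⟨hW, rfl⟩
  · obtain ⟨L, π, hL, hKL, hπ, hsurj, hker⟩ := (embedsIn_circle.trans hW).exists_hom hK
    have := infinite_unitSphere (D := ℂ) (by rw [Complex.finrank_real_complex]; norm_num)
    refine exists_manifold_of_isSphereModel hK hL hKL hπ hsurj hker ?_ (isSphereModel_complexSq hk)
    rw [finrank_prodUnitSphere, Complex.finrank_real_complex]
    ring
  · obtain ⟨L, π, hL, hKL, hπ, hsurj, hker⟩ :=
      (embedsIn_specialUnitaryGroup.trans hW).exists_hom hK
    have := infinite_unitSphere (D := Quaternion ℝ) (by rw [Quaternion.finrank_eq_four]; norm_num)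
    refine exists_manifold_of_isSphereModel hK hL hKL hπ hsurj hker ?_
      (isSphereModel_quaternionConj hk)
    rw [finrank_prodUnitSphere, Quaternion.finrank_eq_four, Quaternion.finrank_imSpace]
    ring
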